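/- Let $\kappa>0$, $\alpha>0$, $\beta\ge 0$, and let $\Lambda=\frac{2\pi}{\operatorname{Im}\tau}(\mathbb Z\oplus\tau\mathbb Z)\subset\mathbb C\cong\mathbb R^2$ be a non-equilateral lattice, i.e. $\operatorname{Im}\tau>0$, $-\frac12<\operatorname{Re}\tau\le\frac12$ and $|\tau|>1$. Let $\Lambda^*=\{v\in\mathbb R^2: u\cdot v\in 2\pi\mathbb Z\ \text{for all } u\in\Lambda\}$ be the dual lattice, whose shortest nonzero vectors have length $1$, and let $\gamma=\min\{|v|: v\in\Lambda^*,\ |v|>1\}$ be the second critical wave number (so $\gamma=|\tau|$ if $|\tau|\le 2$). Let $L^2_\Lambda$ and $H^2_\Lambda$ be the $L^2$ and Sobolev spaces of $\Lambda$-periodic fields $\mathbb R^2\to\mathbb R^3$, where $L^2_\Lambda$ carries the scalar product $\langle f,g\rangle$ averaged over a primitive cell. For $\boldsymbol m=(m_1,m_2,m_3)\in H^2_\Lambda$ and $\lambda\in\mathbb R$ put $$F(\boldsymbol m,\lambda)=-\Delta\boldsymbol m+2\kappa\,\nabla\times\boldsymbol m+\lambda\boldsymbol m+\alpha|\boldsymbol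 m|^2\boldsymbol m+\beta m_3\hat{\boldsymbol e}_3,\qquad \nabla\times\boldsymbol m=(\partial_2m_3,\,-\partial_1m_3,\,\partial_1m_2-\partial_2m_1).$$ Assume that $\lambda_0:=-1-\frac\beta2+\sqrt{4\kappa^2+\frac{\beta^2}4}$ satisfies $\lambda_0>0$, the non-resonance condition $\lambda_0\ne-|v|^2-\frac\beta2\pm\sqrt{4\kappa^2|v|^2+\frac{\beta^2}4}$ for all $v\in\Lambda^*\setminus\mathbb S^1$, and $$4\kappa^2\le\sqrt{4\kappa^2+\tfrac{\beta^2}4}+\sqrt{4\kappa^2\gamma^2+\tfrac{\beta^2}4}.$$ Let $\varphi_1(x)=\sqrt{\tfrac{2}{1+A^2}}\,(A\sin x_2,\,0,\,\cos x_2)$ with $A=2\kappa\big/\big(-\tfrac\beta2+\sqrt{4\kappa^2+\tfrac{\beta^2}4}\big)$. A helical bifurcation solution is a family $(\boldsymbol m_s,\lambda_s)\in H^2_\Lambda\times\mathbb R$, $s\in(-\delta,\delta)$, $\delta>0$, that is real analytic in $s$, satisfies $F(\boldsymbol m_s,\lambda_s)=0$ for all $s$, takes the value $(0,\lambda_0)$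 at $s=0$ with $\lambda_0$ as above, has the form $\boldsymbol m_s=s\varphi_1+\psi_s$ with $\langle\psi_s,\varphi_1\rangle=0$, and is such that each $\boldsymbol m_s$ is invariant under all translations in the $x_1$-direction and under $\boldsymbol m\mapsto\operatorname{diag}(-1,-1,1)\,\boldsymbol m(-\,\cdot)$. Then a helical bifurcation solution exists, and for every helical bifurcation solution there is $\delta'\in(0,\delta]$ such that for every nonzero $s\in(-\delta',\delta')$ it is linearly stable: the operator $L_s=D_{\boldsymbol m}F(\boldsymbol m_s,\lambda_s):H^2_\Lambda\subset L^2_\Lambda\to L^2_\Lambda$, $$L_s\phi=-\Delta\phi+2\kappa\,\nabla\times\phi+\lambda_s\phi+\alpha\big(|\boldsymbol m_s|^2\phi+2(\boldsymbol m_s\cdot\phi)\boldsymbol m_s\big)+\beta\phi_3\hat{\boldsymbol e}_3,$$ satisfies $L_s\ge 0$, i.e. $\langle L_s\phi,\phi\rangle\ge0$ for all $\phi\in H^2_\Lambda$, and $\ker L_s=\operatorname{span}\{\partial_2\boldsymbol m_s\}$. -/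

import Mathlib

open MeasureTheory Set
open scoped ContDiff

noncomputable section

namespace ChiralMagnet

/-- The plane `ℝ²` (domain of the fields). -/
abbrev Plane := EuclideanSpace ℝ (Fin 2)

/-- The space `ℝ³` of magnetization vectors. -/
abbrev Spin := EuclideanSpace ℝ (Fin 3)

/-! ### Lattices -/

/-- The basis `(2π / Im τ) ê₁`, `(2π / Im τ) τ` of the lattice, with `ℂ ≅ ℝ²`. -/
def latticeVec (τ : ℂ) : Fin 2 → Plane :=
  ![(2 * Real.pi / τ.im) • !₂[(1 : ℝ), 0], (2 * Real.pi / τ.im) • !₂[τ.re, τ.im]]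

/-- The lattice `Λ = (2π / Im τ) (ℤ ⊕ τ ℤ)`. -/
def lattice (τ : ℂ) : Submodule ℤ Plane := Submodule.span ℤ (range (latticeVec τ))

/-- The dual lattice `Λ* = {v : u · v ∈ 2πℤ for all u ∈ Λ}`. -/
def dualLattice (τ : ℂ) : Set Plane :=
  {v | ∀ u ∈ lattice τ, ∃ n : ℤ, inner ℝ u v = 2 * Real.pi * n}

/-- Shape parameters of non-equilateral lattices: the points of the fundamental domain of the
modular group with `|τ| > 1`. -/
def IsNonEquilateral (τ : ℂ) : Prop :=
  0 < τ.im ∧ -(1 / 2) < τ.re ∧ τ.re ≤ 1 / 2 ∧ 1 < ‖τ‖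

/-- The second critical wave number: the smallest length larger than `1` in the dual lattice
(the smallest nonzero length being `1`). -/
def secondWaveNumber (τ : ℂ) : ℝ := sInf {r : ℝ | ∃ v ∈ dualLattice τ, 1 < ‖v‖ ∧ r = ‖v‖}

/-- The primitive cell spanned by the two basis vectors. -/
def cell (τ : ℂ) : Set Plane := parallelepiped (latticeVec τ)

/-- Normalized Lebesgue measure on the primitive cell: integrals against it are averages. -/
def cellMeasure (τ : ℂ) : Measure Plane := ProbabilityTheory.cond volume (cell τ)

instance (τ : ℂ) : IsFiniteMeasure (cellMeasure τ) := by
  unfold cellMeasure; infer_instance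

/-- `Λ`-periodicity. -/
def IsPeriodic {E : Type*} (τ : ℂ) (f : Plane → E) : Prop :=
  ∀ u ∈ lattice τ, ∀ x, f (x + u) = f x

/-! ### Function spaces -/

/-- `L²_Λ`: a `Λ`-periodic field is identified with its restriction to the primitive cell. The
inner product is the averaged one. -/
abbrev L2 (τ : ℂ) := Lp Spin 2 (cellMeasure τ)

/-- `v` is the weak partial derivative `∂ᵢ u`, tested against smooth `Λ`-periodic functions. -/
def IsWeakDeriv (τ : ℂ) (i : Fin 2) (u v : L2 τ) : Prop :=
  ∀ ψ : Plane → ℝ, ContDiff ℝ ∞ ψ → IsPeriodic τ ψ →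
    ∫ x, fderiv ℝ ψ x (EuclideanSpace.single i 1) • u x ∂(cellMeasure τ)
      = -∫ x, ψ x • v x ∂(cellMeasure τ)

lemma isCompact_cell (τ : ℂ) : IsCompact (cell τ) := by
  unfold cell parallelepiped
  exact isCompact_Icc.image (by fun_prop)

lemma integrable_smul_cell (τ : ℂ) {g : Plane → ℝ} (hg : Continuous g) (u : L2 τ) :
    Integrable (fun x => g x • u x) (cellMeasure τ) := by
  have hu : Integrable u (cellMeasure τ) := (Lp.memLp u).integrable (by norm_num)
  obtain ⟨C, hC⟩ := (isCompact_cell τ).exists_bound_of_continuousOn hg.continuousOn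
  refine hu.bdd_smul C hg.aestronglyMeasurable ?_
  have hm : MeasurableSet (cell τ) := (isCompact_cell τ).isClosed.measurableSet
  unfold cellMeasure ProbabilityTheory.cond
  exact Measure.ae_smul_measure ((ae_restrict_iff' hm).2 (Filter.Eventually.of_forall hC)) _

lemma IsWeakDeriv.zero (τ : ℂ) (i : Fin 2) : IsWeakDeriv τ i 0 0 := by
  intro ψ _ _
  have h : (⇑(0 : L2 τ)) =ᵐ[cellMeasure τ] 0 := Lp.coeFn_zero _ _ _
  rw [integral_eq_zero_of_ae, integral_eq_zero_of_ae, neg_zero]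
  · filter_upwards [h] with x hx using by rw [hx]; simp
  · filter_upwards [h] with x hx using by rw [hx]; simp

lemma IsWeakDeriv.add {τ : ℂ} {i : Fin 2} {u v u' v' : L2 τ} (h : IsWeakDeriv τ i u v)
    (h' : IsWeakDeriv τ i u' v') : IsWeakDeriv τ i (u + u') (v + v') := by
  intro ψ hψ hp
  have hc : Continuous fun x => fderiv ℝ ψ x (EuclideanSpace.single i (1 : ℝ)) :=
    (hψ.continuous_fderiv (by simp)).clm_apply continuous_const
  have e1 : ∫ x, fderiv ℝ ψ x (EuclideanSpace.single i 1) • (u + u') x ∂(cellMeasure τ)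
      = ∫ x, (fderiv ℝ ψ x (EuclideanSpace.single i 1) • u x
        + fderiv ℝ ψ x (EuclideanSpace.single i 1) • u' x) ∂(cellMeasure τ) := by
    refine integral_congr_ae ?_
    filter_upwards [Lp.coeFn_add u u'] with x hx using by rw [hx, Pi.add_apply, smul_add]
  have e2 : ∫ x, ψ x • (v + v') x ∂(cellMeasure τ)
      = ∫ x, (ψ x • v x + ψ x • v' x) ∂(cellMeasure τ) := by
    refine integral_congr_ae ?_
    filter_upwards [Lp.coeFn_add v v'] with x hx using by rw [hx, Pi.add_apply, smul_add]
  rw [e1, e2, integral_add (integrable_smul_cell τ hc u) (integrable_smul_cell τ hc u'),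
    integral_add (integrable_smul_cell τ hψ.continuous v)
      (integrable_smul_cell τ hψ.continuous v'), h ψ hψ hp, h' ψ hψ hp, neg_add]

lemma IsWeakDeriv.smul {τ : ℂ} {i : Fin 2} {u v : L2 τ} (c : ℝ) (h : IsWeakDeriv τ i u v) :
    IsWeakDeriv τ i (c • u) (c • v) := by
  intro ψ hψ hp
  have e1 : ∫ x, fderiv ℝ ψ x (EuclideanSpace.single i 1) • (c • u) x ∂(cellMeasure τ)
      = ∫ x, c • (fderiv ℝ ψ x (EuclideanSpace.single i 1) • u x) ∂(cellMeasure τ) := by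
    refine integral_congr_ae ?_
    filter_upwards [Lp.coeFn_smul c u] with x hx using by
      rw [hx, Pi.smul_apply, smul_comm]
  have e2 : ∫ x, ψ x • (c • v) x ∂(cellMeasure τ)
      = ∫ x, c • (ψ x • v x) ∂(cellMeasure τ) := by
    refine integral_congr_ae ?_
    filter_upwards [Lp.coeFn_smul c v] with x hx using by
      rw [hx, Pi.smul_apply, smul_comm]
  rw [e1, e2, integral_smul, integral_smul, h ψ hψ hp, smul_neg]

/-- The Sobolev space `H²_Λ`. An element is a field `u ∈ L²_Λ` stored together with its weak
derivatives `∂ᵢ u`, `∂ⱼ ∂ᵢ u ∈ L²_Λ` (which `u` determines). The norm induced from the product is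
equivalent to the usual `H²` norm. -/
def H2 (τ : ℂ) : Submodule ℝ (L2 τ × (Fin 2 → L2 τ) × (Fin 2 → Fin 2 → L2 τ)) where
  carrier := {p | (∀ i, IsWeakDeriv τ i p.1 (p.2.1 i)) ∧
    ∀ i j, IsWeakDeriv τ j (p.2.1 i) (p.2.2 i j)}
  add_mem' hp hq := ⟨fun i => (hp.1 i).add (hq.1 i), fun i j => (hp.2 i j).add (hq.2 i j)⟩
  zero_mem' := ⟨fun i => IsWeakDeriv.zero τ i, fun _ j => IsWeakDeriv.zero τ j⟩
  smul_mem' c _ hp := ⟨fun i => (hp.1 i).smul c, fun i j => (hp.2 i j).smul c⟩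

/-- The underlying field of an element of `H²_Λ`. -/
def fld {τ : ℂ} (m : H2 τ) : L2 τ := m.1.1

/-- The first derivative `∂ᵢ m`. -/
def pd {τ : ℂ} (m : H2 τ) (i : Fin 2) : L2 τ := m.1.2.1 i

/-- The second derivative `∂ⱼ ∂ᵢ m`. -/
def pdd {τ : ℂ} (m : H2 τ) (i j : Fin 2) : L2 τ := m.1.2.2 i j

/-! ### The Euler-Lagrange operator and its linearization -/

/-- The Laplacian of `m`. -/
def lap {τ : ℂ} (m : H2 τ) (x : Plane) : Spin := pdd m 0 0 x + pdd m 1 1 x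

/-- The curl `(∂₂ m₃, -∂₁ m₃, ∂₁ m₂ - ∂₂ m₁)` of a field on the plane. -/
def curl {τ : ℂ} (m : H2 τ) (x : Plane) : Spin :=
  !₂[pd m 1 x 2, -(pd m 0 x 2), pd m 0 x 1 - pd m 1 x 0]

/-- `F(m, λ) = -Δm + 2κ ∇ × m + λ m + α |m|² m + β m₃ ê₃`, as an almost everywhere defined
field. -/
def eulerLagrange (κ α β lam : ℝ) {τ : ℂ} (m : H2 τ) (x : Plane) : Spin :=
  -lap m x + (2 * κ) • curl m x + lam • fld m x + (α * ‖fld m x‖ ^ 2) • fld m x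
    + (β * fld m x 2) • EuclideanSpace.single 2 1

/-- The linearization `D_m F(m, λ) φ
= -Δφ + 2κ ∇ × φ + λ φ + α (|m|² φ + 2 (m · φ) m) + β φ₃ ê₃`. -/
def linearization (κ α β lam : ℝ) {τ : ℂ} (m φ : H2 τ) (x : Plane) : Spin :=
  -lap φ x + (2 * κ) • curl φ x + lam • fld φ x
    + α • (‖fld m x‖ ^ 2 • fld φ x + (2 * inner ℝ (fld m x) (fld φ x)) • fld m x)
    + (β * fld φ x 2) • EuclideanSpace.single 2 1

/-- The kernel of `D_m F(m, λ) : H²_Λ ⊂ L²_Λ → L²_Λ`, as a subset of `L²_Λ`. -/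
def linearizationKer (κ α β lam : ℝ) {τ : ℂ} (m : H2 τ) : Set (L2 τ) :=
  {u | ∃ φ : H2 τ, fld φ = u ∧ linearization κ α β lam m φ =ᵐ[cellMeasure τ] 0}

/-- The linearization `L = D_m F(m, λ)` maps `H²_Λ` to `L²_Λ` and `⟨L φ, φ⟩ ≥ 0` for all
`φ ∈ H²_Λ`. -/
def LinearizationNonneg (κ α β lam : ℝ) {τ : ℂ} (m : H2 τ) : Prop :=
  ∀ φ : H2 τ, MemLp (linearization κ α β lam m φ) 2 (cellMeasure τ) ∧
    0 ≤ ∫ x, inner ℝ (linearization κ α β lam m φ x) (fld φ x) ∂(cellMeasure τ)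

/-! ### The helical bifurcation branch -/

/-- The bifurcation point `λ₀ = -1 - β/2 + √(4κ² + β²/4)`. -/
def lam0 (κ β : ℝ) : ℝ := -1 - β / 2 + Real.sqrt (4 * κ ^ 2 + β ^ 2 / 4)

/-- The non-resonance condition: `λ₀ ≠ -|v|² - β/2 ± √(4κ²|v|² + β²/4)` for all
`v ∈ Λ* ∖ 𝕊¹`. -/
def NonResonant (κ β : ℝ) (τ : ℂ) : Prop :=
  ∀ v ∈ dualLattice τ, ‖v‖ ≠ 1 →
    lam0 κ β ≠ -‖v‖ ^ 2 - β / 2 + Real.sqrt (4 * κ ^ 2 * ‖v‖ ^ 2 + β ^ 2 / 4) ∧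
    lam0 κ β ≠ -‖v‖ ^ 2 - β / 2 - Real.sqrt (4 * κ ^ 2 * ‖v‖ ^ 2 + β ^ 2 / 4)

/-- The amplitude `A = 2κ / (-β/2 + √(4κ² + β²/4))`. -/
def amplitude (κ β : ℝ) : ℝ := 2 * κ / (-(β / 2) + Real.sqrt (4 * κ ^ 2 + β ^ 2 / 4))

/-- The helical mode `φ₁(x) = √(2 / (1 + A²)) (A sin x₂, 0, cos x₂)`. -/
def helicalMode (κ β : ℝ) (x : Plane) : Spin :=
  Real.sqrt (2 / (1 + amplitude κ β ^ 2)) •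
    !₂[amplitude κ β * Real.sin (x 1), 0, Real.cos (x 1)]

/-- Invariance of `u ∈ L²_Λ` under the group generated by the translations in the
`x₁`-direction and the rotation by `π`, which acts by `m ↦ diag(-1, -1, 1) m(-x)`. -/
def IsHelicallySymmetric {τ : ℂ} (u : L2 τ) : Prop :=
  ∃ f : Plane → Spin, IsPeriodic τ f ∧ f =ᵐ[cellMeasure τ] u ∧
    (∀ t : ℝ, (fun x => f (x - t • EuclideanSpace.single 0 1)) =ᵐ[volume] f) ∧
    (fun x => (!₂[-(f (-x) 0), -(f (-x) 1), f (-x) 2] : Spin)) =ᵐ[volume] f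

/-- `(m_s, λ_s)`, `|s| < δ`, is the helical bifurcation solution: a real analytic curve in
`H²_Λ × ℝ` of helically symmetric solutions of `F(m_s, λ_s) = 0` emanating from `(0, λ₀)`, with
`m_s = s φ₁ + ψ_s` where `ψ_0 = 0` and `ψ_s` is `L²_Λ`-orthogonal to `φ₁`. -/
structure IsHelicalBranch (κ α β : ℝ) (τ : ℂ) (δ : ℝ) (m : ℝ → H2 τ) (lam : ℝ → ℝ) : Prop where
  pos : 0 < δ
  analytic_m : AnalyticOnNhd ℝ m (Ioo (-δ) δ)
  analytic_lam : AnalyticOnNhd ℝ lam (Ioo (-δ) δ)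
  m_zero : m 0 = 0
  lam_zero : lam 0 = lam0 κ β
  solution : ∀ s ∈ Ioo (-δ) δ, eulerLagrange κ α β (lam s) (m s) =ᵐ[cellMeasure τ] 0
  orthogonal : ∀ s ∈ Ioo (-δ) δ,
    ∫ x, inner ℝ (fld (m s) x - s • helicalMode κ β x) (helicalMode κ β x) ∂(cellMeasure τ) = 0
  symmetric : ∀ s ∈ Ioo (-δ) δ, IsHelicallySymmetric (fld (m s))

end ChiralMagnet

end

open MeasureTheory Set
open scoped ContDiff BoundedContinuousFunction Topology

noncomputable section

namespace ChiralMagnet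

/-! ### The lattice and the averaged integral over the primitive cell -/

/-! Everything linear is done on Fourier coefficients. At $\lambda=\lambda_0$ the linear part
`linPart` acts on the mode with wave vector $v$ by a symbol whose lowest eigenvalue is
$|v|^2+\lambda_0+\beta/2-\sqrt{4\kappa^2|v|^2+\beta^2/4}$ (`dispersion`), which vanishes at $|v|=1$.
Since $|\tau|>1$, the only dual vectors of length $1$ are $\pm e_2$. For $v=0$ the value is
$\lambda_0>0$; for $|v|\ge\gamma$ the inequality on $4\kappa^2$ gives nonnegativity
(`dispersion_nonneg`) and non-resonance makes it strict. Quadratic growth then yields a uniform gap,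
so the form of `linPart` is coercive in $L^2$ on the orthogonal complement of $\varphi_1$ and
$\varphi_2=\partial_2\varphi_1$ (`Admissible.exists_coercive`).

Existence. Helical symmetry excludes $\varphi_2$, so within the symmetric class the critical
direction is simple. With $m=s(\varphi_1+w)$, $\lambda=\lambda_0+\mu$, the equation divided by $s$
is an analytic equation in $(s,w,\mu)$ whose derivative in $(w,\mu)$ at the origin is
$(w,\mu)\mapsto L_0w+\mu\varphi_1$. Coercivity and an elliptic estimate bound this map from below,
its range has trivial orthogonal complement in the symmetric class, and the analytic implicit
function theorem applies (`Admissible.exists_branch`).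

Stability. For an arbitrary branch, $z_s=m_s/s$ tends to $\varphi_1$ in $H^2$
(`IsHelicalBranch.tendsto`). Pairing the equation with $\varphi_1$ gives
$\lambda_s-\lambda_0=-s^2\alpha\langle|z_s|^2z_s,\varphi_1\rangle$, hence $L_s=L_0+s^2B_s$ with
$B_s$ bounded on $L^2$ and convergent (`secondVar`). In the limit $\langle
B\varphi_1,\varphi_1\rangle=(3-1)\alpha\int|\varphi_1|^4>0$. The field $\partial_2m_s$ lies in $\ker
L_s$ by translation invariance and is close to $s\varphi_2$, so it can replace $\varphi_2$ in the
decomposition of the space. It remains to see that $L_s$ is positive on $\varphi_1$ plus the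
complement: $\varphi_1$ contributes order $s^2$, the complement contributes a fixed constant, and
the cross terms of order $s^2$ are absorbed by Young's inequality. Nonnegativity and the exact
kernel follow together (`stable_of_positive`).

The cubic term is handled on fields independent of $x_1$. There the modes are indexed by one integer
$k$ and decay like $k^{-2}$ in terms of the $H^2$ norm, so the Fourier series converges uniformly
and $|m|^2m$ becomes a polynomial in bounded linear maps into bounded continuous functions (`toBCF`,
`cub`). -/

lemma linearIndependent_latticeVec (τ : ℂ) [hτ : Fact (0 < τ.im)] :
    LinearIndependent ℝ (latticeVec τ) := by
  have h0 := hτ.out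
  have hpi := Real.pi_pos
  have hc : 2 * Real.pi / τ.im ≠ 0 := by positivity
  rw [latticeVec, LinearIndependent.pair_iff' (by
    intro h
    have := congrArg (fun x : Plane => x 0) h
    simp at this
    exact h0.ne' this)]
  intro a h
  have := congrArg (fun x : Plane => x 1) h
  simp at this
  exact h0.ne' this

/-- The basis of the plane that spans the lattice. -/
def latticeBasis (τ : ℂ) [Fact (0 < τ.im)] : Module.Basis (Fin 2) ℝ Plane :=
  basisOfLinearIndependentOfCardEqFinrank (linearIndependent_latticeVec τ) (by simp)

lemma coe_latticeBasis (τ : ℂ) [Fact (0 < τ.im)] : ⇑(latticeBasis τ) = latticeVec τ := by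
  simp [latticeBasis]

lemma lattice_eq_span (τ : ℂ) [Fact (0 < τ.im)] :
    lattice τ = Submodule.span ℤ (range (latticeBasis τ)) := by
  rw [coe_latticeBasis]; rfl

lemma latticeBasis_repr_one {τ : ℂ} [hτ : Fact (0 < τ.im)] (x : Plane) :
    (latticeBasis τ).repr x 1 = x 1 / (2 * Real.pi) := by
  have h0 := hτ.out
  have hpi := Real.pi_pos
  have h := congrArg (fun y : Plane => y 1) ((latticeBasis τ).sum_repr x)
  simp [Fin.sum_univ_two, coe_latticeBasis, latticeVec] at h
  rw [← h]
  field_simp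

lemma latticeBasis_repr_zero {τ : ℂ} [hτ : Fact (0 < τ.im)] (x : Plane) :
    (latticeBasis τ).repr x 0 = (τ.im * x 0 - τ.re * x 1) / (2 * Real.pi) := by
  have h0 := hτ.out
  have hpi := Real.pi_pos
  have h := congrArg (fun y : Plane => y 0) ((latticeBasis τ).sum_repr x)
  simp [Fin.sum_univ_two, coe_latticeBasis, latticeVec, latticeBasis_repr_one] at h
  rw [← h]
  field_simp
  ring

lemma cell_eq_preimage (τ : ℂ) [Fact (0 < τ.im)] :
    cell τ = (latticeBasis τ).equivFunL ⁻¹' Icc 0 1 := by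
  rw [cell, ← coe_latticeBasis, parallelepiped_basis_eq]
  ext x
  simp [Pi.le_def, forall_and, Module.Basis.equivFunL]

lemma exists_map_volume_eq (τ : ℂ) [Fact (0 < τ.im)] : ∃ c : ENNReal, c ≠ 0 ∧ c ≠ ⊤ ∧
    (volume : Measure Plane).map (latticeBasis τ).equivFunL
      = c • (volume : Measure (Fin 2 → ℝ)) := by
  have : ((volume : Measure Plane).map (latticeBasis τ).equivFunL).IsAddHaarMeasure :=
    (latticeBasis τ).equivFunL.isAddHaarMeasure_map _
  refine ⟨_, ?_, ?_, Measure.isAddLeftInvariant_eq_smul _ _⟩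
  · have := Measure.addHaarScalarFactor_pos_of_isAddHaarMeasure
      ((volume : Measure Plane).map (latticeBasis τ).equivFunL) (volume : Measure (Fin 2 → ℝ))
    exact_mod_cast this.ne'
  · exact ENNReal.coe_ne_top

lemma map_cellMeasure (τ : ℂ) [Fact (0 < τ.im)] :
    (cellMeasure τ).map (latticeBasis τ).equivFunL
      = (volume : Measure (Fin 2 → ℝ)).restrict (Icc 0 1) := by
  obtain ⟨c, hc0, hct, hc⟩ := exists_map_volume_eq τ
  have hm : Measurable (latticeBasis τ).equivFunL :=
    (latticeBasis τ).equivFunL.continuous.measurable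
  have h1 : ((volume : Measure Plane).restrict (cell τ)).map (latticeBasis τ).equivFunL
      = c • (volume : Measure (Fin 2 → ℝ)).restrict (Icc 0 1) := by
    rw [cell_eq_preimage, ← Measure.restrict_map hm measurableSet_Icc, hc,
      Measure.restrict_smul]
  have h2 : volume (cell τ) = c := by
    have := congrArg (fun μ : Measure (Fin 2 → ℝ) => μ univ) h1
    simpa [Measure.map_apply hm, Real.volume_Icc_pi] using this
  rw [cellMeasure, ProbabilityTheory.cond, Measure.map_smul, h1, h2, smul_smul,
    ENNReal.inv_mul_cancel hc0 hct, one_smul]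

instance (τ : ℂ) [Fact (0 < τ.im)] : IsProbabilityMeasure (cellMeasure τ) := by
  constructor
  have h := congrArg (fun μ : Measure (Fin 2 → ℝ) => μ univ) (map_cellMeasure τ)
  simpa [Measure.map_apply (latticeBasis τ).equivFunL.continuous.measurable,
    Real.volume_Icc_pi] using h

lemma cellMeasure_eq_smul_restrict (τ : ℂ) [Fact (0 < τ.im)] :
    cellMeasure τ = (volume (cell τ))⁻¹ •
      (volume : Measure Plane).restrict (ZSpan.fundamentalDomain (latticeBasis τ)) := by
  rw [cellMeasure, ProbabilityTheory.cond, cell, ← coe_latticeBasis,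
    Measure.restrict_congr_set (ZSpan.fundamentalDomain_ae_parallelepiped _ volume)]

instance (τ : ℂ) [Fact (0 < τ.im)] :
    Countable (Submodule.span ℤ (range (latticeBasis τ))).toAddSubgroup :=
  inferInstanceAs (Countable (Submodule.span ℤ (range (latticeBasis τ))))

/-- Freedom in the choice of fundamental domain: translating or reflecting the cell gives another
one, which is how averages of periodic functions become invariant under all translations and under
$x\mapsto-x$. -/
lemma integral_cellMeasure_eq {E : Type*} [NormedAddCommGroup E] [NormedSpace ℝ E] {τ : ℂ}
    [Fact (0 < τ.im)] {D : Set Plane}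
    (hD : IsAddFundamentalDomain (Submodule.span ℤ (range (latticeBasis τ))).toAddSubgroup D
      (volume : Measure Plane))
    {f : Plane → E} (hf : IsPeriodic τ f) :
    ∫ x, f x ∂(cellMeasure τ) = (volume (cell τ))⁻¹.toReal • ∫ x in D, f x := by
  rw [cellMeasure_eq_smul_restrict, integral_smul_measure]
  congr 1
  refine (ZSpan.isAddFundamentalDomain' (latticeBasis τ) volume).setIntegral_eq hD fun g x => ?_
  have hg : (g : Plane) ∈ lattice τ := by rw [lattice_eq_span]; exact g.2
  rw [← hf _ hg x, add_comm]; rfl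

lemma IsPeriodic.comp_add {E : Type*} {τ : ℂ} {f : Plane → E} (hf : IsPeriodic τ f) (a : Plane) :
    IsPeriodic τ fun x => f (x + a) := fun u hu x => by
  change f (x + u + a) = f (x + a)
  rw [add_right_comm, hf u hu]

lemma IsPeriodic.comp_neg {E : Type*} {τ : ℂ} {f : Plane → E} (hf : IsPeriodic τ f) :
    IsPeriodic τ fun x => f (-x) := fun u hu x => by
  change f (-(x + u)) = f (-x)
  rw [neg_add, hf (-u) (neg_mem hu)]

lemma integral_comp_add {E : Type*} [NormedAddCommGroup E] [NormedSpace ℝ E] {τ : ℂ}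
    [Fact (0 < τ.im)] {f : Plane → E} (hf : IsPeriodic τ f) (a : Plane) :
    ∫ x, f (x + a) ∂(cellMeasure τ) = ∫ x, f x ∂(cellMeasure τ) := by
  have h := ZSpan.isAddFundamentalDomain' (latticeBasis τ) (volume : Measure Plane)
  have hm : MeasurePreserving (fun x : Plane => x + a) volume volume :=
    measurePreserving_add_right volume a
  have h' := h.image_of_equiv (Equiv.addRight a)
    (measurePreserving_add_right volume (-a)).quasiMeasurePreserving
    (Equiv.refl _) (fun g x => by
      change (g : Plane) + x + a = g + (x + a)
      rw [add_assoc])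
  rw [integral_cellMeasure_eq h (hf.comp_add a), integral_cellMeasure_eq h' hf]
  congr 1
  exact (hm.setIntegral_image_emb (MeasurableEquiv.addRight a).measurableEmbedding f _).symm

lemma integral_comp_neg {E : Type*} [NormedAddCommGroup E] [NormedSpace ℝ E] {τ : ℂ}
    [Fact (0 < τ.im)] {f : Plane → E} (hf : IsPeriodic τ f) :
    ∫ x, f (-x) ∂(cellMeasure τ) = ∫ x, f x ∂(cellMeasure τ) := by
  have h := ZSpan.isAddFundamentalDomain' (latticeBasis τ) (volume : Measure Plane)
  have hm : MeasurePreserving (fun x : Plane => -x) volume volume :=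
    Measure.measurePreserving_neg volume
  have h' := h.image_of_equiv (Equiv.neg Plane) hm.quasiMeasurePreserving
    (Equiv.neg _) (fun g x => by
      change -((-g : (Submodule.span ℤ (range (latticeBasis τ))).toAddSubgroup) + x : Plane)
        = g + (-x)
      simp [add_comm])
  rw [integral_cellMeasure_eq h hf.comp_neg, integral_cellMeasure_eq h' hf]
  congr 1
  exact (hm.setIntegral_image_emb (MeasurableEquiv.neg Plane).measurableEmbedding f _).symm

lemma IsPeriodic.exists_bound {E : Type*} [NormedAddCommGroup E] {τ : ℂ} [Fact (0 < τ.im)]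
    {f : Plane → E} (hf : IsPeriodic τ f) (hc : Continuous f) : ∃ C, ∀ x, ‖f x‖ ≤ C := by
  obtain ⟨C, hC⟩ := (isCompact_cell τ).exists_bound_of_continuousOn hc.continuousOn
  refine ⟨C, fun x => ?_⟩
  have hx := hf (ZSpan.floor (latticeBasis τ) x) (by rw [lattice_eq_span]; exact SetLike.coe_mem _)
    (ZSpan.fract (latticeBasis τ) x)
  rw [ZSpan.fract_apply, sub_add_cancel] at hx
  rw [hx]
  refine hC _ ?_
  rw [cell, ← coe_latticeBasis]
  exact ZSpan.fundamentalDomain_subset_parallelepiped _ (ZSpan.fract_mem_fundamentalDomain _ _)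

lemma cellMeasure_absolutelyContinuous (τ : ℂ) : cellMeasure τ ≪ volume :=
  ProbabilityTheory.cond_absolutelyContinuous

/-! ### Fourier modes of `L²_Λ` -/

/-- The element of `L²_Λ` given by a square integrable field (`0` for other fields). -/
def toL2 (τ : ℂ) (f : Plane → Spin) : L2 τ :=
  open Classical in if h : MemLp f 2 (cellMeasure τ) then h.toLp f else 0

lemma coeFn_toL2_of_memLp {τ : ℂ} {f : Plane → Spin} (h : MemLp f 2 (cellMeasure τ)) :
    toL2 τ f =ᵐ[cellMeasure τ] f := by
  rw [toL2, dif_pos h]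
  exact h.coeFn_toLp

lemma memLp_of_continuous {E : Type*} [NormedAddCommGroup E] [SecondCountableTopology E] (τ : ℂ)
    {f : Plane → E} (hf : Continuous f) : MemLp f 2 (cellMeasure τ) := by
  obtain ⟨C, hC⟩ := (isCompact_cell τ).exists_bound_of_continuousOn hf.continuousOn
  refine MemLp.of_bound hf.aestronglyMeasurable C ?_
  have hm : MeasurableSet (cell τ) := (isCompact_cell τ).isClosed.measurableSet
  unfold cellMeasure ProbabilityTheory.cond
  exact Measure.ae_smul_measure ((ae_restrict_iff' hm).2 (Filter.Eventually.of_forall hC)) _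

lemma coeFn_toL2 (τ : ℂ) {f : Plane → Spin} (h : Continuous f) :
    toL2 τ f =ᵐ[cellMeasure τ] f :=
  coeFn_toL2_of_memLp (memLp_of_continuous τ h)

lemma toL2_eq_of_ae {τ : ℂ} {f : Plane → Spin} {u : L2 τ} (h : f =ᵐ[cellMeasure τ] u) :
    toL2 τ f = u :=
  Lp.ext ((coeFn_toL2_of_memLp ((memLp_congr_ae h).2 (Lp.memLp u))).trans h)

lemma inner_eq_integral {τ : ℂ} {u v : L2 τ} {f g : Plane → Spin} (hf : u =ᵐ[cellMeasure τ] f)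
    (hg : v =ᵐ[cellMeasure τ] g) :
    inner ℝ u v = ∫ x, inner ℝ (f x) (g x) ∂(cellMeasure τ) := by
  rw [L2.inner_def]
  refine integral_congr_ae ?_
  filter_upwards [hf, hg] with x hx hx' using by rw [hx, hx']

/-- The vectors of the dual lattice. -/
def waveVec (τ : ℂ) (n : Fin 2 → ℤ) : Plane := !₂[n 0 * τ.im, n 1 - n 0 * τ.re]

/-- The phase `v · x` of the Fourier mode with wave vector `v`. -/
def phase (τ : ℂ) (n : Fin 2 → ℤ) : Plane →L[ℝ] ℝ := innerSL ℝ (waveVec τ n)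

lemma phase_apply (τ : ℂ) (n : Fin 2 → ℤ) (x : Plane) :
    phase τ n x = n 0 * τ.im * x 0 + (n 1 - n 0 * τ.re) * x 1 := by
  simp [phase, waveVec, PiLp.inner_apply, Fin.sum_univ_two, mul_comm]

/-- In lattice coordinates the phase is that of a standard torus character; periodicity of the modes
and the transport to `UnitAddTorus` both rest on this. -/
lemma phase_eq {τ : ℂ} [hτ : Fact (0 < τ.im)] (n : Fin 2 → ℤ) (x : Plane) :
    phase τ n x = 2 * Real.pi *
      (n 0 * (latticeBasis τ).repr x 0 + n 1 * (latticeBasis τ).repr x 1) := by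
  have hpi := Real.pi_pos
  rw [phase_apply, latticeBasis_repr_one, latticeBasis_repr_zero]
  field_simp
  ring

lemma exists_phase_eq_of_mem_lattice {τ : ℂ} [hτ : Fact (0 < τ.im)] (n : Fin 2 → ℤ) {u : Plane}
    (hu : u ∈ lattice τ) : ∃ k : ℤ, phase τ n u = k * (2 * Real.pi) := by
  rw [lattice_eq_span, Module.Basis.mem_span_iff_repr_mem] at hu
  obtain ⟨a, ha⟩ := hu 0
  obtain ⟨b, hb⟩ := hu 1
  refine ⟨n 0 * a + n 1 * b, ?_⟩
  rw [phase_eq, ← ha, ← hb]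
  simp
  ring

lemma isPeriodic_cos (τ : ℂ) [Fact (0 < τ.im)] (n : Fin 2 → ℤ) :
    IsPeriodic τ fun x => Real.cos (phase τ n x) := by
  intro u hu x
  obtain ⟨k, hk⟩ := exists_phase_eq_of_mem_lattice n hu
  simp only [map_add, hk, Real.cos_add_int_mul_two_pi]

lemma isPeriodic_sin (τ : ℂ) [Fact (0 < τ.im)] (n : Fin 2 → ℤ) :
    IsPeriodic τ fun x => Real.sin (phase τ n x) := by
  intro u hu x
  obtain ⟨k, hk⟩ := exists_phase_eq_of_mem_lattice n hu
  simp only [map_add, hk, Real.sin_add_int_mul_two_pi]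

lemma contDiff_cos_phase (τ : ℂ) (n : Fin 2 → ℤ) :
    ContDiff ℝ ∞ fun x => Real.cos (phase τ n x) :=
  Real.contDiff_cos.comp (phase τ n).contDiff

lemma contDiff_sin_phase (τ : ℂ) (n : Fin 2 → ℤ) :
    ContDiff ℝ ∞ fun x => Real.sin (phase τ n x) :=
  Real.contDiff_sin.comp (phase τ n).contDiff

/-- The projection of `u` to the Fourier mode given by the weight `g`. -/
def weightedMean (τ : ℂ) (g : Plane → ℝ) : L2 τ →L[ℝ] Spin :=
  ∑ j : Fin 3, (innerSL ℝ (toL2 τ fun x => g x • EuclideanSpace.single j (1 : ℝ))).smulRight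
    (EuclideanSpace.single j (1 : ℝ))

lemma inner_toL2_smul {τ : ℂ} {g : Plane → ℝ} (hg : Continuous g) (a : Spin) (u : L2 τ) :
    inner ℝ (toL2 τ fun x => g x • a) u = inner ℝ a (∫ x, g x • u x ∂(cellMeasure τ)) := by
  rw [inner_eq_integral (coeFn_toL2 τ (by fun_prop)) (Filter.EventuallyEq.refl _ u),
    ← integral_inner (integrable_smul_cell τ hg u)]
  simp [real_inner_smul_left, real_inner_smul_right]

lemma weightedMean_apply {τ : ℂ} {g : Plane → ℝ} (hg : Continuous g) (u : L2 τ) :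
    weightedMean τ g u = ∫ x, g x • u x ∂(cellMeasure τ) := by
  ext j
  simp [weightedMean, inner_toL2_smul hg, Finset.sum_apply, Pi.single_apply,
    EuclideanSpace.inner_single_left]

/-- The cosine coefficient `∫ cos(v · x) u(x)`. -/
def cosCoeff (τ : ℂ) (n : Fin 2 → ℤ) : L2 τ →L[ℝ] Spin :=
  weightedMean τ fun x => Real.cos (phase τ n x)

/-- The sine coefficient `∫ sin(v · x) u(x)`. -/
def sinCoeff (τ : ℂ) (n : Fin 2 → ℤ) : L2 τ →L[ℝ] Spin :=
  weightedMean τ fun x => Real.sin (phase τ n x)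

lemma cosCoeff_apply {τ : ℂ} (n : Fin 2 → ℤ) (u : L2 τ) :
    cosCoeff τ n u = ∫ x, Real.cos (phase τ n x) • u x ∂(cellMeasure τ) :=
  weightedMean_apply (by fun_prop) u

lemma sinCoeff_apply {τ : ℂ} (n : Fin 2 → ℤ) (u : L2 τ) :
    sinCoeff τ n u = ∫ x, Real.sin (phase τ n x) • u x ∂(cellMeasure τ) :=
  weightedMean_apply (by fun_prop) u

/-- The Fourier mode `cos(v · x) a + sin(v · x) b`. -/
def mode (τ : ℂ) (n : Fin 2 → ℤ) (a b : Spin) (x : Plane) : Spin :=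
  Real.cos (phase τ n x) • a + Real.sin (phase τ n x) • b

lemma continuous_mode (τ : ℂ) (n : Fin 2 → ℤ) (a b : Spin) : Continuous (mode τ n a b) := by
  unfold mode; fun_prop

lemma toL2_add {τ : ℂ} {f g : Plane → Spin} (hf : Continuous f) (hg : Continuous g) :
    toL2 τ (fun x => f x + g x) = toL2 τ f + toL2 τ g := by
  refine toL2_eq_of_ae ?_
  filter_upwards [Lp.coeFn_add (toL2 τ f) (toL2 τ g), coeFn_toL2 τ hf, coeFn_toL2 τ hg]
    with x h1 h2 h3
  rw [h1, Pi.add_apply, h2, h3]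

lemma toL2_smul {τ : ℂ} {f : Plane → Spin} (c : ℝ) (hf : Continuous f) :
    toL2 τ (fun x => c • f x) = c • toL2 τ f := by
  refine toL2_eq_of_ae ?_
  filter_upwards [Lp.coeFn_smul c (toL2 τ f), coeFn_toL2 τ hf] with x h1 h2
  rw [h1, Pi.smul_apply, h2]

lemma inner_toL2_mode {τ : ℂ} (n : Fin 2 → ℤ) (a b : Spin) (u : L2 τ) :
    inner ℝ (toL2 τ (mode τ n a b)) u
      = inner ℝ a (cosCoeff τ n u) + inner ℝ b (sinCoeff τ n u) := by
  unfold mode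
  rw [toL2_add (by fun_prop) (by fun_prop), inner_add_left, inner_toL2_smul (by fun_prop),
    inner_toL2_smul (by fun_prop), cosCoeff_apply, sinCoeff_apply]

/-! ### Completeness of the Fourier modes -/

section Torus

local instance : MeasureSpace UnitAddCircle := ⟨AddCircle.haarAddCircle⟩

local instance : IsProbabilityMeasure (volume : Measure UnitAddCircle) :=
  inferInstanceAs (IsProbabilityMeasure AddCircle.haarAddCircle)

/-- The projection of the plane to the standard torus. -/
def toTorus (τ : ℂ) [Fact (0 < τ.im)] (x : Plane) : UnitAddTorus (Fin 2) :=
  fun i => ((latticeBasis τ).repr x i : UnitAddCircle)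

/-- A section of the projection to the torus. -/
def ofTorus (τ : ℂ) [Fact (0 < τ.im)] (t : UnitAddTorus (Fin 2)) : Plane :=
  (latticeBasis τ).equivFunL.symm (UnitAddTorus.measurableEquivPiIoc 0 t)

lemma measurePreserving_toTorus (τ : ℂ) [Fact (0 < τ.im)] :
    MeasurePreserving (toTorus τ) (cellMeasure τ) volume := by
  have h1 : MeasurePreserving (latticeBasis τ).equivFunL (cellMeasure τ)
      ((volume : Measure (Fin 2 → ℝ)).restrict (Icc 0 1)) :=
    ⟨(latticeBasis τ).equivFunL.continuous.measurable, map_cellMeasure τ⟩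
  have h2 := measurePreserving_pi (fun _ : Fin 2 => (volume : Measure ℝ).restrict (Ioc 0 (0 + 1)))
    (fun _ => AddCircle.haarAddCircle (T := 1)) (f := fun _ => ((↑) : ℝ → UnitAddCircle))
    (fun _ => by
      have := AddCircle.measurePreserving_mk 1 0
      rwa [AddCircle.volume_eq_smul_haarAddCircle, ENNReal.ofReal_one, one_smul] at this)
  rw [← Measure.restrict_pi_pi] at h2
  have h3 : (Measure.pi fun _ : Fin 2 => (volume : Measure ℝ)).restrict
      (univ.pi fun _ => Ioc 0 (0 + 1)) = (volume : Measure (Fin 2 → ℝ)).restrict (Icc 0 1) := by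
    rw [← volume_pi]
    refine Measure.restrict_congr_set ?_
    have := Measure.univ_pi_Ioc_ae_eq_Icc (μ := fun _ : Fin 2 => (volume : Measure ℝ))
      (f := fun _ => 0) (g := fun _ => 1)
    simpa [volume_pi] using! this
  rw [h3] at h2
  exact h2.comp h1

/-- The section takes coordinates in $(0,1]$ while the cell is closed; the two differ by a null set
of faces, so the identity holds only almost everywhere. -/
lemma ofTorus_toTorus (τ : ℂ) [Fact (0 < τ.im)] :
    ∀ᵐ x ∂(cellMeasure τ), ofTorus τ (toTorus τ x) = x := by
  have h1 : MeasurePreserving (latticeBasis τ).equivFunL (cellMeasure τ)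
      ((volume : Measure (Fin 2 → ℝ)).restrict (Icc 0 1)) :=
    ⟨(latticeBasis τ).equivFunL.continuous.measurable, map_cellMeasure τ⟩
  have h2 : ∀ᵐ t ∂((volume : Measure (Fin 2 → ℝ)).restrict (Icc 0 1)),
      ∀ i, t i ∈ Ioc (0 : ℝ) (0 + 1) := by
    have := Measure.univ_pi_Ioc_ae_eq_Icc (μ := fun _ : Fin 2 => (volume : Measure ℝ))
      (f := fun _ => 0) (g := fun _ => 1)
    rw [← volume_pi] at this
    have h' : (univ.pi fun _ : Fin 2 => Ioc (0 : ℝ) 1) =ᵐ[volume] Icc (0 : Fin 2 → ℝ) 1 := this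
    rw [← Measure.restrict_congr_set h']
    rw [ae_restrict_iff' (MeasurableSet.univ_pi fun _ => measurableSet_Ioc)]
    exact Filter.Eventually.of_forall fun t ht i => by simpa using ht i (mem_univ i)
  filter_upwards [h1.quasiMeasurePreserving.ae h2] with x hx
  have : UnitAddTorus.measurableEquivPiIoc 0 (toTorus τ x)
      = ⟨(latticeBasis τ).equivFunL x, hx⟩ :=
    (UnitAddTorus.measurableEquivPiIoc (0 : Fin 2 → ℝ)).apply_symm_apply
      ⟨(latticeBasis τ).equivFunL x, hx⟩
  rw [ofTorus, this, ContinuousLinearEquiv.symm_apply_apply]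

lemma measurePreserving_ofTorus (τ : ℂ) [Fact (0 < τ.im)] :
    MeasurePreserving (ofTorus τ) volume (cellMeasure τ) := by
  have hm : Measurable (ofTorus τ) :=
    (latticeBasis τ).equivFunL.symm.continuous.measurable.comp
      (measurable_subtype_coe.comp (UnitAddTorus.measurableEquivPiIoc 0).measurable)
  refine ⟨hm, ?_⟩
  rw [← (measurePreserving_toTorus τ).map_eq,
    Measure.map_map hm (measurePreserving_toTorus τ).measurable]
  have : ofTorus τ ∘ toTorus τ =ᵐ[cellMeasure τ] id := ofTorus_toTorus τ
  rw [Measure.map_congr this, Measure.map_id]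

lemma mFourier_toTorus (τ : ℂ) [Fact (0 < τ.im)] (n : Fin 2 → ℤ) (x : Plane) :
    UnitAddTorus.mFourier n (toTorus τ x) = Complex.exp (phase τ n x * Complex.I) := by
  simp only [UnitAddTorus.mFourier, toTorus, ContinuousMap.coe_mk, fourier_coe_apply,
    Fin.prod_univ_two, ← Complex.exp_add, phase_eq]
  congr 1
  push_cast
  ring

/-- The `j`-th component of `u`, transported to the torus. -/
def torusComponent (τ : ℂ) [Fact (0 < τ.im)] (j : Fin 3) (u : L2 τ) :
    Lp ℂ 2 (volume : Measure (UnitAddTorus (Fin 2))) :=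
  Lp.compMeasurePreserving (ofTorus τ) (measurePreserving_ofTorus τ)
    ((Complex.ofRealCLM.comp (EuclideanSpace.proj j : Spin →L[ℝ] ℝ)).compLp u)

lemma torusComponent_toTorus (τ : ℂ) [Fact (0 < τ.im)] (j : Fin 3) (u : L2 τ) :
    ∀ᵐ x ∂(cellMeasure τ), torusComponent τ j u (toTorus τ x) = (u x j : ℂ) := by
  have h1 := (measurePreserving_toTorus τ).quasiMeasurePreserving.ae
    (Lp.coeFn_compMeasurePreserving
      ((Complex.ofRealCLM.comp (EuclideanSpace.proj j : Spin →L[ℝ] ℝ)).compLp u)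
      (measurePreserving_ofTorus τ))
  filter_upwards [h1, ofTorus_toTorus τ, (Complex.ofRealCLM.comp
    (EuclideanSpace.proj j : Spin →L[ℝ] ℝ)).coeFn_compLp u] with x h1 h2 h3
  rw [torusComponent, h1, Function.comp_apply, h2, h3]
  simp

lemma integral_torus (τ : ℂ) [Fact (0 < τ.im)] {F : UnitAddTorus (Fin 2) → ℂ}
    (hF : AEStronglyMeasurable F volume) :
    ∫ t, F t = ∫ x, F (toTorus τ x) ∂(cellMeasure τ) := by
  rw [← (measurePreserving_toTorus τ).map_eq] at hF ⊢
  exact integral_map (measurePreserving_toTorus τ).measurable.aemeasurable hF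

/-- Each component of $u$ is real, so its complex coefficient carries the cosine and sine integrals
as real part and negative imaginary part. -/
lemma mFourierCoeff_torusComponent (τ : ℂ) [Fact (0 < τ.im)] (j : Fin 3) (u : L2 τ)
    (n : Fin 2 → ℤ) : UnitAddTorus.mFourierCoeff (torusComponent τ j u) n
      = (cosCoeff τ n u j : ℂ) - sinCoeff τ n u j * Complex.I := by
  have hm : AEStronglyMeasurable
      (fun t => UnitAddTorus.mFourier (-n) t • torusComponent τ j u t) volume :=
    AEStronglyMeasurable.fun_smul (ContinuousMap.continuous _).aestronglyMeasurable
      (Lp.aestronglyMeasurable _)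
  rw [UnitAddTorus.mFourierCoeff, integral_torus τ hm]
  have hc := integrable_smul_cell τ (g := fun x => Real.cos (phase τ n x)) (by fun_prop) u
  have hs := integrable_smul_cell τ (g := fun x => Real.sin (phase τ n x)) (by fun_prop) u
  have e (a : Spin) : a j = (EuclideanSpace.proj j : Spin →L[ℝ] ℝ) a := rfl
  rw [cosCoeff_apply, sinCoeff_apply, e, e, ← ContinuousLinearMap.integral_comp_comm _ hc,
    ← ContinuousLinearMap.integral_comp_comm _ hs, ← integral_complex_ofReal,
    ← integral_complex_ofReal, ← integral_mul_const, ← integral_sub]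
  · refine integral_congr_ae ?_
    filter_upwards [torusComponent_toTorus τ j u] with x hx
    rw [hx, mFourier_toTorus]
    have : phase τ (-n) x = -phase τ n x := by simp [phase_apply]; ring
    rw [this, Complex.exp_mul_I]
    simp
    ring
  · exact ((EuclideanSpace.proj j : Spin →L[ℝ] ℝ).integrable_comp hc).ofReal
  · exact ((EuclideanSpace.proj j : Spin →L[ℝ] ℝ).integrable_comp hs).ofReal.mul_const _

/-- The field `Re g • eⱼ` for a function `g` on the torus. -/
def ofTorusComponent (τ : ℂ) [Fact (0 < τ.im)] (j : Fin 3) :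
    Lp ℂ 2 (volume : Measure (UnitAddTorus (Fin 2))) →L[ℝ] L2 τ :=
  ((Complex.reCLM.smulRight (EuclideanSpace.single j (1 : ℝ) : Spin)).compLpL 2
    (cellMeasure τ)).comp
    ((Lp.compMeasurePreservingₗᵢ ℝ (toTorus τ) (measurePreserving_toTorus τ)).toContinuousLinearMap)

lemma coeFn_ofTorusComponent (τ : ℂ) [Fact (0 < τ.im)] (j : Fin 3)
    (g : Lp ℂ 2 (volume : Measure (UnitAddTorus (Fin 2)))) :
    ∀ᵐ x ∂(cellMeasure τ), ofTorusComponent τ j g x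
      = (g (toTorus τ x)).re • (EuclideanSpace.single j (1 : ℝ) : Spin) := by
  have h1 := Lp.coeFn_compMeasurePreserving g (measurePreserving_toTorus τ)
  filter_upwards [h1, (Complex.reCLM.smulRight
    (EuclideanSpace.single j (1 : ℝ) : Spin)).coeFn_compLp
    (Lp.compMeasurePreserving (toTorus τ) (measurePreserving_toTorus τ) g)] with x h1 h2
  change ((Complex.reCLM.smulRight (EuclideanSpace.single j (1 : ℝ) : Spin)).compLp
    (Lp.compMeasurePreserving (toTorus τ) (measurePreserving_toTorus τ) g)) x = _
  rw [h2, h1]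
  rfl

lemma sum_smul_single (a : Spin) : ∑ j, a j • (EuclideanSpace.single j (1 : ℝ) : Spin) = a := by
  ext i
  simp [Finset.sum_apply, Pi.single_apply]

lemma sum_ofTorusComponent (τ : ℂ) [Fact (0 < τ.im)] (u : L2 τ) :
    ∑ j, ofTorusComponent τ j (torusComponent τ j u) = u := by
  refine Lp.ext ?_
  have h1 : ∀ᵐ x ∂(cellMeasure τ), ∀ j, ofTorusComponent τ j (torusComponent τ j u) x
      = u x j • (EuclideanSpace.single j (1 : ℝ) : Spin) := by
    rw [ae_all_iff]
    intro j
    filter_upwards [coeFn_ofTorusComponent τ j (torusComponent τ j u),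
      torusComponent_toTorus τ j u] with x h1 h2
    rw [h1, h2, Complex.ofReal_re]
  filter_upwards [h1, Lp.coeFn_fun_finsetSum Finset.univ
    (fun j => ofTorusComponent τ j (torusComponent τ j u))] with x h1 h2
  rw [h2]
  simp_rw [h1]
  exact sum_smul_single _

/-- The Fourier series of `u ∈ L²_Λ` converges to `u`. -/
theorem hasSum_mode (τ : ℂ) [Fact (0 < τ.im)] (u : L2 τ) :
    HasSum (fun n => toL2 τ (mode τ n (cosCoeff τ n u) (sinCoeff τ n u))) u := by
  have h : HasSum (fun n => ∑ j, ofTorusComponent τ j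
      (UnitAddTorus.mFourierCoeff (torusComponent τ j u) n • UnitAddTorus.mFourierLp 2 n))
      (∑ j, ofTorusComponent τ j (torusComponent τ j u)) :=
    hasSum_sum fun j _ => (ofTorusComponent τ j).hasSum
      (UnitAddTorus.hasSum_mFourier_series_L2 (torusComponent τ j u))
  rw [sum_ofTorusComponent] at h
  refine h.congr_fun fun n => ?_
  refine toL2_eq_of_ae ?_
  have h1 : ∀ᵐ x ∂(cellMeasure τ), ∀ j, ofTorusComponent τ j
      (UnitAddTorus.mFourierCoeff (torusComponent τ j u) n • UnitAddTorus.mFourierLp 2 n) x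
      = (mode τ n (cosCoeff τ n u) (sinCoeff τ n u) x) j •
        (EuclideanSpace.single j (1 : ℝ) : Spin) := by
    rw [ae_all_iff]
    intro j
    have h2 := (measurePreserving_toTorus τ).quasiMeasurePreserving.ae
      (UnitAddTorus.coeFn_mFourierLp (d := Fin 2) 2 n)
    have h3 := (measurePreserving_toTorus τ).quasiMeasurePreserving.ae
      (Lp.coeFn_smul (UnitAddTorus.mFourierCoeff (torusComponent τ j u) n)
        (UnitAddTorus.mFourierLp (d := Fin 2) 2 n))
    filter_upwards [coeFn_ofTorusComponent τ j (UnitAddTorus.mFourierCoeff (torusComponent τ j u) n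
      • UnitAddTorus.mFourierLp 2 n), h2, h3] with x h1 h2 h3
    rw [h1, h3, Pi.smul_apply, h2, mFourier_toTorus, mFourierCoeff_torusComponent,
      Complex.exp_mul_I]
    congr 1
    -- $\operatorname{Re}\big((C-iS)(\cos+i\sin)\big)=C\cos+S\sin$. The sum runs over both $n$ and
    -- $-n$, so no factor $2$ appears in the real expansion.
    simp [mode, mul_comm, Complex.cos_ofReal_re, Complex.sin_ofReal_re]
  filter_upwards [h1, Lp.coeFn_fun_finsetSum Finset.univ (fun j => ofTorusComponent τ j
      (UnitAddTorus.mFourierCoeff (torusComponent τ j u) n • UnitAddTorus.mFourierLp 2 n))]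
    with x h1 h2
  rw [h2]
  simp_rw [h1]
  exact (sum_smul_single _).symm

end Torus

/-- Parseval's identity. -/
theorem hasSum_inner (τ : ℂ) [Fact (0 < τ.im)] (u w : L2 τ) :
    HasSum (fun n => inner ℝ (cosCoeff τ n u) (cosCoeff τ n w)
      + inner ℝ (sinCoeff τ n u) (sinCoeff τ n w)) (inner ℝ u w) := by
  have h := (innerSL ℝ w).hasSum (hasSum_mode τ u)
  simp only [innerSL_apply_apply] at h
  rw [real_inner_comm] at h
  refine h.congr_fun fun n => ?_
  rw [real_inner_comm _ w, inner_toL2_mode]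

/-! ### Weak derivatives and smooth periodic fields -/

lemma IsPeriodic.fderiv {E : Type*} [NormedAddCommGroup E] [NormedSpace ℝ E] {τ : ℂ}
    {f : Plane → E} (hf : IsPeriodic τ f) : IsPeriodic τ (fderiv ℝ f) := by
  intro u hu x
  have h : (fun y => f (y + u)) = f := funext fun y => hf u hu y
  rw [← fderiv_comp_add_right, h]

/-- The classical partial derivative. -/
def pderiv {E : Type*} [NormedAddCommGroup E] [NormedSpace ℝ E] (i : Fin 2) (f : Plane → E)
    (x : Plane) : E := fderiv ℝ f x (EuclideanSpace.single i 1)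

lemma IsPeriodic.pderiv {E : Type*} [NormedAddCommGroup E] [NormedSpace ℝ E] {τ : ℂ}
    {f : Plane → E} (hf : IsPeriodic τ f) (i : Fin 2) : IsPeriodic τ (pderiv i f) :=
  fun u hu x => by rw [ChiralMagnet.pderiv, hf.fderiv u hu x]; rfl

lemma contDiff_pderiv {E : Type*} [NormedAddCommGroup E] [NormedSpace ℝ E]
    {f : Plane → E} (hf : ContDiff ℝ ∞ f) (i : Fin 2) : ContDiff ℝ ∞ (pderiv i f) :=
  (hf.fderiv_right (m := ∞) (by simp)).clm_apply contDiff_const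

lemma continuous_pderiv {E : Type*} [NormedAddCommGroup E] [NormedSpace ℝ E]
    {f : Plane → E} (hf : ContDiff ℝ 1 f) (i : Fin 2) : Continuous (pderiv i f) :=
  (hf.continuous_fderiv (by simp)).clm_apply continuous_const

lemma integrable_of_continuous {E : Type*} [NormedAddCommGroup E] [SecondCountableTopology E]
    (τ : ℂ) {f : Plane → E} (hf : Continuous f) : Integrable f (cellMeasure τ) :=
  (memLp_of_continuous τ hf).integrable (by norm_num)

/-- The mean of $f(\cdot+te_i)$ does not depend on $t$; differentiate under the integral at $t=0$.
This replaces integration by parts with boundary terms on the cell. -/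
lemma integral_pderiv_eq_zero {E : Type*} [NormedAddCommGroup E] [NormedSpace ℝ E]
    [SecondCountableTopology E]
    {τ : ℂ} [Fact (0 < τ.im)] {f : Plane → E} (hf : IsPeriodic τ f) (hd : ContDiff ℝ 1 f)
    (i : Fin 2) : ∫ x, pderiv i f x ∂(cellMeasure τ) = 0 := by
  set e : Plane := EuclideanSpace.single i 1
  obtain ⟨C, hC⟩ := (hf.pderiv i).exists_bound (continuous_pderiv hd i)
  have key := (hasDerivAt_integral_of_dominated_loc_of_deriv_le (μ := cellMeasure τ)
    (F := fun t : ℝ => fun x => f (x + t • e)) (F' := fun t x => pderiv i f (x + t • e))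
    (x₀ := 0) (bound := fun _ => C) (s := univ) Filter.univ_mem
    (Filter.Eventually.of_forall fun t =>
      (hd.continuous.comp (by fun_prop : Continuous fun x : Plane => x + t • e)).aestronglyMeasurable)
    (integrable_of_continuous τ (hd.continuous.comp (by fun_prop)))
    ((continuous_pderiv hd i).comp (by fun_prop)).aestronglyMeasurable
    (Filter.Eventually.of_forall fun x t _ => hC _) (integrable_const _)
    (Filter.Eventually.of_forall fun x t _ => by
      have h1 : HasDerivAt (fun t : ℝ => x + t • e) e t := by
        simpa using ((hasDerivAt_id t).smul_const e).const_add x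
      exact ((hd.differentiable (by simp) _).hasFDerivAt.comp_hasDerivAt t h1))).2
  have hconst : (fun t : ℝ => ∫ x, f (x + t • e) ∂(cellMeasure τ))
      = fun _ => ∫ x, f x ∂(cellMeasure τ) := funext fun t => integral_comp_add hf _
  rw [hconst] at key
  simpa using key.unique (hasDerivAt_const _ _)

lemma isWeakDeriv_toL2 {τ : ℂ} [Fact (0 < τ.im)] {f : Plane → Spin} (hf : IsPeriodic τ f)
    (hd : ContDiff ℝ 1 f) (i : Fin 2) :
    IsWeakDeriv τ i (toL2 τ f) (toL2 τ (pderiv i f)) := by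
  intro ψ hψ hp
  have hψ1 : ContDiff ℝ 1 ψ := hψ.of_le (by simp)
  have h := integral_pderiv_eq_zero (τ := τ) (f := fun x => ψ x • f x)
    (fun u hu x => by simp only [hp u hu, hf u hu]) (hψ1.smul hd) i
  have e : ∀ x, pderiv i (fun x => ψ x • f x) x = pderiv i ψ x • f x + ψ x • pderiv i f x := by
    intro x
    simp only [pderiv]
    rw [fderiv_fun_smul (hψ1.differentiable (by simp) x) (hd.differentiable (by simp) x)]
    simp [add_comm]
  simp_rw [e] at h
  have c1 := (continuous_pderiv hψ1 i).fun_smul hd.continuous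
  have c2 := hψ1.continuous.fun_smul (continuous_pderiv hd i)
  rw [integral_add (integrable_of_continuous τ c1) (integrable_of_continuous τ c2)] at h
  rw [eq_neg_iff_add_eq_zero, ← h]
  congr 1
  · refine integral_congr_ae ?_
    filter_upwards [coeFn_toL2 τ hd.continuous] with x hx using by rw [hx]; rfl
  · refine integral_congr_ae ?_
    filter_upwards [coeFn_toL2 τ (continuous_pderiv hd i)] with x hx using by rw [hx]

/-- The element of `H²_Λ` given by a smooth periodic field. -/
def smoothH2 {τ : ℂ} [Fact (0 < τ.im)] (f : Plane → Spin) (hd : ContDiff ℝ ∞ f)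
    (hf : IsPeriodic τ f) : H2 τ :=
  ⟨(toL2 τ f, fun i => toL2 τ (pderiv i f), fun i j => toL2 τ (pderiv j (pderiv i f))),
    fun i => isWeakDeriv_toL2 hf (hd.of_le (by simp)) i,
    fun i j => isWeakDeriv_toL2 (hf.pderiv i) ((contDiff_pderiv hd i).of_le (by simp)) j⟩

lemma phase_single (τ : ℂ) (n : Fin 2 → ℤ) (i : Fin 2) :
    phase τ n (EuclideanSpace.single i 1) = waveVec τ n i := by
  simp [phase, EuclideanSpace.inner_single_right]

lemma pderiv_cos_phase (τ : ℂ) (n : Fin 2 → ℤ) (i : Fin 2) (x : Plane) :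
    fderiv ℝ (fun x => Real.cos (phase τ n x)) x (EuclideanSpace.single i 1)
      = -(waveVec τ n i * Real.sin (phase τ n x)) := by
  have h : HasFDerivAt (fun x => Real.cos (phase τ n x))
      (-Real.sin (phase τ n x) • phase τ n) x :=
    (Real.hasDerivAt_cos _).comp_hasFDerivAt x (phase τ n).hasFDerivAt
  rw [h.fderiv]
  simp [phase_single, mul_comm]

lemma pderiv_sin_phase (τ : ℂ) (n : Fin 2 → ℤ) (i : Fin 2) (x : Plane) :
    fderiv ℝ (fun x => Real.sin (phase τ n x)) x (EuclideanSpace.single i 1)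
      = waveVec τ n i * Real.cos (phase τ n x) := by
  have h : HasFDerivAt (fun x => Real.sin (phase τ n x))
      (Real.cos (phase τ n x) • phase τ n) x :=
    (Real.hasDerivAt_sin _).comp_hasFDerivAt x (phase τ n).hasFDerivAt
  rw [h.fderiv]
  simp [phase_single, mul_comm]

/-- The trigonometric modes are themselves smooth periodic test functions, so a weak derivative acts
on coefficients as multiplication by $v_i$ with cosine and sine exchanged. -/
lemma IsWeakDeriv.cosCoeff_eq {τ : ℂ} [Fact (0 < τ.im)] {i : Fin 2} {u v : L2 τ}
    (h : IsWeakDeriv τ i u v) (n : Fin 2 → ℤ) :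
    cosCoeff τ n v = waveVec τ n i • sinCoeff τ n u := by
  have := h _ (contDiff_cos_phase τ n) (isPeriodic_cos τ n)
  simp_rw [pderiv_cos_phase, neg_smul, mul_smul] at this
  rw [integral_neg, integral_smul, neg_inj] at this
  rw [cosCoeff_apply, sinCoeff_apply, this]

lemma IsWeakDeriv.sinCoeff_eq {τ : ℂ} [Fact (0 < τ.im)] {i : Fin 2} {u v : L2 τ}
    (h : IsWeakDeriv τ i u v) (n : Fin 2 → ℤ) :
    sinCoeff τ n v = -(waveVec τ n i • cosCoeff τ n u) := by
  have := h _ (contDiff_sin_phase τ n) (isPeriodic_sin τ n)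
  simp_rw [pderiv_sin_phase, mul_smul] at this
  rw [integral_smul] at this
  rw [cosCoeff_apply, sinCoeff_apply, this, neg_neg]

lemma eq_of_coeff_eq {τ : ℂ} [Fact (0 < τ.im)] {u w : L2 τ}
    (hc : ∀ n, cosCoeff τ n u = cosCoeff τ n w) (hs : ∀ n, sinCoeff τ n u = sinCoeff τ n w) :
    u = w := by
  have h := hasSum_mode τ u
  simp_rw [hc, hs] at h
  exact h.unique (hasSum_mode τ w)

lemma IsWeakDeriv.unique {τ : ℂ} [Fact (0 < τ.im)] {i : Fin 2} {u v w : L2 τ}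
    (h : IsWeakDeriv τ i u v) (h' : IsWeakDeriv τ i u w) : v = w :=
  eq_of_coeff_eq (fun n => by rw [h.cosCoeff_eq, h'.cosCoeff_eq])
    (fun n => by rw [h.sinCoeff_eq, h'.sinCoeff_eq])

lemma isWeakDeriv_iff {τ : ℂ} {i : Fin 2} {u v : L2 τ} : IsWeakDeriv τ i u v ↔
    ∀ ψ : Plane → ℝ, ContDiff ℝ ∞ ψ → IsPeriodic τ ψ →
      weightedMean τ (pderiv i ψ) u = -weightedMean τ ψ v := by
  refine forall_congr' fun ψ => forall_congr' fun hψ => forall_congr' fun _ => ?_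
  rw [weightedMean_apply (continuous_pderiv (hψ.of_le (by simp)) i),
    weightedMean_apply hψ.continuous]
  rfl

/-- For each fixed test function the relation is an equality of continuous maps. It serves both the
completeness of $H^2_\Lambda$ and passing identities from smooth fields to limits. -/
lemma isClosed_isWeakDeriv {X : Type*} [TopologicalSpace X] (τ : ℂ) (i : Fin 2) {f g : X → L2 τ}
    (hf : Continuous f) (hg : Continuous g) : IsClosed {p : X | IsWeakDeriv τ i (f p) (g p)} := by
  simp only [isWeakDeriv_iff, ofPred_forall]
  refine isClosed_iInter fun ψ => isClosed_iInter fun _ => isClosed_iInter fun _ => ?_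
  exact isClosed_eq (by fun_prop) (by fun_prop)

/-! ### The Banach space $H^2_\Lambda$ and its Fourier series -/

instance (τ : ℂ) : CompleteSpace (H2 τ) := by
  refine (completeSpace_coe_iff_isComplete.2 (IsClosed.isComplete ?_) : CompleteSpace ↥(H2 τ))
  have : ((H2 τ : Set (L2 τ × (Fin 2 → L2 τ) × (Fin 2 → Fin 2 → L2 τ))))
      = (⋂ i, {p | IsWeakDeriv τ i p.1 (p.2.1 i)})
        ∩ ⋂ i, ⋂ j, {p | IsWeakDeriv τ j (p.2.1 i) (p.2.2 i j)} := by
    ext p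
    simp [H2]
  rw [this]
  exact (isClosed_iInter fun i => isClosed_isWeakDeriv τ i (by fun_prop) (by fun_prop)).inter
    (isClosed_iInter fun i => isClosed_iInter fun j =>
      isClosed_isWeakDeriv τ j (by fun_prop) (by fun_prop))

/-- The embedding `H²_Λ → L²_Λ`. -/
def fldL (τ : ℂ) : H2 τ →L[ℝ] L2 τ := (ContinuousLinearMap.fst ℝ _ _).comp (H2 τ).subtypeL

/-- The first derivative as a bounded operator. -/
def pdL (τ : ℂ) (i : Fin 2) : H2 τ →L[ℝ] L2 τ :=
  ((ContinuousLinearMap.proj i).comp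
    ((ContinuousLinearMap.fst ℝ _ _).comp (ContinuousLinearMap.snd ℝ _ _))).comp (H2 τ).subtypeL

/-- The second derivative as a bounded operator. -/
def pddL (τ : ℂ) (i j : Fin 2) : H2 τ →L[ℝ] L2 τ :=
  ((ContinuousLinearMap.proj j).comp ((ContinuousLinearMap.proj i).comp
    ((ContinuousLinearMap.snd ℝ _ _).comp (ContinuousLinearMap.snd ℝ _ _)))).comp (H2 τ).subtypeL

@[simp] lemma fldL_apply {τ : ℂ} (m : H2 τ) : fldL τ m = fld m := rfl

@[simp] lemma pdL_apply {τ : ℂ} (m : H2 τ) (i : Fin 2) : pdL τ i m = pd m i := rfl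

@[simp] lemma pddL_apply {τ : ℂ} (m : H2 τ) (i j : Fin 2) : pddL τ i j m = pdd m i j := rfl

lemma isWeakDeriv_pd {τ : ℂ} (m : H2 τ) (i : Fin 2) : IsWeakDeriv τ i (fld m) (pd m i) := m.2.1 i

lemma isWeakDeriv_pdd {τ : ℂ} (m : H2 τ) (i j : Fin 2) :
    IsWeakDeriv τ j (pd m i) (pdd m i j) := m.2.2 i j

lemma fld_injective (τ : ℂ) [Fact (0 < τ.im)] : Function.Injective (fld : H2 τ → L2 τ) := by
  intro m m' h
  have h1 : ∀ i, pd m i = pd m' i := fun i =>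
    (isWeakDeriv_pd m i).unique (h ▸ isWeakDeriv_pd m' i)
  have h2 : ∀ i j, pdd m i j = pdd m' i j := fun i j =>
    (isWeakDeriv_pdd m i j).unique (h1 i ▸ isWeakDeriv_pdd m' i j)
  exact Subtype.ext (Prod.ext h (Prod.ext (funext h1) (funext fun i => funext (h2 i))))

lemma norm_le_of_forall {τ : ℂ} (m : H2 τ) {C : ℝ} (h0 : ‖fld m‖ ≤ C)
    (h1 : ∀ i, ‖pd m i‖ ≤ C) (h2 : ∀ i j, ‖pdd m i j‖ ≤ C) : ‖m‖ ≤ C := by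
  have hC : 0 ≤ C := (norm_nonneg _).trans h0
  exact max_le h0 (max_le ((pi_norm_le_iff_of_nonneg hC).2 h1)
    ((pi_norm_le_iff_of_nonneg hC).2 fun i => (pi_norm_le_iff_of_nonneg hC).2 (h2 i)))

lemma hasSum_H2 {τ : ℂ} {ι : Type*} {f : ι → H2 τ} {m : H2 τ}
    (h0 : HasSum (fun n => fld (f n)) (fld m)) (h1 : ∀ i, HasSum (fun n => pd (f n) i) (pd m i))
    (h2 : ∀ i j, HasSum (fun n => pdd (f n) i j) (pdd m i j)) : HasSum f m := by
  have : HasSum (fun n => ((f n : H2 τ) : L2 τ × (Fin 2 → L2 τ) × (Fin 2 → Fin 2 → L2 τ)))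
      (m : L2 τ × (Fin 2 → L2 τ) × (Fin 2 → Fin 2 → L2 τ)) :=
    h0.prodMk ((Pi.hasSum.2 h1).prodMk (Pi.hasSum.2 fun i => Pi.hasSum.2 (h2 i)))
  rw [HasSum, Topology.IsInducing.subtypeVal.tendsto_nhds_iff]
  refine Filter.Tendsto.congr (fun s => ?_) this
  simp

lemma isPeriodic_mode (τ : ℂ) [Fact (0 < τ.im)] (n : Fin 2 → ℤ) (a b : Spin) :
    IsPeriodic τ (mode τ n a b) := fun u hu x => by
  have h1 := isPeriodic_cos τ n u hu x
  have h2 := isPeriodic_sin τ n u hu x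
  simp only at h1 h2
  simp only [mode, h1, h2]

lemma contDiff_mode (τ : ℂ) (n : Fin 2 → ℤ) (a b : Spin) : ContDiff ℝ ∞ (mode τ n a b) :=
  ((contDiff_cos_phase τ n).smul contDiff_const).add ((contDiff_sin_phase τ n).smul contDiff_const)

lemma pderiv_mode (τ : ℂ) (n : Fin 2 → ℤ) (a b : Spin) (i : Fin 2) :
    pderiv i (mode τ n a b) = mode τ n (waveVec τ n i • b) (-(waveVec τ n i • a)) := by
  ext1 x
  have hc := (contDiff_cos_phase τ n).differentiable (by simp) x
  have hs := (contDiff_sin_phase τ n).differentiable (by simp) x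
  unfold pderiv mode
  rw [fderiv_fun_add (hc.smul_const a) (hs.smul_const b), fderiv_smul_const hc,
    fderiv_smul_const hs]
  simp only [add_apply, ContinuousLinearMap.smulRight_apply,
    pderiv_cos_phase, pderiv_sin_phase]
  module

/-- A Fourier mode as an element of `H²_Λ`. -/
def modeH2 (τ : ℂ) [Fact (0 < τ.im)] (n : Fin 2 → ℤ) (a b : Spin) : H2 τ :=
  smoothH2 (mode τ n a b) (contDiff_mode τ n a b) (isPeriodic_mode τ n a b)

/-- The Fourier series of `m ∈ H²_Λ` converges in `H²_Λ`. -/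
theorem hasSum_modeH2 {τ : ℂ} [Fact (0 < τ.im)] (m : H2 τ) :
    HasSum (fun n => modeH2 τ n (cosCoeff τ n (fld m)) (sinCoeff τ n (fld m))) m := by
  have hpd : ∀ n i, pderiv i (mode τ n (cosCoeff τ n (fld m)) (sinCoeff τ n (fld m)))
      = mode τ n (cosCoeff τ n (pd m i)) (sinCoeff τ n (pd m i)) := fun n i => by
    rw [pderiv_mode, (isWeakDeriv_pd m i).cosCoeff_eq, (isWeakDeriv_pd m i).sinCoeff_eq]
  refine hasSum_H2 (hasSum_mode τ _) (fun i => ?_) (fun i j => ?_)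
  · refine (hasSum_mode τ (pd m i)).congr_fun fun n => ?_
    exact congrArg (toL2 τ) (hpd n i)
  · refine (hasSum_mode τ (pdd m i j)).congr_fun fun n => ?_
    change toL2 τ (pderiv j (pderiv i _)) = _
    rw [hpd, pderiv_mode, (isWeakDeriv_pdd m i j).cosCoeff_eq, (isWeakDeriv_pdd m i j).sinCoeff_eq]

/-! ### The linear part of the Euler-Lagrange operator -/

/-- The action of a matrix on fields. -/
def pointwise (τ : ℂ) (A : Spin →L[ℝ] Spin) : L2 τ →L[ℝ] L2 τ := A.compLpL 2 (cellMeasure τ)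

lemma coeFn_pointwise {τ : ℂ} (A : Spin →L[ℝ] Spin) (u : L2 τ) :
    pointwise τ A u =ᵐ[cellMeasure τ] fun x => A (u x) := A.coeFn_compLp u

lemma weightedMean_pointwise {τ : ℂ} (A : Spin →L[ℝ] Spin) {g : Plane → ℝ} (hg : Continuous g)
    (u : L2 τ) : weightedMean τ g (pointwise τ A u) = A (weightedMean τ g u) := by
  rw [weightedMean_apply hg, weightedMean_apply hg,
    ← A.integral_comp_comm (integrable_smul_cell τ hg u)]
  refine integral_congr_ae ?_
  filter_upwards [coeFn_pointwise A u] with x hx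
  rw [hx, map_smul]

lemma cosCoeff_pointwise {τ : ℂ} (A : Spin →L[ℝ] Spin) (n : Fin 2 → ℤ) (u : L2 τ) :
    cosCoeff τ n (pointwise τ A u) = A (cosCoeff τ n u) :=
  weightedMean_pointwise A (by fun_prop) u

lemma sinCoeff_pointwise {τ : ℂ} (A : Spin →L[ℝ] Spin) (n : Fin 2 → ℤ) (u : L2 τ) :
    sinCoeff τ n (pointwise τ A u) = A (sinCoeff τ n u) :=
  weightedMean_pointwise A (by fun_prop) u

lemma IsWeakDeriv.pointwise {τ : ℂ} {i : Fin 2} {u v : L2 τ} (h : IsWeakDeriv τ i u v)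
    (A : Spin →L[ℝ] Spin) : IsWeakDeriv τ i (pointwise τ A u) (pointwise τ A v) := by
  rw [isWeakDeriv_iff] at h ⊢
  intro ψ hψ hp
  rw [weightedMean_pointwise A (continuous_pderiv (hψ.of_le (by simp)) i),
    weightedMean_pointwise A hψ.continuous, h ψ hψ hp, map_neg]

/-- The coefficient matrix of `∂ᵢ` in the curl. -/
def curlMat (i : Fin 2) : Spin →L[ℝ] Spin := LinearMap.toContinuousLinearMap
  { toFun := fun w => (![!₂[0, -(w 2), w 1], !₂[w 2, 0, -(w 0)]] : Fin 2 → Spin) i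
    map_add' := fun v w => by
      fin_cases i <;> ext j <;> fin_cases j <;> simp <;> ring
    map_smul' := fun c w => by
      fin_cases i <;> ext j <;> fin_cases j <;> simp }

lemma curlMat_zero_apply (w : Spin) : curlMat 0 w = !₂[0, -(w 2), w 1] := rfl

lemma curlMat_one_apply (w : Spin) : curlMat 1 w = !₂[w 2, 0, -(w 0)] := rfl

/-- The projection to the third component. -/
def thirdProj : Spin →L[ℝ] Spin :=
  (EuclideanSpace.proj 2 : Spin →L[ℝ] ℝ).smulRight (EuclideanSpace.single 2 1)

lemma thirdProj_apply (w : Spin) : thirdProj w = w 2 • EuclideanSpace.single 2 (1 : ℝ) := rfl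

/-- The operator `-Δ + 2κ ∇× + λ + β ê₃ ⊗ ê₃`. -/
def linPart (κ β lam : ℝ) (τ : ℂ) : H2 τ →L[ℝ] L2 τ :=
  -(pddL τ 0 0 + pddL τ 1 1)
    + (2 * κ) • ((pointwise τ (curlMat 0)).comp (pdL τ 0) + (pointwise τ (curlMat 1)).comp (pdL τ 1))
    + lam • fldL τ + β • (pointwise τ thirdProj).comp (fldL τ)

lemma linPart_apply (κ β lam : ℝ) {τ : ℂ} (m : H2 τ) : linPart κ β lam τ m
    = -(pdd m 0 0 + pdd m 1 1)
      + (2 * κ) • (pointwise τ (curlMat 0) (pd m 0) + pointwise τ (curlMat 1) (pd m 1))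
      + lam • fld m + β • pointwise τ thirdProj (fld m) := rfl

lemma coeFn_linPart (κ β lam : ℝ) {τ : ℂ} (m : H2 τ) :
    linPart κ β lam τ m =ᵐ[cellMeasure τ] fun x => -lap m x + (2 * κ) • curl m x
      + lam • fld m x + (β * fld m x 2) • EuclideanSpace.single 2 1 := by
  rw [linPart_apply]
  filter_upwards [
    Lp.coeFn_add (-(pdd m 0 0 + pdd m 1 1) + (2 * κ) • (pointwise τ (curlMat 0) (pd m 0)
      + pointwise τ (curlMat 1) (pd m 1)) + lam • fld m) (β • pointwise τ thirdProj (fld m)),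
    Lp.coeFn_add (-(pdd m 0 0 + pdd m 1 1) + (2 * κ) • (pointwise τ (curlMat 0) (pd m 0)
      + pointwise τ (curlMat 1) (pd m 1))) (lam • fld m),
    Lp.coeFn_add (-(pdd m 0 0 + pdd m 1 1)) ((2 * κ) • (pointwise τ (curlMat 0) (pd m 0)
      + pointwise τ (curlMat 1) (pd m 1))),
    Lp.coeFn_neg (pdd m 0 0 + pdd m 1 1), Lp.coeFn_add (pdd m 0 0) (pdd m 1 1),
    Lp.coeFn_smul (2 * κ) (pointwise τ (curlMat 0) (pd m 0) + pointwise τ (curlMat 1) (pd m 1)),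
    Lp.coeFn_add (pointwise τ (curlMat 0) (pd m 0)) (pointwise τ (curlMat 1) (pd m 1)),
    Lp.coeFn_smul lam (fld m), Lp.coeFn_smul β (pointwise τ thirdProj (fld m)),
    coeFn_pointwise (curlMat 0) (pd m 0), coeFn_pointwise (curlMat 1) (pd m 1),
    coeFn_pointwise thirdProj (fld m)] with x h1 h2 h3 h4 h5 h6 h7 h8 h9 h10 h11 h12
  rw [h1, Pi.add_apply, h2, Pi.add_apply, h3, Pi.add_apply, h4, Pi.neg_apply, h5, Pi.add_apply, h6,
    Pi.smul_apply, h7, Pi.add_apply, h8, Pi.smul_apply, h9, Pi.smul_apply, h10, h11, h12, lap]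
  congr 1
  · congr 3
    rw [curl, curlMat_zero_apply, curlMat_one_apply]
    ext j
    fin_cases j <;> simp [sub_eq_add_neg]
  · rw [thirdProj_apply, smul_smul]

/-! ### Fields that do not depend on `x₁` -/

lemma waveVec_zero_cons (τ : ℂ) (k : ℤ) : waveVec τ ![0, k] = !₂[0, (k : ℝ)] := by
  simp [waveVec]

lemma norm_sq_coeff_le {τ : ℂ} [Fact (0 < τ.im)] (n : Fin 2 → ℤ) (u : L2 τ) :
    ‖cosCoeff τ n u‖ ^ 2 + ‖sinCoeff τ n u‖ ^ 2 ≤ ‖u‖ ^ 2 := by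
  have h := hasSum_inner τ u u
  simp only [real_inner_self_eq_norm_sq] at h
  exact le_hasSum h n fun _ _ => by positivity

lemma norm_cosCoeff_le {τ : ℂ} [Fact (0 < τ.im)] (n : Fin 2 → ℤ) (u : L2 τ) :
    ‖cosCoeff τ n u‖ ≤ ‖u‖ :=
  (pow_le_pow_iff_left₀ (norm_nonneg _) (norm_nonneg _) two_ne_zero).1
    (by nlinarith [norm_sq_coeff_le n u, sq_nonneg ‖sinCoeff τ n u‖])

lemma norm_sinCoeff_le {τ : ℂ} [Fact (0 < τ.im)] (n : Fin 2 → ℤ) (u : L2 τ) :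
    ‖sinCoeff τ n u‖ ≤ ‖u‖ :=
  (pow_le_pow_iff_left₀ (norm_nonneg _) (norm_nonneg _) two_ne_zero).1
    (by nlinarith [norm_sq_coeff_le n u, sq_nonneg ‖cosCoeff τ n u‖])

lemma norm_pdd_le {τ : ℂ} (m : H2 τ) (i j : Fin 2) : ‖pdd m i j‖ ≤ ‖m‖ :=
  ((norm_le_pi_norm (m.1.2.2 i) j).trans (norm_le_pi_norm m.1.2.2 i)).trans
    ((le_max_right _ _).trans (le_max_right _ _))

lemma cosCoeff_pdd {τ : ℂ} [Fact (0 < τ.im)] (m : H2 τ) (i : Fin 2) (n : Fin 2 → ℤ) :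
    cosCoeff τ n (pdd m i i) = -(waveVec τ n i ^ 2 • cosCoeff τ n (fld m)) := by
  rw [(isWeakDeriv_pdd m i i).cosCoeff_eq, (isWeakDeriv_pd m i).sinCoeff_eq]
  module

lemma sinCoeff_pdd {τ : ℂ} [Fact (0 < τ.im)] (m : H2 τ) (i : Fin 2) (n : Fin 2 → ℤ) :
    sinCoeff τ n (pdd m i i) = -(waveVec τ n i ^ 2 • sinCoeff τ n (fld m)) := by
  rw [(isWeakDeriv_pdd m i i).sinCoeff_eq, (isWeakDeriv_pd m i).cosCoeff_eq]
  module

/-- `cos (k x₂)` as a bounded continuous function. -/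
def cosB (τ : ℂ) (k : ℤ) : Plane →ᵇ ℝ :=
  BoundedContinuousFunction.ofNormedAddCommGroup (fun x => Real.cos (phase τ ![0, k] x))
    (by fun_prop) 1 fun x => Real.abs_cos_le_one _

/-- `sin (k x₂)` as a bounded continuous function. -/
def sinB (τ : ℂ) (k : ℤ) : Plane →ᵇ ℝ :=
  BoundedContinuousFunction.ofNormedAddCommGroup (fun x => Real.sin (phase τ ![0, k] x))
    (by fun_prop) 1 fun x => Real.abs_sin_le_one _

lemma norm_cosB_le (τ : ℂ) (k : ℤ) : ‖cosB τ k‖ ≤ 1 :=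
  BoundedContinuousFunction.norm_ofNormedAddCommGroup_le _ zero_le_one fun _ => Real.abs_cos_le_one _

lemma norm_sinB_le (τ : ℂ) (k : ℤ) : ‖sinB τ k‖ ≤ 1 :=
  BoundedContinuousFunction.norm_ofNormedAddCommGroup_le _ zero_le_one fun _ => Real.abs_sin_le_one _

/-- The Fourier mode with wave vector `(0, k)` of the `i`-th component. -/
def modeB (τ : ℂ) (i : Fin 3) (k : ℤ) : H2 τ →L[ℝ] (Plane →ᵇ ℝ) :=
  (((EuclideanSpace.proj i : Spin →L[ℝ] ℝ).comp ((cosCoeff τ ![0, k]).comp (fldL τ))).smulRight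
    (cosB τ k)) +
  (((EuclideanSpace.proj i : Spin →L[ℝ] ℝ).comp ((sinCoeff τ ![0, k]).comp (fldL τ))).smulRight
    (sinB τ k))

lemma modeB_apply (τ : ℂ) (i : Fin 3) (k : ℤ) (m : H2 τ) (x : Plane) : modeB τ i k m x
    = mode τ ![0, k] (cosCoeff τ ![0, k] (fld m)) (sinCoeff τ ![0, k] (fld m)) x i := by
  simp [modeB, mode, cosB, sinB, mul_comm]

/-- For the wave vector $(0,k)$ the coefficients of $\partial_2^2m$ are $-k^2$ times those of $m$,
and coefficients are bounded by the $L^2$ norm. Summability of $k^{-2}$ then gives uniform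
convergence. -/
lemma norm_modeB_le (τ : ℂ) [Fact (0 < τ.im)] (i : Fin 3) {k : ℤ} (hk : k ≠ 0) :
    ‖modeB τ i k‖ ≤ 2 * (1 / (k : ℝ) ^ 2) := by
  refine ContinuousLinearMap.opNorm_le_bound _ (by positivity) fun m => ?_
  have hk' : (0 : ℝ) < (k : ℝ) ^ 2 := by positivity
  have hc := norm_cosCoeff_le ![0, k] (pdd m 1 1)
  have hs := norm_sinCoeff_le ![0, k] (pdd m 1 1)
  rw [cosCoeff_pdd, waveVec_zero_cons, norm_neg, norm_smul] at hc
  rw [sinCoeff_pdd, waveVec_zero_cons, norm_neg, norm_smul] at hs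
  simp only [Matrix.cons_val_one, Matrix.cons_val_fin_one, norm_pow,
    Real.norm_eq_abs, sq_abs] at hc hs
  have hm := norm_pdd_le m 1 1
  have h1 : ‖modeB τ i k m‖ ≤ ‖cosCoeff τ ![0, k] (fld m)‖ + ‖sinCoeff τ ![0, k] (fld m)‖ := by
    refine (norm_add_le _ _).trans (add_le_add ?_ ?_)
    · refine (norm_smul_le _ _).trans ?_
      refine (mul_le_of_le_one_right (norm_nonneg _) (norm_cosB_le τ k)).trans ?_
      exact PiLp.norm_apply_le (cosCoeff τ ![0, k] (fld m)) i
    · refine (norm_smul_le _ _).trans ?_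
      refine (mul_le_of_le_one_right (norm_nonneg _) (norm_sinB_le τ k)).trans ?_
      exact PiLp.norm_apply_le (sinCoeff τ ![0, k] (fld m)) i
  refine h1.trans ?_
  have e1 : ‖cosCoeff τ ![0, k] (fld m)‖ ≤ 1 / (k : ℝ) ^ 2 * ‖m‖ := by
    rw [one_div, ← div_eq_inv_mul, le_div_iff₀ hk']; linarith
  have e2 : ‖sinCoeff τ ![0, k] (fld m)‖ ≤ 1 / (k : ℝ) ^ 2 * ‖m‖ := by
    rw [one_div, ← div_eq_inv_mul, le_div_iff₀ hk']; linarith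
  linarith

lemma summable_of_norm_le_int {E F : Type*} [NormedAddCommGroup E] [NormedSpace ℝ E]
    [NormedAddCommGroup F] [NormedSpace ℝ F] [CompleteSpace F] {f : ℤ → E →L[ℝ] F}
    (hf : ∀ k, k ≠ 0 → ‖f k‖ ≤ 2 * (1 / (k : ℝ) ^ 2)) : Summable f := by
  refine Summable.of_norm_bounded_eventually
    (((Real.summable_one_div_int_pow (p := 2)).2 (by norm_num)).mul_left 2) ?_
  filter_upwards [(Set.finite_singleton (0 : ℤ)).compl_mem_cofinite] with k hk
  exact hf k hk

lemma summable_modeB (τ : ℂ) [Fact (0 < τ.im)] (i : Fin 3) : Summable (modeB τ i) :=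
  summable_of_norm_le_int fun _ hk => norm_modeB_le τ i hk

/-- The `i`-th component of the `x₁`-independent part of `m`, as a bounded continuous function. -/
def toBCF (τ : ℂ) (i : Fin 3) : H2 τ →L[ℝ] (Plane →ᵇ ℝ) := ∑' k, modeB τ i k

lemma hasSum_toBCF (τ : ℂ) [Fact (0 < τ.im)] (i : Fin 3) (m : H2 τ) :
    HasSum (fun k => modeB τ i k m) (toBCF τ i m) :=
  (summable_modeB τ i).hasSum.mapL (ContinuousLinearMap.apply ℝ (Plane →ᵇ ℝ) m)

/-- The embedding of scalar bounded continuous functions into `L²_Λ`, as `j`-th component. -/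
def ofBCF (τ : ℂ) (j : Fin 3) : (Plane →ᵇ ℝ) →L[ℝ] L2 τ :=
  (((ContinuousLinearMap.id ℝ ℝ).smulRight (EuclideanSpace.single j (1 : ℝ) : Spin)).compLpL 2
    (cellMeasure τ)).comp (BoundedContinuousFunction.toLp 2 (cellMeasure τ) ℝ)

lemma coeFn_ofBCF (τ : ℂ) (j : Fin 3) (f : Plane →ᵇ ℝ) :
    ofBCF τ j f =ᵐ[cellMeasure τ] fun x => f x • EuclideanSpace.single j (1 : ℝ) := by
  filter_upwards [((ContinuousLinearMap.id ℝ ℝ).smulRight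
    (EuclideanSpace.single j (1 : ℝ) : Spin)).coeFn_compLp
    (BoundedContinuousFunction.toLp 2 (cellMeasure τ) ℝ f),
    BoundedContinuousFunction.coeFn_toLp 2 (cellMeasure τ) ℝ f] with x h1 h2
  change (((ContinuousLinearMap.id ℝ ℝ).smulRight (EuclideanSpace.single j (1 : ℝ) : Spin)).compLp
    (BoundedContinuousFunction.toLp 2 (cellMeasure τ) ℝ f)) x = _
  rw [h1, h2]
  rfl

lemma coeFn_sum_ofBCF (τ : ℂ) (f : Fin 3 → (Plane →ᵇ ℝ)) :
    (∑ j, ofBCF τ j (f j) : L2 τ) =ᵐ[cellMeasure τ]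
      fun x => (WithLp.toLp 2 (fun j => f j x) : Spin) := by
  have h1 : ∀ᵐ x ∂(cellMeasure τ), ∀ j, ofBCF τ j (f j) x
      = f j x • EuclideanSpace.single j (1 : ℝ) := ae_all_iff.2 fun j => coeFn_ofBCF τ j (f j)
  filter_upwards [h1, Lp.coeFn_fun_finsetSum Finset.univ (fun j => ofBCF τ j (f j))] with x h1 h2
  rw [h2]
  simp_rw [h1]
  exact sum_smul_single (WithLp.toLp 2 (fun j => f j x))

lemma coeff_eq_zero_of_pd_eq_zero {τ : ℂ} [hτ : Fact (0 < τ.im)] {m : H2 τ} (hm : pd m 0 = 0)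
    {n : Fin 2 → ℤ} (hn : n 0 ≠ 0) : cosCoeff τ n (fld m) = 0 ∧ sinCoeff τ n (fld m) = 0 := by
  have hv : waveVec τ n 0 ≠ 0 := by
    simp [waveVec, hn, hτ.out.ne']
  have h1 := (isWeakDeriv_pd m 0).cosCoeff_eq n
  have h2 := (isWeakDeriv_pd m 0).sinCoeff_eq n
  rw [hm, map_zero] at h1 h2
  refine ⟨?_, ?_⟩
  · simpa [hv] using h2
  · simpa [hv] using h1.symm

/-- When $\partial_1m=0$ only the wave vectors $(0,k)$ contribute, so the uniformly convergent
series and the $L^2$ Fourier series have the same terms. -/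
lemma sum_ofBCF_toBCF {τ : ℂ} [Fact (0 < τ.im)] {m : H2 τ} (hm : pd m 0 = 0) :
    ∑ j, ofBCF τ j (toBCF τ j m) = fld m := by
  have h1 : HasSum (fun k : ℤ => ∑ j, ofBCF τ j (modeB τ j k m))
      (∑ j, ofBCF τ j (toBCF τ j m)) :=
    hasSum_sum fun j _ => (ofBCF τ j).hasSum (hasSum_toBCF τ j m)
  have hinj : Function.Injective fun k : ℤ => (![0, k] : Fin 2 → ℤ) := fun k l h => by
    simpa using congrFun h 1
  have h2 := (hinj.hasSum_iff (f := fun n => toL2 τ (mode τ n (cosCoeff τ n (fld m))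
    (sinCoeff τ n (fld m)))) (a := fld m) (by
      intro n hn
      have : n 0 ≠ 0 := by
        contrapose! hn
        exact ⟨n 1, by ext i; fin_cases i <;> simp [hn]⟩
      obtain ⟨h1, h2⟩ := coeff_eq_zero_of_pd_eq_zero hm this
      rw [h1, h2]
      refine toL2_eq_of_ae ?_
      filter_upwards [Lp.coeFn_zero Spin 2 (cellMeasure τ)] with x hx
      rw [hx]; simp [mode])).2 (hasSum_mode τ (fld m))
  refine h1.unique (h2.congr_fun fun k => ?_)
  symm
  refine toL2_eq_of_ae ?_
  filter_upwards [coeFn_sum_ofBCF τ (fun j => modeB τ j k m)] with x hx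
  rw [hx]
  ext j
  exact (modeB_apply τ j k m x).symm

/-- The continuous representative of an `x₁`-independent `m ∈ H²_Λ`. -/
def rep {τ : ℂ} (m : H2 τ) (x : Plane) : Spin := WithLp.toLp 2 fun j => toBCF τ j m x

lemma fld_eq_rep {τ : ℂ} [Fact (0 < τ.im)] {m : H2 τ} (hm : pd m 0 = 0) :
    fld m =ᵐ[cellMeasure τ] rep m := by
  rw [← sum_ofBCF_toBCF hm]
  exact coeFn_sum_ofBCF τ fun j => toBCF τ j m

/-! ### The cubic nonlinearity and its derivative -/

/-- The cubic term `|m|² m`. -/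
def cub {τ : ℂ} (m : H2 τ) : L2 τ :=
  ∑ j, ofBCF τ j ((∑ i, toBCF τ i m ^ 2) * toBCF τ j m)

/-- A cubic polynomial in the bounded linear maps `toBCF`, with products taken in the Banach algebra
of bounded continuous functions. -/
lemma contDiff_cub (τ : ℂ) : ContDiff ℝ ω (cub : H2 τ → L2 τ) := by
  unfold cub
  fun_prop

lemma coeFn_cub {τ : ℂ} (m : H2 τ) :
    cub m =ᵐ[cellMeasure τ] fun x => ‖rep m x‖ ^ 2 • rep m x := by
  filter_upwards [coeFn_sum_ofBCF τ fun j => (∑ i, toBCF τ i m ^ 2) * toBCF τ j m] with x hx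
  rw [cub, hx]
  ext j
  simp [rep, EuclideanSpace.norm_sq_eq]

lemma memLp_smul_bcf {τ : ℂ} (f : Plane →ᵇ ℝ) (u : L2 τ) :
    MemLp (fun x => f x • u x) 2 (cellMeasure τ) :=
  (Lp.memLp u).of_le_mul (c := ‖f‖)
    (f.continuous.aestronglyMeasurable.smul (Lp.aestronglyMeasurable u))
    (Filter.Eventually.of_forall fun x => by
      rw [norm_smul]
      exact mul_le_mul_of_nonneg_right (f.norm_coe_le_norm x) (norm_nonneg _))

/-- Multiplication by bounded continuous functions. -/
def mulBCF (τ : ℂ) : (Plane →ᵇ ℝ) →L[ℝ] L2 τ →L[ℝ] L2 τ :=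
  LinearMap.mkContinuous₂ (LinearMap.mk₂ ℝ (fun f u => (memLp_smul_bcf f u).toLp _)
    (fun f g u => Lp.ext (by
      filter_upwards [(memLp_smul_bcf (f + g) u).coeFn_toLp,
        (memLp_smul_bcf f u).coeFn_toLp, (memLp_smul_bcf g u).coeFn_toLp,
        Lp.coeFn_add ((memLp_smul_bcf f u).toLp _) ((memLp_smul_bcf g u).toLp _)] with x h1 h2 h3 h4
      rw [h1, h4, Pi.add_apply, h2, h3, BoundedContinuousFunction.add_apply, add_smul]))
    (fun c f u => Lp.ext (by
      filter_upwards [(memLp_smul_bcf (c • f) u).coeFn_toLp, (memLp_smul_bcf f u).coeFn_toLp,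
        Lp.coeFn_smul c ((memLp_smul_bcf f u).toLp _)] with x h1 h2 h3
      rw [h1, h3, Pi.smul_apply, h2, BoundedContinuousFunction.smul_apply, smul_assoc]))
    (fun f u v => Lp.ext (by
      filter_upwards [(memLp_smul_bcf f (u + v)).coeFn_toLp, (memLp_smul_bcf f u).coeFn_toLp,
        (memLp_smul_bcf f v).coeFn_toLp, Lp.coeFn_add ((memLp_smul_bcf f u).toLp _)
          ((memLp_smul_bcf f v).toLp _), Lp.coeFn_add u v] with x h1 h2 h3 h4 h5
      rw [h1, h4, Pi.add_apply, h2, h3, h5, Pi.add_apply, smul_add]))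
    (fun c f u => Lp.ext (by
      filter_upwards [(memLp_smul_bcf f (c • u)).coeFn_toLp, (memLp_smul_bcf f u).coeFn_toLp,
        Lp.coeFn_smul c ((memLp_smul_bcf f u).toLp _), Lp.coeFn_smul c u] with x h1 h2 h3 h4
      rw [h1, h3, Pi.smul_apply, h2, h4, Pi.smul_apply, smul_comm])))
    1 (fun f u => by
      rw [one_mul]
      refine Lp.norm_le_mul_norm_of_ae_le_mul ?_
      filter_upwards [(memLp_smul_bcf f u).coeFn_toLp] with x h1
      rw [LinearMap.mk₂_apply, h1, norm_smul]
      exact mul_le_mul_of_nonneg_right (f.norm_coe_le_norm x) (norm_nonneg _))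

lemma coeFn_mulBCF {τ : ℂ} (f : Plane →ᵇ ℝ) (u : L2 τ) :
    mulBCF τ f u =ᵐ[cellMeasure τ] fun x => f x • u x :=
  (memLp_smul_bcf f u).coeFn_toLp

/-- The matrix unit `w ↦ wⱼ eᵢ`. -/
def matUnit (i j : Fin 3) : Spin →L[ℝ] Spin :=
  (EuclideanSpace.proj j : Spin →L[ℝ] ℝ).smulRight (EuclideanSpace.single i 1)

lemma matUnit_apply (i j : Fin 3) (w : Spin) :
    matUnit i j w = w j • EuclideanSpace.single i (1 : ℝ) := rfl

/-- The derivative `v ↦ |m|² v + 2 (m · v) m` of the cubic term. -/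
def dcub {τ : ℂ} (m : H2 τ) : L2 τ →L[ℝ] L2 τ :=
  ∑ i, ∑ j, ((mulBCF τ (toBCF τ j m ^ 2)).comp (pointwise τ (matUnit i i))
    + (2 : ℝ) • (mulBCF τ (toBCF τ i m * toBCF τ j m)).comp (pointwise τ (matUnit i j)))

lemma continuous_dcub (τ : ℂ) : Continuous (dcub : H2 τ → L2 τ →L[ℝ] L2 τ) := by
  unfold dcub
  fun_prop

lemma coeFn_dcub {τ : ℂ} (m : H2 τ) (u : L2 τ) : dcub m u =ᵐ[cellMeasure τ]
    fun x => ‖rep m x‖ ^ 2 • u x + (2 * inner ℝ (rep m x) (u x)) • rep m x := by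
  -- The summand $(i,j)$ contributes $m_j^2u_ie_i+2m_im_ju_je_i$: summing the first part over $j$
  -- builds $|m|^2u$, the second builds $2(m\cdot u)m$.
  have key : ∀ i j, ((mulBCF τ (toBCF τ j m ^ 2)).comp (pointwise τ (matUnit i i))
    + (2 : ℝ) • (mulBCF τ (toBCF τ i m * toBCF τ j m)).comp (pointwise τ (matUnit i j))) u
      =ᵐ[cellMeasure τ] fun x => (rep m x j ^ 2 * u x i + 2 * (rep m x i * rep m x j) * u x j) •
        EuclideanSpace.single i (1 : ℝ) := by
    intro i j
    have e : ((mulBCF τ (toBCF τ j m ^ 2)).comp (pointwise τ (matUnit i i))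
      + (2 : ℝ) • (mulBCF τ (toBCF τ i m * toBCF τ j m)).comp (pointwise τ (matUnit i j))) u
      = mulBCF τ (toBCF τ j m ^ 2) (pointwise τ (matUnit i i) u)
        + (2 : ℝ) • mulBCF τ (toBCF τ i m * toBCF τ j m) (pointwise τ (matUnit i j) u) := rfl
    rw [e]
    filter_upwards [Lp.coeFn_add (mulBCF τ (toBCF τ j m ^ 2) (pointwise τ (matUnit i i) u))
      ((2 : ℝ) • mulBCF τ (toBCF τ i m * toBCF τ j m) (pointwise τ (matUnit i j) u)),
      Lp.coeFn_smul (2 : ℝ) (mulBCF τ (toBCF τ i m * toBCF τ j m) (pointwise τ (matUnit i j) u)),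
      coeFn_mulBCF (toBCF τ j m ^ 2) (pointwise τ (matUnit i i) u),
      coeFn_mulBCF (toBCF τ i m * toBCF τ j m) (pointwise τ (matUnit i j) u),
      coeFn_pointwise (matUnit i i) u, coeFn_pointwise (matUnit i j) u] with x h1 h2 h3 h4 h5 h6
    rw [h1, Pi.add_apply, h2, Pi.smul_apply, h3, h4, h5, h6]
    simp only [matUnit_apply, rep,
      BoundedContinuousFunction.mul_apply, BoundedContinuousFunction.pow_apply]
    module
  have h1 : ∀ᵐ x ∂(cellMeasure τ), ∀ i j,
      ((mulBCF τ (toBCF τ j m ^ 2)).comp (pointwise τ (matUnit i i))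
    + (2 : ℝ) • (mulBCF τ (toBCF τ i m * toBCF τ j m)).comp (pointwise τ (matUnit i j))) u x
      = (rep m x j ^ 2 * u x i + 2 * (rep m x i * rep m x j) * u x j) •
        EuclideanSpace.single i (1 : ℝ) :=
    ae_all_iff.2 fun i => ae_all_iff.2 fun j => key i j
  have h2 : ∀ᵐ x ∂(cellMeasure τ), ∀ i, (∑ j, ((mulBCF τ (toBCF τ j m ^ 2)).comp
      (pointwise τ (matUnit i i)) + (2 : ℝ) • (mulBCF τ (toBCF τ i m * toBCF τ j m)).comp
        (pointwise τ (matUnit i j))) u : L2 τ) x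
      = ∑ j, ((mulBCF τ (toBCF τ j m ^ 2)).comp (pointwise τ (matUnit i i))
    + (2 : ℝ) • (mulBCF τ (toBCF τ i m * toBCF τ j m)).comp (pointwise τ (matUnit i j))) u x :=
    ae_all_iff.2 fun i => Lp.coeFn_fun_finsetSum _ _
  have e : dcub m u = ∑ i, ∑ j, ((mulBCF τ (toBCF τ j m ^ 2)).comp (pointwise τ (matUnit i i))
      + (2 : ℝ) • (mulBCF τ (toBCF τ i m * toBCF τ j m)).comp (pointwise τ (matUnit i j))) u := by
    simp only [dcub, sum_apply]
  filter_upwards [h1, h2, Lp.coeFn_fun_finsetSum Finset.univ (fun i => ∑ j,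
    ((mulBCF τ (toBCF τ j m ^ 2)).comp (pointwise τ (matUnit i i))
      + (2 : ℝ) • (mulBCF τ (toBCF τ i m * toBCF τ j m)).comp (pointwise τ (matUnit i j))) u)]
    with x h1 h2 h3
  rw [e, h3]
  simp_rw [h2, h1]
  ext l
  fin_cases l <;> simp [Fin.sum_univ_three, EuclideanSpace.norm_sq_eq, PiLp.inner_apply] <;> ring

/-! ### Differentiating the Euler-Lagrange equation -/

/-- Invariance under translations in the `x₁`-direction. -/
def IsXInvariant {E : Type*} (f : Plane → E) : Prop :=
  ∀ (t : ℝ) (x : Plane), f (x + t • EuclideanSpace.single 0 1) = f x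

lemma IsXInvariant.pderiv {E : Type*} [NormedAddCommGroup E] [NormedSpace ℝ E] {f : Plane → E}
    (hf : IsXInvariant f) (i : Fin 2) : IsXInvariant (pderiv i f) := by
  intro t x
  have h : (fun y => f (y + t • EuclideanSpace.single 0 1)) = f := funext fun y => hf t y
  rw [ChiralMagnet.pderiv, ← fderiv_comp_add_right, h]
  rfl

lemma IsXInvariant.pderiv_zero {E : Type*} [NormedAddCommGroup E] [NormedSpace ℝ E]
    {f : Plane → E} (hf : IsXInvariant f) (hd : Differentiable ℝ f) :
    ChiralMagnet.pderiv 0 f = 0 := by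
  ext1 x
  have h := (hd x).hasFDerivAt.hasLineDerivAt (EuclideanSpace.single 0 1)
  have h' : (fun t : ℝ => f (x + t • EuclideanSpace.single 0 1)) = fun _ => f x :=
    funext fun t => hf t x
  rw [HasLineDerivAt, h'] at h
  exact h.unique (hasDerivAt_const _ _)

lemma isXInvariant_mode {τ : ℂ} {n : Fin 2 → ℤ} {a b : Spin}
    (h : waveVec τ n 0 = 0 ∨ (a = 0 ∧ b = 0)) : IsXInvariant (mode τ n a b) := by
  intro t x
  rcases h with h | ⟨rfl, rfl⟩
  · simp [mode, phase_single, h]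
  · simp [mode]

lemma toL2_zero (τ : ℂ) : toL2 τ 0 = 0 :=
  toL2_eq_of_ae (Lp.coeFn_zero Spin 2 (cellMeasure τ)).symm

lemma smoothH2_add {τ : ℂ} [Fact (0 < τ.im)] {f g : Plane → Spin} (hf : ContDiff ℝ ∞ f)
    (hg : ContDiff ℝ ∞ g) (pf : IsPeriodic τ f) (pg : IsPeriodic τ g) :
    smoothH2 (fun x => f x + g x) (hf.add hg) (fun u hu x => by simp only [pf u hu, pg u hu])
      = smoothH2 f hf pf + smoothH2 g hg pg :=
  fld_injective τ (toL2_add hf.continuous hg.continuous)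

/-- A closed property of `x₁`-independent smooth fields holds for `x₁`-independent fields. -/
theorem xInvariant_induction {τ : ℂ} [Fact (0 < τ.im)] {P : H2 τ → Prop}
    (hP : IsClosed {m | P m}) (h : ∀ (f : Plane → Spin) (hd : ContDiff ℝ ∞ f)
      (hf : IsPeriodic τ f), IsXInvariant f → P (smoothH2 f hd hf)) {m : H2 τ}
    (hm : pd m 0 = 0) : P m := by
  -- The approximants are partial Fourier sums; for $\partial_1m=0$ every nonzero term is itself
  -- independent of $x_1$, so the sums stay in the smooth invariant class.
  refine hP.mem_of_tendsto (hasSum_modeH2 m) (Filter.Eventually.of_forall fun s => ?_)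
  suffices ∃ (f : Plane → Spin) (hd : ContDiff ℝ ∞ f) (hf : IsPeriodic τ f), IsXInvariant f ∧
      ∑ n ∈ s, modeH2 τ n (cosCoeff τ n (fld m)) (sinCoeff τ n (fld m)) = smoothH2 f hd hf by
    obtain ⟨f, hd, hf, hx, e⟩ := this
    change P _
    rw [e]
    exact h f hd hf hx
  refine Finset.sum_induction _ (fun m => ∃ (f : Plane → Spin) (hd : ContDiff ℝ ∞ f)
    (hf : IsPeriodic τ f), IsXInvariant f ∧ m = smoothH2 f hd hf) ?_ ?_ ?_
  · rintro _ _ ⟨f, hd, hf, hx, rfl⟩ ⟨g, gd, hg, gx, rfl⟩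
    exact ⟨_, hd.add gd, _, fun t x => by simp only [hx t x, gx t x],
      (smoothH2_add hd gd hf hg).symm⟩
  · exact ⟨0, contDiff_const, fun _ _ _ => rfl, fun _ _ => rfl,
      fld_injective τ (toL2_zero τ).symm⟩
  · intro n _
    refine ⟨_, contDiff_mode _ _ _ _, isPeriodic_mode _ _ _ _, isXInvariant_mode ?_, rfl⟩
    by_cases hn : waveVec τ n 0 = 0
    · exact Or.inl hn
    · refine Or.inr (coeff_eq_zero_of_pd_eq_zero hm fun h0 => hn ?_)
      simp [waveVec, h0]

lemma pd_smoothH2_zero {τ : ℂ} [Fact (0 < τ.im)] {f : Plane → Spin} (hd : ContDiff ℝ ∞ f)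
    (hf : IsPeriodic τ f) (hx : IsXInvariant f) : pd (smoothH2 f hd hf) 0 = 0 := by
  change toL2 τ (pderiv 0 f) = 0
  rw [hx.pderiv_zero (hd.differentiable (by simp)), toL2_zero]

/-- `cub` is defined from the $x_1$-independent part of $m$ alone; it is the true cubic term only
when $\partial_1m=0$. -/
lemma cub_eq {τ : ℂ} [Fact (0 < τ.im)] {m : H2 τ} (hm : pd m 0 = 0) {f : Plane → Spin}
    (hf : fld m =ᵐ[cellMeasure τ] f) : cub m =ᵐ[cellMeasure τ] fun x => ‖f x‖ ^ 2 • f x := by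
  filter_upwards [coeFn_cub m, fld_eq_rep hm, hf] with x h1 h2 h3
  rw [h1, ← h2, h3]

lemma dcub_eq {τ : ℂ} [Fact (0 < τ.im)] {m : H2 τ} (hm : pd m 0 = 0) {f g : Plane → Spin}
    {u : L2 τ} (hf : fld m =ᵐ[cellMeasure τ] f) (hg : u =ᵐ[cellMeasure τ] g) :
    dcub m u =ᵐ[cellMeasure τ]
      fun x => ‖f x‖ ^ 2 • g x + (2 * inner ℝ (f x) (g x)) • f x := by
  filter_upwards [coeFn_dcub m u, fld_eq_rep hm, hf, hg] with x h1 h2 h3 h4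
  rw [h1, ← h2, h3, h4]

/-- The chain rule holds classically for smooth fields, and both `cub` and `dcub` are continuous on
$H^2_\Lambda$, so it survives the limit. -/
theorem isWeakDeriv_cub {τ : ℂ} [Fact (0 < τ.im)] {m : H2 τ} (hm : pd m 0 = 0) :
    IsWeakDeriv τ 1 (cub m) (dcub m (pd m 1)) := by
  refine xInvariant_induction (P := fun m => IsWeakDeriv τ 1 (cub m) (dcub m (pd m 1)))
    (isClosed_isWeakDeriv τ 1 (contDiff_cub τ).continuous
      ((continuous_dcub τ).clm_apply (pdL τ 1).continuous)) (fun f hd hf hx => ?_) hm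
  have h0 := pd_smoothH2_zero hd hf hx
  have h1 : fld (smoothH2 f hd hf) =ᵐ[cellMeasure τ] f := coeFn_toL2 τ hd.continuous
  have h2 : pd (smoothH2 f hd hf) 1 =ᵐ[cellMeasure τ] pderiv 1 f :=
    coeFn_toL2 τ (continuous_pderiv (hd.of_le (by simp)) 1)
  have hg : ContDiff ℝ ∞ fun x => ‖f x‖ ^ 2 • f x := (hd.norm_sq ℝ).smul hd
  have e1 := toL2_eq_of_ae (cub_eq h0 h1).symm
  have e2 := toL2_eq_of_ae (dcub_eq h0 h1 h2).symm
  have e3 : pderiv 1 (fun x => ‖f x‖ ^ 2 • f x)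
      = fun x => ‖f x‖ ^ 2 • pderiv 1 f x + (2 * inner ℝ (f x) (pderiv 1 f x)) • f x := by
    ext1 x
    have hfx := (hd.differentiable (by simp) x).hasFDerivAt
    have := hfx.norm_sq.fun_smul hfx
    rw [pderiv, this.fderiv]
    simp [pderiv]
  rw [← e1, ← e2, ← e3]
  exact isWeakDeriv_toL2 (fun u hu x => by simp only [hf u hu]) (hg.of_le (by simp)) 1

lemma isWeakDeriv_zero_pdd {τ : ℂ} [Fact (0 < τ.im)] {m : H2 τ} (hm : pd m 0 = 0) :
    IsWeakDeriv τ 0 (pdd m 1 1) 0 := by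
  refine xInvariant_induction (P := fun m => IsWeakDeriv τ 0 (pdd m 1 1) 0)
    (isClosed_isWeakDeriv τ 0 (pddL τ 1 1).continuous continuous_const)
    (fun f hd hf hx => ?_) hm
  have h := isWeakDeriv_toL2 ((hf.pderiv 1).pderiv 1)
    ((contDiff_pderiv (contDiff_pderiv hd 1) 1).of_le (by simp)) 0
  rwa [((hx.pderiv 1).pderiv 1).pderiv_zero
    ((contDiff_pderiv (contDiff_pderiv hd 1) 1).differentiable (by simp)), toL2_zero] at h

lemma pdd_zero_eq_zero {τ : ℂ} [Fact (0 < τ.im)] {m : H2 τ} (hm : pd m 0 = 0) (j : Fin 2) :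
    pdd m 0 j = 0 :=
  (isWeakDeriv_pdd m 0 j).unique (by rw [hm]; exact IsWeakDeriv.zero τ j)

lemma pdd_one_zero_eq_zero {τ : ℂ} [Fact (0 < τ.im)] {m : H2 τ} (hm : pd m 0 = 0) :
    pdd m 1 0 = 0 := by
  have h : ∀ n, cosCoeff τ n (pdd m 1 0) = 0 ∧ sinCoeff τ n (pdd m 1 0) = 0 := fun n => by
    have h1 := (isWeakDeriv_pd m 0).cosCoeff_eq n
    have h2 := (isWeakDeriv_pd m 0).sinCoeff_eq n
    rw [hm, map_zero, eq_comm] at h1 h2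
    rw [neg_eq_zero] at h2
    rw [(isWeakDeriv_pdd m 1 0).cosCoeff_eq, (isWeakDeriv_pdd m 1 0).sinCoeff_eq,
      (isWeakDeriv_pd m 1).cosCoeff_eq, (isWeakDeriv_pd m 1).sinCoeff_eq, smul_neg, smul_comm,
      h2, smul_comm, h1]
    simp
  exact eq_of_coeff_eq (fun n => by rw [(h n).1, map_zero]) (fun n => by rw [(h n).2, map_zero])

/-- The derivative of an `x₁`-independent solution lies in `H²_Λ` and in the kernel of the
linearization. -/
theorem exists_deriv_mem_kernel {τ : ℂ} [Fact (0 < τ.im)] {κ α β lam : ℝ} {m : H2 τ}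
    (hm : pd m 0 = 0) (heq : linPart κ β lam τ m + α • cub m = 0) :
    ∃ η : H2 τ, fld η = pd m 1 ∧ pd η 0 = 0 ∧
      linPart κ β lam τ η + α • dcub m (fld η) = 0 := by
  -- With no $x_1$-dependence the equation is an ODE solved for $\partial_2^2m$. Every term on the
  -- right has a weak $\partial_2$ in $L^2$, so a third derivative exists and is the field $D$
  -- below; this regularity places $\partial_2m$ in $H^2_\Lambda$.
  have e : pdd m 1 1 = (2 * κ) • pointwise τ (curlMat 1) (pd m 1) + lam • fld m
      + β • pointwise τ thirdProj (fld m) + α • cub m := by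
    rw [linPart_apply, hm, pdd_zero_eq_zero hm, map_zero, zero_add, zero_add] at heq
    linear_combination (norm := module) -heq
  set D : L2 τ := (2 * κ) • pointwise τ (curlMat 1) (pdd m 1 1) + lam • pd m 1
      + β • pointwise τ thirdProj (pd m 1) + α • dcub m (pd m 1) with hD
  have hDw : IsWeakDeriv τ 1 (pdd m 1 1) D := by
    rw [e, hD]
    exact (((((isWeakDeriv_pdd m 1 1).pointwise _).smul _).add
      ((isWeakDeriv_pd m 1).smul lam)).add (((isWeakDeriv_pd m 1).pointwise _).smul β)).add
      ((isWeakDeriv_cub hm).smul α)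
  have h10 := pdd_one_zero_eq_zero hm
  refine ⟨⟨(pd m 1, fun i => pdd m 1 i, ![fun _ => 0, ![0, D]]), fun i => isWeakDeriv_pdd m 1 i,
    fun i j => ?_⟩, rfl, h10, ?_⟩
  · fin_cases i
    · change IsWeakDeriv τ j (pdd m 1 0) 0
      rw [h10]
      exact IsWeakDeriv.zero τ j
    · fin_cases j
      · exact isWeakDeriv_zero_pdd hm
      · exact hDw
  · rw [linPart_apply]
    change -(0 + D) + (2 * κ) • (pointwise τ (curlMat 0) (pdd m 1 0)
      + pointwise τ (curlMat 1) (pdd m 1 1)) + lam • pd m 1 + β • pointwise τ thirdProj (pd m 1)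
      + α • dcub m (pd m 1) = 0
    rw [h10, map_zero, hD]
    module

/-! ### Symmetry of the linearization -/

/-- The symbol of the curl. -/
def curlSymbol (v : Plane) : Spin →L[ℝ] Spin := v 0 • curlMat 0 + v 1 • curlMat 1

lemma curlSymbol_apply (v : Plane) (w : Spin) :
    curlSymbol v w = !₂[v 1 * w 2, -(v 0 * w 2), v 0 * w 1 - v 1 * w 0] := by
  simp only [curlSymbol, add_apply, smul_apply, curlMat_zero_apply, curlMat_one_apply]
  ext j
  fin_cases j <;> simp [sub_eq_add_neg]

lemma cosCoeff_linPart (κ β lam : ℝ) {τ : ℂ} [Fact (0 < τ.im)] (m : H2 τ) (n : Fin 2 → ℤ) :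
    cosCoeff τ n (linPart κ β lam τ m) = (‖waveVec τ n‖ ^ 2 + lam) • cosCoeff τ n (fld m)
      + (2 * κ) • curlSymbol (waveVec τ n) (sinCoeff τ n (fld m))
      + β • thirdProj (cosCoeff τ n (fld m)) := by
  rw [linPart_apply]
  simp only [map_add, map_neg, map_smul, cosCoeff_pdd, cosCoeff_pointwise,
    (isWeakDeriv_pd m _).cosCoeff_eq, curlSymbol, add_apply, smul_apply,
    EuclideanSpace.norm_sq_eq, Fin.sum_univ_two, Real.norm_eq_abs, sq_abs]
  module

lemma sinCoeff_linPart (κ β lam : ℝ) {τ : ℂ} [Fact (0 < τ.im)] (m : H2 τ) (n : Fin 2 → ℤ) :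
    sinCoeff τ n (linPart κ β lam τ m) = (‖waveVec τ n‖ ^ 2 + lam) • sinCoeff τ n (fld m)
      - (2 * κ) • curlSymbol (waveVec τ n) (cosCoeff τ n (fld m))
      + β • thirdProj (sinCoeff τ n (fld m)) := by
  rw [linPart_apply]
  simp only [map_add, map_neg, map_smul, sinCoeff_pdd, sinCoeff_pointwise,
    (isWeakDeriv_pd m _).sinCoeff_eq, curlSymbol, add_apply, smul_apply,
    EuclideanSpace.norm_sq_eq, Fin.sum_univ_two, Real.norm_eq_abs, sq_abs]
  module

/-- By Parseval this is symmetry of each symbol: `curlSymbol v` is the antisymmetric map $w\mapsto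
v\times w$, and it couples cosine and sine coefficients with opposite signs. -/
lemma inner_linPart_comm (κ β lam : ℝ) {τ : ℂ} [Fact (0 < τ.im)] (m w : H2 τ) :
    inner ℝ (linPart κ β lam τ m) (fld w) = inner ℝ (fld m) (linPart κ β lam τ w) := by
  refine (hasSum_inner τ _ _).unique ((hasSum_inner τ _ _).congr_fun fun n => ?_)
  rw [cosCoeff_linPart, sinCoeff_linPart, cosCoeff_linPart, sinCoeff_linPart]
  simp only [curlSymbol_apply, thirdProj_apply, PiLp.inner_apply, Fin.sum_univ_three]
  simp
  ring

lemma inner_dcub_comm {τ : ℂ} (m : H2 τ) (u v : L2 τ) :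
    inner ℝ (dcub m u) v = inner ℝ u (dcub m v) := by
  rw [inner_eq_integral (coeFn_dcub m u) (Filter.EventuallyEq.refl _ v),
    inner_eq_integral (Filter.EventuallyEq.refl _ u) (coeFn_dcub m v)]
  congr 1
  ext1 x
  simp only [inner_add_left, inner_add_right, real_inner_smul_left, real_inner_smul_right,
    real_inner_comm (rep m x)]
  ring

/-! ### Spectral gap -/

lemma waveVec_mem_dualLattice (τ : ℂ) [Fact (0 < τ.im)] (n : Fin 2 → ℤ) :
    waveVec τ n ∈ dualLattice τ := by
  intro u hu
  obtain ⟨k, hk⟩ := exists_phase_eq_of_mem_lattice n hu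
  exact ⟨k, by rw [real_inner_comm, mul_comm, ← hk]; rfl⟩

lemma norm_sq_waveVec (τ : ℂ) (n : Fin 2 → ℤ) :
    ‖waveVec τ n‖ ^ 2 = (n 0 * τ.im) ^ 2 + (n 1 - n 0 * τ.re) ^ 2 := by
  simp [EuclideanSpace.norm_sq_eq, Fin.sum_univ_two, waveVec]

/-- $|v|^2=n_0^2|\tau|^2+n_1^2-2\operatorname{Re}\tau\,n_0n_1>n_0^2+n_1^2-|n_0n_1|\ge1$, strict
because $|\tau|>1$ and $n_0\neq0$. This is where the equilateral lattice is excluded. -/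
lemma one_lt_norm_waveVec {τ : ℂ} (hτ : IsNonEquilateral τ) {n : Fin 2 → ℤ} (hn : n 0 ≠ 0) :
    1 < ‖waveVec τ n‖ := by
  obtain ⟨h0, h1, h2, h3⟩ := hτ
  have h4 : 1 < τ.re ^ 2 + τ.im ^ 2 := by
    have : ‖τ‖ ^ 2 = τ.re ^ 2 + τ.im ^ 2 := by rw [Complex.sq_norm, Complex.normSq_apply]; ring
    nlinarith
  have key : 1 < ‖waveVec τ n‖ ^ 2 := by
    rw [norm_sq_waveVec]
    have e : ((n 0 : ℝ) * τ.im) ^ 2 + (n 1 - n 0 * τ.re) ^ 2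
        = (n 0 : ℝ) ^ 2 * (τ.re ^ 2 + τ.im ^ 2) + (n 1 : ℝ) ^ 2 - 2 * τ.re * ((n 0 : ℝ) * n 1) := by
      ring
    have hn2 : (0 : ℝ) < (n 0 : ℝ) ^ 2 := by positivity
    have i1 : (n 0 : ℝ) ^ 2 * 1 < (n 0 : ℝ) ^ 2 * (τ.re ^ 2 + τ.im ^ 2) :=
      mul_lt_mul_of_pos_left h4 hn2
    have i2 : 2 * τ.re * ((n 0 : ℝ) * n 1) ≤ |(n 0 : ℝ) * n 1| := by
      refine (le_abs_self _).trans ?_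
      rw [abs_mul]
      exact mul_le_of_le_one_left (abs_nonneg _) (abs_le.2 ⟨by linarith, by linarith⟩)
    have i3 : (1 : ℤ) ≤ n 0 ^ 2 + n 1 ^ 2 - |n 0 * n 1| := by
      have p1 : 0 < |n 0| := abs_pos.2 hn
      have p2 : 0 ≤ |n 1| := abs_nonneg _
      rw [abs_mul, ← sq_abs (n 0), ← sq_abs (n 1)]
      rcases eq_or_lt_of_le p2 with h | h
      · rw [← h]; nlinarith
      · nlinarith [sq_nonneg (|n 0| - |n 1|)]
    have i4 : (1 : ℝ) ≤ (n 0 : ℝ) ^ 2 + (n 1 : ℝ) ^ 2 - |(n 0 : ℝ) * n 1| := by exact_mod_cast i3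
    rw [e]
    linarith
  nlinarith [norm_nonneg (waveVec τ n)]

lemma norm_waveVec_of_eq_zero {τ : ℂ} {n : Fin 2 → ℤ} (hn : n 0 = 0) :
    ‖waveVec τ n‖ = |(n 1 : ℝ)| := by
  have := norm_sq_waveVec τ n
  simp only [hn, Int.cast_zero, zero_mul, sub_zero, ne_eq, OfNat.ofNat_ne_zero, not_false_eq_true,
    zero_pow, zero_add] at this
  rw [← sq_abs (n 1 : ℝ)] at this
  exact (pow_left_inj₀ (norm_nonneg _) (abs_nonneg _) two_ne_zero).1 this

lemma eq_of_norm_waveVec_eq_one {τ : ℂ} (hτ : IsNonEquilateral τ) {n : Fin 2 → ℤ}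
    (hn : ‖waveVec τ n‖ = 1) : n = ![0, 1] ∨ n = ![0, -1] := by
  have h0 : n 0 = 0 := by
    by_contra h
    exact (one_lt_norm_waveVec hτ h).ne' hn
  rw [norm_waveVec_of_eq_zero h0] at hn
  have : |n 1| = 1 := by exact_mod_cast hn
  rcases (abs_eq zero_le_one).1 this with h | h
  · left; ext i; fin_cases i <;> simp [h0, h]
  · right; ext i; fin_cases i <;> simp [h0, h]

lemma norm_waveVec_trichotomy {τ : ℂ} (hτ : IsNonEquilateral τ) (n : Fin 2 → ℤ) :
    ‖waveVec τ n‖ = 0 ∨ ‖waveVec τ n‖ = 1 ∨ 1 < ‖waveVec τ n‖ := by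
  by_cases h0 : n 0 = 0
  · rw [norm_waveVec_of_eq_zero h0, ← Int.cast_abs]
    have : 0 ≤ |n 1| := abs_nonneg _
    have h : |n 1| = 0 ∨ |n 1| = 1 ∨ 1 < |n 1| := by omega
    exact_mod_cast h
  · exact Or.inr (Or.inr (one_lt_norm_waveVec hτ h0))

/-- The lowest eigenvalue of the symbol at wave number `r`. -/
def dispersion (κ β r : ℝ) : ℝ :=
  r ^ 2 + lam0 κ β + β / 2 - Real.sqrt (4 * κ ^ 2 * r ^ 2 + β ^ 2 / 4)

/-- Let $S,R$ be the square roots at wave numbers $1$ and $r$. The claim is $R-S\le r^2-1$. Since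
$(R-S)(R+S)=4\kappa^2(r^2-1)$, it follows from $4\kappa^2\le S+R$, which holds at $\gamma$ and hence
at every $r\ge\gamma$. -/
lemma dispersion_nonneg {κ β r γ : ℝ} (hr : 1 ≤ r) (hγ0 : 0 ≤ γ) (hγr : γ ≤ r)
    (hγ : 4 * κ ^ 2 ≤ Real.sqrt (4 * κ ^ 2 + β ^ 2 / 4)
      + Real.sqrt (4 * κ ^ 2 * γ ^ 2 + β ^ 2 / 4)) : 0 ≤ dispersion κ β r := by
  have hmono : Real.sqrt (4 * κ ^ 2 * γ ^ 2 + β ^ 2 / 4)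
      ≤ Real.sqrt (4 * κ ^ 2 * r ^ 2 + β ^ 2 / 4) := by gcongr
  have hmono' : Real.sqrt (4 * κ ^ 2 + β ^ 2 / 4)
      ≤ Real.sqrt (4 * κ ^ 2 * r ^ 2 + β ^ 2 / 4) := by
    refine Real.sqrt_le_sqrt ?_
    nlinarith [sq_nonneg κ, mul_nonneg (sq_nonneg κ) (by nlinarith : 0 ≤ r ^ 2 - 1)]
  rw [dispersion, lam0]
  set S := Real.sqrt (4 * κ ^ 2 + β ^ 2 / 4) with hS
  set R := Real.sqrt (4 * κ ^ 2 * r ^ 2 + β ^ 2 / 4) with hR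
  have hS2 : S ^ 2 = 4 * κ ^ 2 + β ^ 2 / 4 := Real.sq_sqrt (by positivity)
  have hR2 : R ^ 2 = 4 * κ ^ 2 * r ^ 2 + β ^ 2 / 4 := Real.sq_sqrt (by positivity)
  have hS0 : 0 ≤ S := Real.sqrt_nonneg _
  rcases eq_or_lt_of_le (add_nonneg hS0 (Real.sqrt_nonneg (4 * κ ^ 2 * r ^ 2 + β ^ 2 / 4)))
    with h | h
  · have : R - S ≤ 0 := by linarith
    nlinarith
  · have e : (R - S) * (S + R) = 4 * κ ^ 2 * (r ^ 2 - 1) := by nlinarith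
    have : (R - S) * (S + R) ≤ (r ^ 2 - 1) * (S + R) := by
      rw [e, mul_comm]
      exact mul_le_mul_of_nonneg_left (by linarith) (by nlinarith)
    have := le_of_mul_le_mul_right this h
    linarith

lemma finite_norm_waveVec_le {τ : ℂ} [hτ : Fact (0 < τ.im)] (R : ℝ) :
    {n : Fin 2 → ℤ | ‖waveVec τ n‖ ≤ R}.Finite := by
  have h0 := hτ.out
  obtain ⟨N, hN⟩ := exists_nat_ge (R / τ.im)
  obtain ⟨M, hM⟩ := exists_nat_ge (R + N * |τ.re|)
  refine (Set.finite_Icc (fun _ => -((N : ℤ) + M)) (fun _ => (N : ℤ) + M)).subset fun n hn => ?_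
  have hn' : ‖waveVec τ n‖ ≤ R := hn
  have c0 := (PiLp.norm_apply_le (waveVec τ n) 0).trans hn'
  have c1 := (PiLp.norm_apply_le (waveVec τ n) 1).trans hn'
  simp only [waveVec, Matrix.cons_val_zero, Matrix.cons_val_one, Matrix.cons_val_fin_one,
    Real.norm_eq_abs] at c0 c1
  rw [abs_mul, abs_of_pos h0, ← le_div_iff₀ h0] at c0
  have d0 : |(n 0 : ℝ)| ≤ N := c0.trans hN
  have d1 : |(n 1 : ℝ)| ≤ M := by
    have : |(n 1 : ℝ)| ≤ |n 1 - n 0 * τ.re| + |n 0 * τ.re| := by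
      simpa using abs_add_le ((n 1 : ℝ) - n 0 * τ.re) (n 0 * τ.re)
    rw [abs_mul (n 0 : ℝ)] at this
    have := mul_le_mul_of_nonneg_right d0 (abs_nonneg τ.re)
    linarith
  have e0 : |n 0| ≤ (N : ℤ) := by exact_mod_cast d0
  have e1 : |n 1| ≤ (M : ℤ) := by exact_mod_cast d1
  rw [abs_le] at e0 e1
  constructor
  · intro i; fin_cases i <;> simp <;> omega
  · intro i; fin_cases i <;> simp <;> omega

/-- The parameter assumptions: the lattice is not equilateral, and `1` is the only critical
wave number. -/
structure Admissible (κ β : ℝ) (τ : ℂ) : Prop where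
  kappa_pos : 0 < κ
  beta_nonneg : 0 ≤ β
  nonEquilateral : IsNonEquilateral τ
  nonResonant : NonResonant κ β τ
  lam0_pos : 0 < lam0 κ β
  gamma_le : 4 * κ ^ 2 ≤ Real.sqrt (4 * κ ^ 2 + β ^ 2 / 4)
    + Real.sqrt (4 * κ ^ 2 * secondWaveNumber τ ^ 2 + β ^ 2 / 4)

/-- At $v=0$ the value is $\lambda_0$ itself. For $|v|>1$ the vector is at least as long as the
second critical wave number, and non-resonance rules out equality. -/
lemma Admissible.dispersion_pos {κ β : ℝ} {τ : ℂ} [Fact (0 < τ.im)] (h : Admissible κ β τ)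
    {n : Fin 2 → ℤ} (hn : ‖waveVec τ n‖ ≠ 1) : 0 < dispersion κ β ‖waveVec τ n‖ := by
  rcases norm_waveVec_trichotomy h.nonEquilateral n with h0 | h1 | h1
  · have : Real.sqrt (β ^ 2 / 4) = β / 2 := by
      rw [show β ^ 2 / 4 = (β / 2) ^ 2 by ring]
      exact Real.sqrt_sq (by linarith [h.beta_nonneg])
    simp [dispersion, h0, this, h.lam0_pos]
  · exact absurd h1 hn
  · have hbdd : BddBelow {r : ℝ | ∃ v ∈ dualLattice τ, 1 < ‖v‖ ∧ r = ‖v‖} :=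
      ⟨1, by rintro _ ⟨v, _, hv, rfl⟩; exact hv.le⟩
    have hle : secondWaveNumber τ ≤ ‖waveVec τ n‖ :=
      csInf_le hbdd ⟨_, waveVec_mem_dualLattice τ n, h1, rfl⟩
    have hnn : 0 ≤ secondWaveNumber τ :=
      Real.sInf_nonneg (by rintro _ ⟨v, _, _, rfl⟩; exact norm_nonneg _)
    refine lt_of_le_of_ne (dispersion_nonneg h1.le hnn hle h.gamma_le) fun h' => ?_
    refine (h.nonResonant _ (waveVec_mem_dualLattice τ n) hn).1 ?_
    rw [dispersion] at h'
    linarith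

/-- For $r>2\kappa+1$ the square root is at most $2\kappa r+\beta/2$, so the value exceeds
$r(r-2\kappa)\ge1$; below that threshold there are finitely many wave vectors. -/
lemma Admissible.exists_gap {κ β : ℝ} {τ : ℂ} [Fact (0 < τ.im)] (h : Admissible κ β τ) :
    ∃ c, 0 < c ∧ ∀ n, ‖waveVec τ n‖ ≠ 1 → c ≤ dispersion κ β ‖waveVec τ n‖ := by
  have hfin : {n : Fin 2 → ℤ | ‖waveVec τ n‖ ≤ 2 * κ + 1 ∧ ‖waveVec τ n‖ ≠ 1}.Finite :=
    (finite_norm_waveVec_le (2 * κ + 1)).subset fun n hn => hn.1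
  have hκ := h.kappa_pos
  obtain ⟨n₀, hn₀, hmin⟩ := Set.exists_min_image _
    (fun n => dispersion κ β ‖waveVec τ n‖) hfin ⟨0, by
      have : waveVec τ 0 = 0 := by ext i; fin_cases i <;> simp [waveVec]
      simp [this]; linarith⟩
  refine ⟨min 1 (dispersion κ β ‖waveVec τ n₀‖), lt_min one_pos (h.dispersion_pos hn₀.2),
    fun n hn => ?_⟩
  rcases le_or_gt ‖waveVec τ n‖ (2 * κ + 1) with hle | hlt
  · exact (min_le_right _ _).trans (hmin n ⟨hle, hn⟩)
  · refine (min_le_left _ _).trans ?_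
    have hs : Real.sqrt (4 * κ ^ 2 * ‖waveVec τ n‖ ^ 2 + β ^ 2 / 4)
        ≤ 2 * κ * ‖waveVec τ n‖ + β / 2 := by
      have h1 : 0 ≤ 2 * κ * ‖waveVec τ n‖ := by positivity
      have h2 := h.beta_nonneg
      refine Real.sqrt_le_iff.2 ⟨by positivity, ?_⟩
      nlinarith
    have := h.lam0_pos
    rw [dispersion]
    nlinarith

/-- A discriminant condition: $(4\kappa yp)^2\le4(ax)(by^2)\le(ax+by^2)^2$. -/
lemma quadratic_form_nonneg {κ a b x y p ρ : ℝ} (ha : 0 ≤ a) (hb : 0 ≤ b) (hx : 0 ≤ x)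
    (hab : a * b = 4 * κ ^ 2 * ρ) (hp : p ^ 2 ≤ ρ * x) :
    0 ≤ a * x + b * y ^ 2 + 4 * κ * (y * p) := by
  have h1 : (4 * κ * (y * p)) ^ 2 ≤ (a * x + b * y ^ 2) ^ 2 := by
    have : (4 * κ * (y * p)) ^ 2 ≤ 4 * (a * x) * (b * y ^ 2) := by
      calc (4 * κ * (y * p)) ^ 2 = 16 * κ ^ 2 * y ^ 2 * p ^ 2 := by ring
        _ ≤ 16 * κ ^ 2 * y ^ 2 * (ρ * x) := by gcongr
        _ = 4 * (4 * κ ^ 2 * ρ) * (x * y ^ 2) := by ring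
        _ = 4 * (a * x) * (b * y ^ 2) := by rw [← hab]; ring
    nlinarith [sq_nonneg (a * x - b * y ^ 2)]
  have := abs_le_of_sq_le_sq h1 (by positivity)
  linarith [(abs_le.1 this).1]

/-- The quadratic form of the symbol. -/
def symbolForm (κ β lam : ℝ) (v : Plane) (a b : Spin) : ℝ :=
  (‖v‖ ^ 2 + lam) * (‖a‖ ^ 2 + ‖b‖ ^ 2) + β * (a 2 ^ 2 + b 2 ^ 2)
    + 4 * κ * (b 2 * (v 1 * a 0 - v 0 * a 1) + a 2 * (v 0 * b 1 - v 1 * b 0))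

lemma hasSum_symbolForm (κ β lam : ℝ) {τ : ℂ} [Fact (0 < τ.im)] (m : H2 τ) :
    HasSum (fun n => symbolForm κ β lam (waveVec τ n) (cosCoeff τ n (fld m))
      (sinCoeff τ n (fld m))) (inner ℝ (linPart κ β lam τ m) (fld m)) := by
  refine (hasSum_inner τ _ _).congr_fun fun n => ?_
  rw [cosCoeff_linPart, sinCoeff_linPart]
  simp only [curlSymbol_apply, thirdProj_apply, PiLp.inner_apply, Fin.sum_univ_three, symbolForm,
    EuclideanSpace.norm_sq_eq]
  simp
  ring

/-- The form decouples into the blocks $(a_0,a_1,b_2)$ and $(b_0,b_1,a_2)$. After subtracting the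
lowest eigenvalue the planar entries carry the weight $R-\beta/2$ and the third ones $R+\beta/2$,
whose product is exactly $4\kappa^2|v|^2$, and Cauchy–Schwarz bounds the coupling. -/
lemma le_symbolForm {κ β : ℝ} (hβ : 0 ≤ β) (v : Plane) (a b : Spin) :
    dispersion κ β ‖v‖ * (‖a‖ ^ 2 + ‖b‖ ^ 2) ≤ symbolForm κ β (lam0 κ β) v a b := by
  set R := Real.sqrt (4 * κ ^ 2 * ‖v‖ ^ 2 + β ^ 2 / 4) with hR
  have hR2 : R ^ 2 = 4 * κ ^ 2 * ‖v‖ ^ 2 + β ^ 2 / 4 := Real.sq_sqrt (by positivity)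
  have hRβ : β / 2 ≤ R := Real.le_sqrt_of_sq_le (by nlinarith [sq_nonneg (κ * ‖v‖)])
  have hab : (R - β / 2) * (R + β / 2) = 4 * κ ^ 2 * ‖v‖ ^ 2 := by linarith
  have hv : ‖v‖ ^ 2 = v 0 ^ 2 + v 1 ^ 2 := by simp [EuclideanSpace.norm_sq_eq, Fin.sum_univ_two]
  have h1 := quadratic_form_nonneg (κ := κ) (x := a 0 ^ 2 + a 1 ^ 2) (y := b 2)
    (p := v 1 * a 0 - v 0 * a 1) (by linarith : 0 ≤ R - β / 2) (by linarith : 0 ≤ R + β / 2)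
    (by positivity) hab (by rw [hv]; nlinarith [sq_nonneg (v 0 * a 0 + v 1 * a 1)])
  have h2 := quadratic_form_nonneg (κ := κ) (x := b 0 ^ 2 + b 1 ^ 2) (y := a 2)
    (p := v 0 * b 1 - v 1 * b 0) (by linarith : 0 ≤ R - β / 2) (by linarith : 0 ≤ R + β / 2)
    (by positivity) hab (by rw [hv]; nlinarith [sq_nonneg (v 0 * b 0 + v 1 * b 1)])
  simp only [symbolForm, dispersion, ← hR]
  have ea : ‖a‖ ^ 2 = a 0 ^ 2 + a 1 ^ 2 + a 2 ^ 2 := by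
    simp [EuclideanSpace.norm_sq_eq, Fin.sum_univ_three]
  have eb : ‖b‖ ^ 2 = b 0 ^ 2 + b 1 ^ 2 + b 2 ^ 2 := by
    simp [EuclideanSpace.norm_sq_eq, Fin.sum_univ_three]
  rw [ea, eb]
  linarith

/-! ### The critical modes -/

lemma one_add_lam0_pos {κ : ℝ} (β : ℝ) (hκ : 0 < κ) : 0 < 1 + lam0 κ β := by
  have : β / 2 < Real.sqrt (4 * κ ^ 2 + β ^ 2 / 4) :=
    Real.lt_sqrt_of_sq_lt (by nlinarith [mul_pos hκ hκ])
  rw [lam0]; linarith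

/-- This identity and `two_mul_amplitude` are the first and third components of the eigenvector
equation for $\varphi_1$. -/
lemma amplitude_mul {κ : ℝ} (β : ℝ) (hκ : 0 < κ) :
    (1 + lam0 κ β) * amplitude κ β = 2 * κ := by
  have := one_add_lam0_pos β hκ
  have e : -(β / 2) + Real.sqrt (4 * κ ^ 2 + β ^ 2 / 4) = 1 + lam0 κ β := by rw [lam0]; ring
  rw [amplitude, e]
  field_simp

lemma two_mul_amplitude {κ : ℝ} (β : ℝ) (hκ : 0 < κ) :
    2 * κ * amplitude κ β = 1 + lam0 κ β + β := by
  have h0 := one_add_lam0_pos β hκ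
  have h1 := amplitude_mul β hκ
  have h2 : (1 + lam0 κ β) * (1 + lam0 κ β + β) = 4 * κ ^ 2 := by
    have : Real.sqrt (4 * κ ^ 2 + β ^ 2 / 4) ^ 2 = 4 * κ ^ 2 + β ^ 2 / 4 :=
      Real.sq_sqrt (by positivity)
    rw [lam0]
    linarith
  refine mul_left_cancel₀ h0.ne' ?_
  linear_combination 2 * κ * h1 - h2

/-- The cosine amplitude of `φ₁`. -/
def helCos (κ β : ℝ) : Spin :=
  Real.sqrt (2 / (1 + amplitude κ β ^ 2)) • EuclideanSpace.single 2 1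

/-- The sine amplitude of `φ₁`. -/
def helSin (κ β : ℝ) : Spin :=
  (Real.sqrt (2 / (1 + amplitude κ β ^ 2)) * amplitude κ β) • EuclideanSpace.single 0 1

lemma phase_zero_one (τ : ℂ) (x : Plane) : phase τ ![0, 1] x = x 1 := by
  simp [phase_apply]

lemma helicalMode_eq (κ β : ℝ) (τ : ℂ) :
    helicalMode κ β = mode τ ![0, 1] (helCos κ β) (helSin κ β) := by
  ext x j
  simp only [helicalMode, mode, phase_zero_one, helCos, helSin]
  fin_cases j <;> simp <;> ring

/-- The critical mode `φ₁` in `H²_Λ`. -/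
def phi1 (κ β : ℝ) (τ : ℂ) [Fact (0 < τ.im)] : H2 τ :=
  modeH2 τ ![0, 1] (helCos κ β) (helSin κ β)

/-- The critical mode `φ₂ = ∂₂ φ₁` in `H²_Λ`. -/
def phi2 (κ β : ℝ) (τ : ℂ) [Fact (0 < τ.im)] : H2 τ :=
  modeH2 τ ![0, 1] (helSin κ β) (-helCos κ β)

lemma fld_phi1 (κ β : ℝ) (τ : ℂ) [Fact (0 < τ.im)] :
    fld (phi1 κ β τ) =ᵐ[cellMeasure τ] helicalMode κ β := by
  rw [helicalMode_eq κ β τ]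
  exact coeFn_toL2 τ (continuous_mode _ _ _ _)

lemma pd_phi1_zero (κ β : ℝ) (τ : ℂ) [Fact (0 < τ.im)] : pd (phi1 κ β τ) 0 = 0 :=
  pd_smoothH2_zero (contDiff_mode _ _ _ _) (isPeriodic_mode _ _ _ _)
    (isXInvariant_mode (Or.inl (by simp [waveVec])))

lemma pd_phi1_one (κ β : ℝ) (τ : ℂ) [Fact (0 < τ.im)] :
    pd (phi1 κ β τ) 1 = fld (phi2 κ β τ) := by
  change toL2 τ (pderiv 1 (mode τ ![0, 1] _ _)) = toL2 τ (mode τ ![0, 1] _ _)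
  rw [pderiv_mode, waveVec_zero_cons]
  simp

lemma toL2_mode_add (τ : ℂ) (n : Fin 2 → ℤ) (a b a' b' : Spin) :
    toL2 τ (mode τ n a b) + toL2 τ (mode τ n a' b') = toL2 τ (mode τ n (a + a') (b + b')) := by
  rw [← toL2_add (continuous_mode _ _ _ _) (continuous_mode _ _ _ _)]
  congr 1
  ext1 x
  simp only [mode]
  module

lemma toL2_mode_smul (τ : ℂ) (n : Fin 2 → ℤ) (a b : Spin) (c : ℝ) :
    c • toL2 τ (mode τ n a b) = toL2 τ (mode τ n (c • a) (c • b)) := by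
  rw [← toL2_smul c (continuous_mode _ _ _ _)]
  congr 1
  ext1 x
  simp only [mode]
  module

lemma pointwise_toL2_mode (τ : ℂ) (n : Fin 2 → ℤ) (a b : Spin) (A : Spin →L[ℝ] Spin) :
    pointwise τ A (toL2 τ (mode τ n a b)) = toL2 τ (mode τ n (A a) (A b)) := by
  symm
  refine toL2_eq_of_ae ?_
  filter_upwards [coeFn_pointwise A (toL2 τ (mode τ n a b)),
    coeFn_toL2 τ (continuous_mode τ n a b)] with x h1 h2
  rw [h1, h2]
  simp [mode]

lemma linPart_modeH2 (κ β lam : ℝ) (τ : ℂ) [Fact (0 < τ.im)] (n : Fin 2 → ℤ) (a b : Spin) :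
    linPart κ β lam τ (modeH2 τ n a b) = toL2 τ (mode τ n
      ((‖waveVec τ n‖ ^ 2 + lam) • a + (2 * κ) • curlSymbol (waveVec τ n) b + β • thirdProj a)
      ((‖waveVec τ n‖ ^ 2 + lam) • b - (2 * κ) • curlSymbol (waveVec τ n) a + β • thirdProj b)) := by
  rw [linPart_apply]
  have e0 : fld (modeH2 τ n a b) = toL2 τ (mode τ n a b) := rfl
  have e1 : ∀ i, pd (modeH2 τ n a b) i
      = toL2 τ (mode τ n (waveVec τ n i • b) (-(waveVec τ n i • a))) := fun i =>
    congrArg (toL2 τ) (pderiv_mode τ n a b i)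
  have e2 : ∀ i, pdd (modeH2 τ n a b) i i = toL2 τ (mode τ n
      (waveVec τ n i • (-(waveVec τ n i • a))) (-(waveVec τ n i • (waveVec τ n i • b)))) :=
    fun i => by
      change toL2 τ (pderiv i (pderiv i (mode τ n a b))) = _
      rw [pderiv_mode, pderiv_mode]
  rw [e0, e1, e1, e2, e2, ← neg_one_smul ℝ (toL2 τ _ + toL2 τ _)]
  simp only [pointwise_toL2_mode, toL2_mode_add, toL2_mode_smul]
  congr 2
  · simp only [curlSymbol, add_apply, smul_apply, EuclideanSpace.norm_sq_eq, Fin.sum_univ_two,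
      Real.norm_eq_abs, sq_abs, map_smul]
    module
  · simp only [curlSymbol, add_apply, smul_apply, EuclideanSpace.norm_sq_eq, Fin.sum_univ_two,
      Real.norm_eq_abs, sq_abs, map_smul, map_neg]
    module

lemma norm_waveVec_zero_one (τ : ℂ) : ‖waveVec τ ![0, 1]‖ = 1 := by
  rw [norm_waveVec_of_eq_zero (by simp)]; simp

lemma linPart_phi1 {κ : ℝ} (β : ℝ) (hκ : 0 < κ) (τ : ℂ) [Fact (0 < τ.im)] :
    linPart κ β (lam0 κ β) τ (phi1 κ β τ) = 0 := by
  have h1 := amplitude_mul β hκ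
  have h2 := two_mul_amplitude β hκ
  rw [phi1, linPart_modeH2, norm_waveVec_zero_one]
  set ρ := Real.sqrt (2 / (1 + amplitude κ β ^ 2)) with hρ
  rw [← toL2_zero]
  congr 1
  have ea : ((1 : ℝ) ^ 2 + lam0 κ β) • helCos κ β
      + (2 * κ) • curlSymbol (waveVec τ ![0, 1]) (helSin κ β) + β • thirdProj (helCos κ β) = 0 := by
    rw [curlSymbol_apply, thirdProj_apply, waveVec_zero_cons, helCos, helSin, ← hρ]
    ext j
    fin_cases j <;> simp
    linear_combination -ρ * h2
  have eb : ((1 : ℝ) ^ 2 + lam0 κ β) • helSin κ β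
      - (2 * κ) • curlSymbol (waveVec τ ![0, 1]) (helCos κ β) + β • thirdProj (helSin κ β) = 0 := by
    rw [curlSymbol_apply, thirdProj_apply, waveVec_zero_cons, helCos, helSin, ← hρ]
    ext j
    fin_cases j <;> simp
    linear_combination ρ * h1
  rw [ea, eb]
  ext1 x
  simp [mode]

/-- Coercivity of the symbol on the orthogonal complement of the critical modes. -/
theorem Admissible.exists_le_symbolForm {κ β : ℝ} {τ : ℂ} [Fact (0 < τ.im)]
    (h : Admissible κ β τ) : ∃ c, 0 < c ∧ ∀ w : L2 τ, inner ℝ (fld (phi1 κ β τ)) w = 0 →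
      inner ℝ (fld (phi2 κ β τ)) w = 0 → ∀ n, c * (‖cosCoeff τ n w‖ ^ 2 + ‖sinCoeff τ n w‖ ^ 2)
        ≤ symbolForm κ β (lam0 κ β) (waveVec τ n) (cosCoeff τ n w) (sinCoeff τ n w) := by
  obtain ⟨c, hc, hgap⟩ := h.exists_gap
  have hL := one_add_lam0_pos β h.kappa_pos
  refine ⟨min c (1 + lam0 κ β), lt_min hc hL, fun w h1 h2 n => ?_⟩
  have h1' : inner ℝ (helCos κ β) (cosCoeff τ ![0, 1] w)
      + inner ℝ (helSin κ β) (sinCoeff τ ![0, 1] w) = 0 := by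
    rw [← inner_toL2_mode]; exact h1
  have h2' : inner ℝ (helSin κ β) (cosCoeff τ ![0, 1] w)
      + inner ℝ (-helCos κ β) (sinCoeff τ ![0, 1] w) = 0 := by
    rw [← inner_toL2_mode]; exact h2
  set A := amplitude κ β with hA
  have hρ : 0 < Real.sqrt (2 / (1 + A ^ 2)) := Real.sqrt_pos.2 (by positivity)
  simp only [helCos, helSin, inner_neg_left, real_inner_smul_left,
    EuclideanSpace.inner_single_left, ← hA] at h1' h2'
  simp only [map_one, one_mul] at h1' h2'
  -- Orthogonality to $\varphi_1$ and $\varphi_2$ amounts to two scalar relations between the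
  -- coefficients at $v=e_2$.
  have k1 : cosCoeff τ ![0, 1] w 2 = -(A * sinCoeff τ ![0, 1] w 0) := by
    refine mul_left_cancel₀ hρ.ne' ?_
    linear_combination h1'
  have k2 : sinCoeff τ ![0, 1] w 2 = A * cosCoeff τ ![0, 1] w 0 := by
    refine mul_left_cancel₀ hρ.ne' ?_
    linear_combination -h2'
  have e1 := amplitude_mul β h.kappa_pos
  have e2 := two_mul_amplitude β h.kappa_pos
  rw [← hA] at e1 e2
  -- Under those relations the curl coupling becomes $4\kappa A(a_0^2+b_0^2)\ge0$, so the form is at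
  -- least $1+\lambda_0$ times the squared norm. The sign $\sigma=\pm1$ treats $e_2$ and $-e_2$
  -- together, as both occur in the Fourier sum.
  have crit : ∀ (v : Plane) (σ : ℝ) (a b : Spin), v 0 = 0 → v 1 = σ → σ ^ 2 = 1 →
      a 2 = -(A * (σ * b 0)) → σ * b 2 = A * a 0 →
      (1 + lam0 κ β) * (‖a‖ ^ 2 + ‖b‖ ^ 2) ≤ symbolForm κ β (lam0 κ β) v a b := by
    intro v σ a b hv0 hv1 hσ ha hb
    have hv : ‖v‖ ^ 2 = 1 := by
      simp [EuclideanSpace.norm_sq_eq, Fin.sum_univ_two, hv0, hv1, hσ]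
    have hb' : b 2 = A * (σ * a 0) := by linear_combination σ * hb - b 2 * hσ
    have ea : ‖a‖ ^ 2 = a 0 ^ 2 + a 1 ^ 2 + a 2 ^ 2 := by
      simp [EuclideanSpace.norm_sq_eq, Fin.sum_univ_three]
    have eb : ‖b‖ ^ 2 = b 0 ^ 2 + b 1 ^ 2 + b 2 ^ 2 := by
      simp [EuclideanSpace.norm_sq_eq, Fin.sum_univ_three]
    rw [symbolForm, hv, hv0, hv1, ea, eb, ha, hb']
    have key : (1 + lam0 κ β) * (a 0 ^ 2 + a 1 ^ 2 + (-(A * (σ * b 0))) ^ 2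
          + (b 0 ^ 2 + b 1 ^ 2 + (A * (σ * a 0)) ^ 2))
        + β * ((-(A * (σ * b 0))) ^ 2 + (A * (σ * a 0)) ^ 2)
        + 4 * κ * (A * (σ * a 0) * (σ * a 0 - 0 * a 1) + -(A * (σ * b 0)) * (0 * b 1 - σ * b 0))
        = (1 + lam0 κ β) * (a 0 ^ 2 + a 1 ^ 2 + (-(A * (σ * b 0))) ^ 2
          + (b 0 ^ 2 + b 1 ^ 2 + (A * (σ * a 0)) ^ 2))
          + (β * A ^ 2 + 4 * κ * A) * (a 0 ^ 2 + b 0 ^ 2) := by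
      linear_combination (β * A ^ 2 + 4 * κ * A) * (a 0 ^ 2 + b 0 ^ 2) * hσ
    rw [key]
    have hpos : 0 ≤ β * A ^ 2 + 4 * κ * A := by
      have := h.beta_nonneg
      have : 0 ≤ κ * A := by linarith
      nlinarith [mul_nonneg h.beta_nonneg (sq_nonneg A)]
    linarith [mul_nonneg hpos (by positivity : 0 ≤ a 0 ^ 2 + b 0 ^ 2)]
  by_cases hn : ‖waveVec τ n‖ = 1
  · refine (mul_le_mul_of_nonneg_right (min_le_right _ _) (by positivity)).trans ?_
    rcases eq_of_norm_waveVec_eq_one h.nonEquilateral hn with rfl | rfl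
    · exact crit _ 1 _ _ (by simp [waveVec]) (by simp [waveVec]) (by norm_num)
        (by rw [k1, one_mul]) (by rw [k2, one_mul])
    · have hph : ∀ x, phase τ ![0, -1] x = -phase τ ![0, 1] x := fun x => by simp [phase_apply]
      have ec : cosCoeff τ ![0, -1] w = cosCoeff τ ![0, 1] w := by
        simp only [cosCoeff_apply, hph, Real.cos_neg]
      have es : sinCoeff τ ![0, -1] w = -sinCoeff τ ![0, 1] w := by
        simp only [sinCoeff_apply, hph, Real.sin_neg, neg_smul, integral_neg]
      exact crit _ (-1) _ _ (by simp [waveVec]) (by simp [waveVec]) (by norm_num)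
        (by rw [ec, es, k1]; simp) (by rw [ec, es]; simp [k2])
  · exact (mul_le_mul_of_nonneg_right ((min_le_left _ _).trans (hgap n hn))
      (by positivity)).trans (le_symbolForm h.beta_nonneg _ _ _)

/-- Coercivity of the linear part on the orthogonal complement of the critical modes. -/
theorem Admissible.exists_coercive {κ β : ℝ} {τ : ℂ} [Fact (0 < τ.im)] (h : Admissible κ β τ) :
    ∃ c, 0 < c ∧ ∀ w : H2 τ, inner ℝ (fld (phi1 κ β τ)) (fld w) = 0 →
      inner ℝ (fld (phi2 κ β τ)) (fld w) = 0 →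
      c * ‖fld w‖ ^ 2 ≤ inner ℝ (linPart κ β (lam0 κ β) τ w) (fld w) := by
  obtain ⟨c, hc, hle⟩ := h.exists_le_symbolForm
  refine ⟨c, hc, fun w h1 h2 => ?_⟩
  have hP := (hasSum_inner τ (fld w) (fld w)).mul_left c
  simp only [real_inner_self_eq_norm_sq] at hP
  exact hasSum_le (hle (fld w) h1 h2) hP (hasSum_symbolForm κ β (lam0 κ β) w)

/-! ### Inner products of the critical modes -/

/-- A shift by $\pi/2$ in $x_2$ exchanges the two integrals, and they add up to $1$. -/
lemma integral_cos_sq (τ : ℂ) [Fact (0 < τ.im)] :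
    ∫ x : Plane, Real.cos (x 1) ^ 2 ∂(cellMeasure τ) = 1 / 2
      ∧ ∫ x : Plane, Real.sin (x 1) ^ 2 ∂(cellMeasure τ) = 1 / 2 := by
  have hp : IsPeriodic τ fun x : Plane => Real.cos (x 1) ^ 2 := fun u hu x => by
    have := isPeriodic_cos τ ![0, 1] u hu x
    simp only [phase_zero_one] at this
    simp only [this]
  have h1 := integral_comp_add hp ((Real.pi / 2) • (EuclideanSpace.single 1 1 : Plane))
  have h2 : ∀ x : Plane, Real.cos ((x + (Real.pi / 2) • (EuclideanSpace.single 1 1 : Plane)) 1) ^ 2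
      = Real.sin (x 1) ^ 2 := fun x => by
    simp [Real.cos_add_pi_div_two]
  simp_rw [h2] at h1
  have h3 : ∫ x : Plane, (Real.cos (x 1) ^ 2 + Real.sin (x 1) ^ 2) ∂(cellMeasure τ) = 1 := by
    simp
  rw [integral_add (integrable_of_continuous τ (by fun_prop))
    (integrable_of_continuous τ (by fun_prop)), h1] at h3
  constructor <;> linarith

lemma integral_sin_mul_cos (τ : ℂ) [Fact (0 < τ.im)] :
    ∫ x : Plane, Real.sin (x 1) * Real.cos (x 1) ∂(cellMeasure τ) = 0 := by
  have hp : IsPeriodic τ fun x : Plane => Real.sin (x 1) * Real.cos (x 1) := fun u hu x => by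
    have h1 := isPeriodic_cos τ ![0, 1] u hu x
    have h2 := isPeriodic_sin τ ![0, 1] u hu x
    simp only [phase_zero_one] at h1 h2
    simp only [h1, h2]
  have h1 := integral_comp_neg hp
  have h2 : ∀ x : Plane, Real.sin ((-x) 1) * Real.cos ((-x) 1)
      = -(Real.sin (x 1) * Real.cos (x 1)) := fun x => by simp
  simp_rw [h2] at h1
  rw [integral_neg] at h1
  linarith

lemma inner_toL2_mode_mode (τ : ℂ) [Fact (0 < τ.im)] (a b a' b' : Spin) :
    inner ℝ (toL2 τ (mode τ ![0, 1] a b)) (toL2 τ (mode τ ![0, 1] a' b'))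
      = (inner ℝ a a' + inner ℝ b b') / 2 := by
  rw [inner_eq_integral (coeFn_toL2 τ (continuous_mode _ _ _ _))
    (coeFn_toL2 τ (continuous_mode _ _ _ _))]
  have e : ∀ x, inner ℝ (mode τ ![0, 1] a b x) (mode τ ![0, 1] a' b' x)
      = inner ℝ a a' * Real.cos (x 1) ^ 2 + inner ℝ b b' * Real.sin (x 1) ^ 2
        + (inner ℝ a b' + inner ℝ b a') * (Real.sin (x 1) * Real.cos (x 1)) := fun x => by
    simp only [mode, phase_zero_one, inner_add_left, inner_add_right, real_inner_smul_left,
      real_inner_smul_right]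
    ring
  simp_rw [e]
  rw [integral_add (integrable_of_continuous τ (by fun_prop))
    (integrable_of_continuous τ (by fun_prop)), integral_add
    (integrable_of_continuous τ (by fun_prop)) (integrable_of_continuous τ (by fun_prop)),
    integral_const_mul, integral_const_mul, integral_const_mul, integral_sin_mul_cos,
    (integral_cos_sq τ).1, (integral_cos_sq τ).2]
  ring

lemma inner_helCos_helSin (κ β : ℝ) : inner ℝ (helCos κ β) (helSin κ β) = 0
    ∧ inner ℝ (helCos κ β) (helCos κ β) + inner ℝ (helSin κ β) (helSin κ β) = 2 := by
  have h : Real.sqrt (2 / (1 + amplitude κ β ^ 2)) ^ 2 = 2 / (1 + amplitude κ β ^ 2) :=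
    Real.sq_sqrt (by positivity)
  have h' : 1 + amplitude κ β ^ 2 ≠ 0 := by positivity
  unfold helCos helSin
  generalize Real.sqrt (2 / (1 + amplitude κ β ^ 2)) = ρ at h ⊢
  constructor
  · simp [real_inner_smul_left, real_inner_smul_right, EuclideanSpace.inner_single_left]
  · simp only [real_inner_smul_left, real_inner_smul_right, EuclideanSpace.inner_single_left]
    simp
    have : ρ ^ 2 * (1 + amplitude κ β ^ 2) = 2 := by rw [h]; field_simp
    linear_combination this

lemma inner_phi1_phi1 (κ β : ℝ) (τ : ℂ) [Fact (0 < τ.im)] :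
    inner ℝ (fld (phi1 κ β τ)) (fld (phi1 κ β τ)) = 1 := by
  refine (inner_toL2_mode_mode τ _ _ _ _).trans ?_
  rw [(inner_helCos_helSin κ β).2]; norm_num

lemma inner_phi2_phi2 (κ β : ℝ) (τ : ℂ) [Fact (0 < τ.im)] :
    inner ℝ (fld (phi2 κ β τ)) (fld (phi2 κ β τ)) = 1 := by
  refine (inner_toL2_mode_mode τ _ _ _ _).trans ?_
  rw [inner_neg_neg, add_comm, (inner_helCos_helSin κ β).2]; norm_num

lemma inner_phi1_phi2 (κ β : ℝ) (τ : ℂ) [Fact (0 < τ.im)] :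
    inner ℝ (fld (phi1 κ β τ)) (fld (phi2 κ β τ)) = 0 := by
  refine (inner_toL2_mode_mode τ _ _ _ _).trans ?_
  rw [inner_neg_right, real_inner_comm (helCos κ β) (helSin κ β), (inner_helCos_helSin κ β).1]
  norm_num

lemma norm_phi1 (κ β : ℝ) (τ : ℂ) [Fact (0 < τ.im)] : ‖fld (phi1 κ β τ)‖ = 1 := by
  have := inner_phi1_phi1 κ β τ
  rw [real_inner_self_eq_norm_sq] at this
  exact (pow_eq_one_iff_of_nonneg (norm_nonneg _) two_ne_zero).1 this

/-- $\int(|\varphi_1|^2-1)^2\ge0$ together with $\int|\varphi_1|^2=1$ gives $\int|\varphi_1|^4\ge1$;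
only positivity matters later. -/
lemma one_le_inner_cub_phi1 (κ β : ℝ) (τ : ℂ) [Fact (0 < τ.im)] :
    1 ≤ inner ℝ (cub (phi1 κ β τ)) (fld (phi1 κ β τ)) := by
  have hc : Continuous (helicalMode κ β) := by
    rw [helicalMode_eq κ β τ]; exact continuous_mode _ _ _ _
  have h1 := inner_phi1_phi1 κ β τ
  rw [inner_eq_integral (fld_phi1 κ β τ) (fld_phi1 κ β τ)] at h1
  rw [inner_eq_integral (cub_eq (pd_phi1_zero κ β τ) (fld_phi1 κ β τ)) (fld_phi1 κ β τ)]
  simp_rw [real_inner_smul_left, real_inner_self_eq_norm_sq] at h1 ⊢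
  have h2 : 0 ≤ ∫ x, (‖helicalMode κ β x‖ ^ 2 - 1) ^ 2 ∂(cellMeasure τ) :=
    integral_nonneg fun x => sq_nonneg _
  have e : ∀ x, (‖helicalMode κ β x‖ ^ 2 - 1) ^ 2
      = ‖helicalMode κ β x‖ ^ 2 * ‖helicalMode κ β x‖ ^ 2 - 2 * ‖helicalMode κ β x‖ ^ 2 + 1 :=
    fun x => by ring
  simp_rw [e] at h2
  rw [integral_add (integrable_of_continuous τ (by fun_prop)) (integrable_const _),
    integral_sub (integrable_of_continuous τ (by fun_prop))
      (integrable_of_continuous τ (by fun_prop)), integral_const_mul, h1] at h2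
  simp at h2
  linarith

/-! ### Homogeneity and identification with the operators of the statement -/

lemma rep_smul {τ : ℂ} (s : ℝ) (m : H2 τ) (x : Plane) : rep (s • m) x = s • rep m x := by
  ext j; simp [rep]

lemma cub_smul {τ : ℂ} (s : ℝ) (m : H2 τ) : cub (s • m) = s ^ 3 • cub m := by
  refine Lp.ext ?_
  filter_upwards [coeFn_cub (s • m), coeFn_cub m, Lp.coeFn_smul (s ^ 3) (cub m)] with x h1 h2 h3
  rw [h1, h3, Pi.smul_apply, h2, rep_smul, norm_smul, mul_pow, Real.norm_eq_abs, sq_abs]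
  module

lemma dcub_smul {τ : ℂ} (s : ℝ) (m : H2 τ) (u : L2 τ) :
    dcub (s • m) u = s ^ 2 • dcub m u := by
  refine Lp.ext ?_
  filter_upwards [coeFn_dcub (s • m) u, coeFn_dcub m u, Lp.coeFn_smul (s ^ 2) (dcub m u)]
    with x h1 h2 h3
  rw [h1, h3, Pi.smul_apply, h2, rep_smul, norm_smul, mul_pow, Real.norm_eq_abs, sq_abs,
    real_inner_smul_left]
  module

lemma dcub_self {τ : ℂ} [Fact (0 < τ.im)] {m : H2 τ} (hm : pd m 0 = 0) :
    dcub m (fld m) = (3 : ℝ) • cub m := by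
  refine Lp.ext ?_
  filter_upwards [dcub_eq hm (fld_eq_rep hm) (fld_eq_rep hm), coeFn_cub m,
    Lp.coeFn_smul (3 : ℝ) (cub m)] with x h1 h2 h3
  rw [h1, h3, Pi.smul_apply, h2, real_inner_self_eq_norm_sq]
  module

lemma eulerLagrange_eq (κ α β lam : ℝ) {τ : ℂ} [Fact (0 < τ.im)] {m : H2 τ} (hm : pd m 0 = 0) :
    eulerLagrange κ α β lam m =ᵐ[cellMeasure τ] (linPart κ β lam τ m + α • cub m : L2 τ) := by
  filter_upwards [Lp.coeFn_add (linPart κ β lam τ m) (α • cub m), coeFn_linPart κ β lam m,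
    Lp.coeFn_smul α (cub m), cub_eq hm (Filter.EventuallyEq.refl _ (fld m))] with x h1 h2 h3 h4
  rw [h1, Pi.add_apply, h2, h3, Pi.smul_apply, h4, eulerLagrange]
  module

lemma linearization_eq (κ α β lam : ℝ) {τ : ℂ} [Fact (0 < τ.im)] {m : H2 τ} (hm : pd m 0 = 0)
    (φ : H2 τ) : linearization κ α β lam m φ
      =ᵐ[cellMeasure τ] (linPart κ β lam τ φ + α • dcub m (fld φ) : L2 τ) := by
  filter_upwards [Lp.coeFn_add (linPart κ β lam τ φ) (α • dcub m (fld φ)),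
    coeFn_linPart κ β lam φ, Lp.coeFn_smul α (dcub m (fld φ)),
    dcub_eq hm (Filter.EventuallyEq.refl _ (fld m)) (Filter.EventuallyEq.refl _ (fld φ))]
    with x h1 h2 h3 h4
  rw [h1, Pi.add_apply, h2, h3, Pi.smul_apply, h4, linearization]
  module

lemma linPart_eq_add (κ β lam lam' : ℝ) {τ : ℂ} (m : H2 τ) :
    linPart κ β lam τ m = linPart κ β lam' τ m + (lam - lam') • fld m := by
  rw [linPart_apply, linPart_apply]
  module

/-! ### Helically symmetric fields -/

/-- Translation in $x_1$ by half a wavelength, $\pi/v_0$, fixes the field and reverses the sign of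
the mode, so the coefficient equals its own negative. -/
lemma IsHelicallySymmetric.coeff_eq_zero {τ : ℂ} [Fact (0 < τ.im)] {u : L2 τ}
    (h : IsHelicallySymmetric u) {n : Fin 2 → ℤ} (hn : waveVec τ n 0 ≠ 0) :
    cosCoeff τ n u = 0 ∧ sinCoeff τ n u = 0 := by
  obtain ⟨f, hf, hfu, hx, -⟩ := h
  set t := Real.pi / waveVec τ n 0 with ht
  have htv : phase τ n (-(t • EuclideanSpace.single 0 1)) = -Real.pi := by
    rw [map_neg, map_smul, phase_single, smul_eq_mul, ht, div_mul_cancel₀ _ hn]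
  have hx' := (cellMeasure_absolutelyContinuous τ).ae_le (hx t)
  have key : ∀ g : Plane → ℝ, IsPeriodic τ g →
      (∀ x, g (x + -(t • EuclideanSpace.single 0 1)) = -g x) →
      ∫ x, g x • u x ∂(cellMeasure τ) = 0 := fun g hg hgt => by
    have e1 : ∫ x, g x • u x ∂(cellMeasure τ) = ∫ x, g x • f x ∂(cellMeasure τ) :=
      integral_congr_ae (by filter_upwards [hfu] with x h using by rw [h])
    have e2 := integral_comp_add (τ := τ) (f := fun x => g x • f x)
      (fun u hu x => by simp only [hg u hu, hf u hu]) (-(t • EuclideanSpace.single 0 1))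
    have e3 : ∫ x, g (x + -(t • EuclideanSpace.single 0 1)) •
        f (x + -(t • EuclideanSpace.single 0 1)) ∂(cellMeasure τ)
        = -∫ x, g x • f x ∂(cellMeasure τ) := by
      rw [← integral_neg]
      refine integral_congr_ae ?_
      filter_upwards [hx'] with x h
      rw [sub_eq_add_neg] at h
      rw [hgt, h, neg_smul]
    rw [e1]
    rw [e3] at e2
    have e4 : (2 : ℝ) • ∫ x, g x • f x ∂(cellMeasure τ) = 0 := by
      rw [two_smul]
      nth_rewrite 1 [← e2]
      exact neg_add_cancel _
    exact (smul_eq_zero.1 e4).resolve_left two_ne_zero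
  rw [cosCoeff_apply, sinCoeff_apply]
  refine ⟨key _ (isPeriodic_cos τ n) fun x => ?_, key _ (isPeriodic_sin τ n) fun x => ?_⟩
  · rw [map_add, htv, ← sub_eq_add_neg, Real.cos_sub_pi]
  · rw [map_add, htv, ← sub_eq_add_neg, Real.sin_sub_pi]

/-- The reflection `diag(-1, -1, 1)`. -/
def spinFlip : Spin →L[ℝ] Spin := LinearMap.toContinuousLinearMap
  { toFun := fun w => !₂[-(w 0), -(w 1), w 2]
    map_add' := fun v w => by ext j; fin_cases j <;> simp <;> ring
    map_smul' := fun c w => by ext j; fin_cases j <;> simp }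

lemma spinFlip_apply (w : Spin) : spinFlip w = !₂[-(w 0), -(w 1), w 2] := rfl

/-- Under $x\mapsto-x$ the cosine is even and the sine odd, so the rotation by $\pi$ acts on the two
coefficients with opposite signs. -/
lemma IsHelicallySymmetric.coeff_flip {τ : ℂ} [Fact (0 < τ.im)] {u : L2 τ}
    (h : IsHelicallySymmetric u) (n : Fin 2 → ℤ) :
    spinFlip (cosCoeff τ n u) = cosCoeff τ n u ∧ spinFlip (sinCoeff τ n u) = -sinCoeff τ n u := by
  obtain ⟨f, hf, hfu, -, hr⟩ := h
  have hr' := (cellMeasure_absolutelyContinuous τ).ae_le hr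
  have key : ∀ (g : Plane → ℝ) (σ : ℝ), IsPeriodic τ g → Continuous g → (∀ x, g (-x) = σ * g x) →
      spinFlip (∫ x, g x • u x ∂(cellMeasure τ)) = σ • ∫ x, g x • u x ∂(cellMeasure τ) :=
    fun g σ hg hgc hgσ => by
    have hi := integrable_smul_cell τ hgc u
    have hfi : (fun x => g x • u x) =ᵐ[cellMeasure τ] fun x => g x • f x := by
      filter_upwards [hfu] with x h using by rw [h]
    have hi' : Integrable (fun x => g x • f x) (cellMeasure τ) := hi.congr hfi
    rw [integral_congr_ae hfi, ← spinFlip.integral_comp_comm hi', ← integral_smul,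
      ← integral_comp_neg (f := fun x => spinFlip (g x • f x))
        (fun u hu x => by simp only [hg u hu, hf u hu])]
    refine integral_congr_ae ?_
    filter_upwards [hr'] with x h
    rw [map_smul, spinFlip_apply, h, hgσ, mul_smul]
  rw [cosCoeff_apply, sinCoeff_apply]
  constructor
  · simpa using key _ 1 (isPeriodic_cos τ n) (by fun_prop) (fun x => by simp)
  · simpa using key _ (-1) (isPeriodic_sin τ n) (by fun_prop) (fun x => by simp)

/-- The subspace of the helically symmetric fields of `L²_Λ`, in terms of Fourier coefficients. -/
def helical (τ : ℂ) : Submodule ℝ (L2 τ) :=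
  ⨅ n, ((waveVec τ n 0 • cosCoeff τ n : L2 τ →L[ℝ] Spin).ker
    ⊓ (waveVec τ n 0 • sinCoeff τ n : L2 τ →L[ℝ] Spin).ker)
    ⊓ ((spinFlip.comp (cosCoeff τ n) - cosCoeff τ n : L2 τ →L[ℝ] Spin).ker
    ⊓ (spinFlip.comp (sinCoeff τ n) + sinCoeff τ n : L2 τ →L[ℝ] Spin).ker)

lemma mem_helical {τ : ℂ} {u : L2 τ} : u ∈ helical τ ↔ ∀ n,
    (waveVec τ n 0 • cosCoeff τ n u = 0 ∧ waveVec τ n 0 • sinCoeff τ n u = 0) ∧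
    spinFlip (cosCoeff τ n u) = cosCoeff τ n u ∧ spinFlip (sinCoeff τ n u) = -sinCoeff τ n u := by
  simp [helical, Submodule.mem_iInf, sub_eq_zero, eq_neg_iff_add_eq_zero]

lemma isClosed_helical (τ : ℂ) : IsClosed (helical τ : Set (L2 τ)) := by
  simp only [helical, Submodule.coe_iInf, Submodule.coe_inf]
  refine isClosed_iInter fun n => ?_
  exact ((ContinuousLinearMap.isClosed_ker _).inter (ContinuousLinearMap.isClosed_ker _)).inter
    ((ContinuousLinearMap.isClosed_ker _).inter (ContinuousLinearMap.isClosed_ker _))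

lemma IsHelicallySymmetric.mem_helical {τ : ℂ} [Fact (0 < τ.im)] {u : L2 τ}
    (h : IsHelicallySymmetric u) : u ∈ helical τ := by
  refine ChiralMagnet.mem_helical.2 fun n => ⟨?_, h.coeff_flip n⟩
  by_cases hn : waveVec τ n 0 = 0
  · simp [hn]
  · simp [h.coeff_eq_zero hn]

lemma pd_zero_of_mem_helical {τ : ℂ} [Fact (0 < τ.im)] {m : H2 τ} (h : fld m ∈ helical τ) :
    pd m 0 = 0 := by
  have key := fun n => (mem_helical.1 h n).1
  refine eq_of_coeff_eq (fun n => ?_) (fun n => ?_)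
  · rw [(isWeakDeriv_pd m 0).cosCoeff_eq, (key n).2, map_zero]
  · rw [(isWeakDeriv_pd m 0).sinCoeff_eq, (key n).1, map_zero, neg_zero]

/-- $\varphi_2$ is odd under the rotation by $\pi$ while helical fields are even. This removes the
second critical direction from the bifurcation problem. -/
lemma inner_phi2_of_mem_helical (κ β : ℝ) {τ : ℂ} [Fact (0 < τ.im)] {u : L2 τ}
    (h : u ∈ helical τ) :
    inner ℝ (fld (phi2 κ β τ)) u = 0 := by
  refine (inner_toL2_mode ![0, 1] (helSin κ β) (-helCos κ β) u).trans ?_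
  have hc := congrArg (fun w : Spin => w 0) (mem_helical.1 h ![0, 1]).2.1
  have hs := congrArg (fun w : Spin => w 2) (mem_helical.1 h ![0, 1]).2.2
  simp only [spinFlip_apply, PiLp.neg_apply, Matrix.cons_val_zero, Matrix.cons_val] at hc hs
  have hc' : cosCoeff τ ![0, 1] u 0 = 0 := by linarith
  have hs' : sinCoeff τ ![0, 1] u 2 = 0 := by linarith
  simp only [helCos, helSin, inner_neg_left, real_inner_smul_left,
    EuclideanSpace.inner_single_left, hc', hs']
  simp

lemma fld_add {τ : ℂ} (m w : H2 τ) : fld (m + w) = fld m + fld w := rfl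

lemma fld_sub {τ : ℂ} (m w : H2 τ) : fld (m - w) = fld m - fld w := rfl

lemma fld_smul {τ : ℂ} (c : ℝ) (m : H2 τ) : fld (c • m) = c • fld m := rfl

lemma pd_smul {τ : ℂ} (c : ℝ) (m : H2 τ) (i : Fin 2) : pd (c • m) i = c • pd m i := rfl

/-! ### A criterion for linear stability -/

/-- The linearization as a bounded operator from `H²_Λ` to `L²_Λ`. -/
def linOp (κ α β lam : ℝ) {τ : ℂ} (m : H2 τ) : H2 τ →L[ℝ] L2 τ :=
  linPart κ β lam τ + α • (dcub m).comp (fldL τ)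

lemma linOp_apply (κ α β lam : ℝ) {τ : ℂ} (m φ : H2 τ) :
    linOp κ α β lam m φ = linPart κ β lam τ φ + α • dcub m (fld φ) := rfl

lemma inner_linOp_comm (κ α β lam : ℝ) {τ : ℂ} [Fact (0 < τ.im)] (m φ ψ : H2 τ) :
    inner ℝ (linOp κ α β lam m φ) (fld ψ) = inner ℝ (fld φ) (linOp κ α β lam m ψ) := by
  rw [linOp_apply, linOp_apply, inner_add_left, inner_add_right, inner_linPart_comm,
    real_inner_smul_left, real_inner_smul_right, inner_dcub_comm]

lemma inner_linOp_add_of_eq_zero {κ α β lam : ℝ} {τ : ℂ} [Fact (0 < τ.im)] {m η : H2 τ}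
    (hη : linOp κ α β lam m η = 0) (b : ℝ) (φ : H2 τ) :
    inner ℝ (linOp κ α β lam m (b • η + φ)) (fld (b • η + φ))
      = inner ℝ (linOp κ α β lam m φ) (fld φ) := by
  have e : linOp κ α β lam m (b • η + φ) = linOp κ α β lam m φ := by
    refine ((linOp κ α β lam m).map_add (b • η) φ).trans ?_
    refine (congrArg (· + _) (((linOp κ α β lam m).map_smul b η).trans ?_)).trans (zero_add _)
    rw [hη, smul_zero]
  rw [e, fld_add, fld_smul, inner_add_right, real_inner_smul_right, inner_linOp_comm _ _ _ _ _ _ η,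
    hη, inner_zero_right, mul_zero, zero_add]

/-- The linearization is symmetric and annihilates $\eta=\partial_2m$, so adding multiples of $\eta$
does not change its form. As $\langle\varphi_2,\eta\rangle\ne0$, every $\phi$ is a multiple of
$\eta$ plus a multiple of $\varphi_1$ plus a field orthogonal to both critical modes, and strict
positivity is needed only on the last two parts. -/
theorem stable_of_positive {κ α β lam ε : ℝ} {τ : ℂ} [Fact (0 < τ.im)] {m : H2 τ}
    (hm : pd m 0 = 0) (hη : inner ℝ (fld (phi2 κ β τ)) (pd m 1) ≠ 0)
    (heq : linPart κ β lam τ m + α • cub m = 0) (hε : 0 < ε)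
    (hpos : ∀ (a : ℝ) (w : H2 τ), inner ℝ (fld (phi1 κ β τ)) (fld w) = 0 →
      inner ℝ (fld (phi2 κ β τ)) (fld w) = 0 →
      ε * (a ^ 2 + ‖fld w‖ ^ 2) ≤ inner ℝ (linOp κ α β lam m (a • phi1 κ β τ + w))
        (fld (a • phi1 κ β τ + w))) :
    LinearizationNonneg κ α β lam m ∧
      linearizationKer κ α β lam m = (Submodule.span ℝ {pd m 1} : Set (L2 τ)) := by
  obtain ⟨η, hη1, -, hη2⟩ := exists_deriv_mem_kernel hm heq
  rw [← linOp_apply] at hη2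
  rw [← hη1] at hη ⊢
  have key : ∀ φ : H2 τ, ∃ (b a : ℝ) (w : H2 τ), fld φ = b • fld η + a • fld (phi1 κ β τ) + fld w
      ∧ ε * (a ^ 2 + ‖fld w‖ ^ 2)
        ≤ inner ℝ (linOp κ α β lam m φ) (fld φ) := fun φ => by
    -- First $b$ removes the $\varphi_2$-component by means of $\eta$; then $a$ removes the
    -- remaining $\varphi_1$-component, which leaves the $\varphi_2$-component untouched.
    obtain ⟨b, hb⟩ : ∃ b : ℝ,
      b = inner ℝ (fld (phi2 κ β τ)) (fld φ) / inner ℝ (fld (phi2 κ β τ)) (fld η) := ⟨_, rfl⟩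
    obtain ⟨a, ha⟩ : ∃ a : ℝ,
      a = inner ℝ (fld (phi1 κ β τ)) (fld φ) - b * inner ℝ (fld (phi1 κ β τ)) (fld η) := ⟨_, rfl⟩
    obtain ⟨w, hw⟩ : ∃ w : H2 τ, w = φ - b • η - a • phi1 κ β τ := ⟨_, rfl⟩
    have hφ : φ = b • η + (a • phi1 κ β τ + w) := by rw [hw]; abel
    have hwf : fld w = fld φ - b • fld η - a • fld (phi1 κ β τ) := by
      rw [hw]; rfl
    have h12 : inner ℝ (fld (phi2 κ β τ)) (fld (phi1 κ β τ)) = 0 := by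
      rw [real_inner_comm]; exact inner_phi1_phi2 κ β τ
    refine ⟨b, a, w, by rw [hwf]; abel, (hpos a w ?_ ?_).trans (le_of_eq ?_)⟩
    · rw [hwf, inner_sub_right, inner_sub_right, real_inner_smul_right, real_inner_smul_right,
        inner_phi1_phi1, ha]
      ring
    · rw [hwf, inner_sub_right, inner_sub_right, real_inner_smul_right, real_inner_smul_right,
        h12, hb, div_mul_cancel₀ _ hη]
      ring
    · conv_rhs => rw [hφ, inner_linOp_add_of_eq_zero hη2]
  refine ⟨fun φ => ?_, ?_⟩
  · have hL := linearization_eq κ α β lam hm φ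
    refine ⟨(memLp_congr_ae hL).2 (Lp.memLp _), ?_⟩
    rw [← inner_eq_integral hL.symm (Filter.EventuallyEq.refl _ (fld φ))]
    obtain ⟨b, a, w, -, h⟩ := key φ
    exact le_trans (by positivity) h
  · ext u
    rw [SetLike.mem_coe, Submodule.mem_span_singleton]
    constructor
    · rintro ⟨φ, rfl, hφ⟩
      obtain ⟨b, a, w, h1, h2⟩ := key φ
      have h3 : linOp κ α β lam m φ = 0 :=
        Lp.ext (((linearization_eq κ α β lam hm φ).symm.trans hφ).trans (Lp.coeFn_zero _ _ _).symm)
      rw [h3, inner_zero_left] at h2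
      have h4 : a ^ 2 + ‖fld w‖ ^ 2 ≤ 0 := nonpos_of_mul_nonpos_right h2 hε
      have ha : a = 0 := by
        have : a ^ 2 = 0 := le_antisymm (by linarith [sq_nonneg ‖fld w‖]) (sq_nonneg a)
        exact pow_eq_zero_iff two_ne_zero |>.1 this
      have hw : fld w = 0 := by
        have : ‖fld w‖ ^ 2 = 0 := le_antisymm (by linarith [sq_nonneg a]) (sq_nonneg _)
        exact norm_eq_zero.1 (pow_eq_zero_iff two_ne_zero |>.1 this)
      exact ⟨b, by rw [h1, ha, hw, zero_smul, add_zero, add_zero]⟩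
    · rintro ⟨b, rfl⟩
      refine ⟨b • η, rfl, (linearization_eq κ α β lam hm (b • η)).trans ?_⟩
      rw [← linOp_apply, map_smul, hη2, smul_zero]
      exact Lp.coeFn_zero _ _ _

/-! ### The blow-up of a branch at the bifurcation point -/

/-- The second order part of the linearization along a branch. -/
def secondVar (κ α β : ℝ) {τ : ℂ} [Fact (0 < τ.im)] (z : H2 τ) : L2 τ →L[ℝ] L2 τ :=
  α • dcub z - (α * inner ℝ (cub z) (fld (phi1 κ β τ))) • ContinuousLinearMap.id ℝ (L2 τ)

lemma continuous_secondVar (κ α β : ℝ) (τ : ℂ) [Fact (0 < τ.im)] :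
    Continuous (secondVar κ α β : H2 τ → L2 τ →L[ℝ] L2 τ) := by
  have h1 := continuous_dcub τ
  have h2 := (contDiff_cub τ).continuous
  unfold secondVar
  fun_prop

/-- The cubic term contributes $3$ by homogeneity and the shift of $\lambda$ takes away $1$. The
positive remainder is the stability of the supercritical branch in its own direction. -/
lemma inner_secondVar_phi1 (κ α β : ℝ) (τ : ℂ) [Fact (0 < τ.im)] :
    inner ℝ (secondVar κ α β (phi1 κ β τ) (fld (phi1 κ β τ))) (fld (phi1 κ β τ))
      = 2 * (α * inner ℝ (cub (phi1 κ β τ)) (fld (phi1 κ β τ))) := by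
  simp only [secondVar, sub_apply, smul_apply,
    ContinuousLinearMap.id_apply, dcub_self (pd_phi1_zero κ β τ), inner_sub_left,
    real_inner_smul_left, inner_phi1_phi1]
  ring

/-- The difference $w-\varphi_1$ is annihilated by the linear part and orthogonal to both critical
modes, so coercivity forces it to vanish. -/
lemma Admissible.eq_phi1 {κ β : ℝ} {τ : ℂ} [Fact (0 < τ.im)] (adm : Admissible κ β τ) {w : H2 τ}
    (hlin : linPart κ β (lam0 κ β) τ w = 0) (h1 : inner ℝ (fld (phi1 κ β τ)) (fld w) = 1)
    (h2 : inner ℝ (fld (phi2 κ β τ)) (fld w) = 0) : w = phi1 κ β τ := by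
  obtain ⟨c, hc, hco⟩ := adm.exists_coercive
  have h3 := hco (w - phi1 κ β τ)
    (by rw [fld_sub, inner_sub_right, h1, inner_phi1_phi1, sub_self])
    (by rw [fld_sub, inner_sub_right, h2, real_inner_comm, inner_phi1_phi2, sub_self])
  rw [ContinuousLinearMap.map_sub, hlin, linPart_phi1 β adm.kappa_pos, sub_zero,
    inner_zero_left] at h3
  have h4 : ‖fld (w - phi1 κ β τ)‖ ^ 2 = 0 :=
    le_antisymm (nonpos_of_mul_nonpos_right h3 hc) (sq_nonneg _)
  rw [pow_eq_zero_iff two_ne_zero, norm_eq_zero, fld_sub, sub_eq_zero] at h4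
  exact fld_injective τ h4

lemma Admissible.inner_linPart_add {κ β : ℝ} {τ : ℂ} [Fact (0 < τ.im)] (adm : Admissible κ β τ)
    (a : ℝ) (w : H2 τ) (v : L2 τ) :
    inner ℝ (linPart κ β (lam0 κ β) τ (a • phi1 κ β τ + w) + v) (fld (a • phi1 κ β τ + w))
      = inner ℝ (linPart κ β (lam0 κ β) τ w) (fld w)
        + inner ℝ v (a • fld (phi1 κ β τ) + fld w) := by
  have e : linPart κ β (lam0 κ β) τ (a • phi1 κ β τ + w) = linPart κ β (lam0 κ β) τ w := by
    refine ((linPart κ β (lam0 κ β) τ).map_add (a • phi1 κ β τ) w).trans ?_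
    refine (congrArg (· + _) (((linPart κ β (lam0 κ β) τ).map_smul a _).trans ?_)).trans
      (zero_add _)
    rw [linPart_phi1 β adm.kappa_pos, smul_zero]
  rw [e, inner_add_left, fld_add,
    fld_smul, inner_add_right, real_inner_smul_right, inner_linPart_comm,
    linPart_phi1 β adm.kappa_pos, inner_zero_right, mul_zero, zero_add]

section Branch

variable {κ α β δ : ℝ} {τ : ℂ} {m : ℝ → H2 τ} {lam : ℝ → ℝ}

lemma IsHelicalBranch.mem (h : IsHelicalBranch κ α β τ δ m lam) : (0 : ℝ) ∈ Ioo (-δ) δ :=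
  ⟨by linarith [h.pos], h.pos⟩

lemma IsHelicalBranch.eventually_mem (h : IsHelicalBranch κ α β τ δ m lam) :
    ∀ᶠ s in 𝓝[≠] (0 : ℝ), s ∈ Ioo (-δ) δ ∧ s ≠ 0 := by
  refine Filter.Eventually.and ?_ self_mem_nhdsWithin
  exact nhdsWithin_le_nhds (isOpen_Ioo.mem_nhds h.mem)

variable [Fact (0 < τ.im)]

lemma IsHelicalBranch.pd_zero (h : IsHelicalBranch κ α β τ δ m lam) {s : ℝ}
    (hs : s ∈ Ioo (-δ) δ) : pd (m s) 0 = 0 :=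
  pd_zero_of_mem_helical (h.symmetric s hs).mem_helical

lemma IsHelicalBranch.inner_phi1 (h : IsHelicalBranch κ α β τ δ m lam) {s : ℝ}
    (hs : s ∈ Ioo (-δ) δ) : inner ℝ (fld (phi1 κ β τ)) (fld (m s)) = s := by
  have e : (fld (m s) - s • fld (phi1 κ β τ) : L2 τ)
      =ᵐ[cellMeasure τ] fun x => fld (m s) x - s • helicalMode κ β x := by
    filter_upwards [Lp.coeFn_sub (fld (m s)) (s • fld (phi1 κ β τ)),
      Lp.coeFn_smul s (fld (phi1 κ β τ)), fld_phi1 κ β τ] with x h1 h2 h3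
    rw [h1, Pi.sub_apply, h2, Pi.smul_apply, h3]
  have := h.orthogonal s hs
  rw [← inner_eq_integral e (fld_phi1 κ β τ), inner_sub_left, real_inner_smul_left,
    inner_phi1_phi1] at this
  rw [real_inner_comm]
  linarith

lemma IsHelicalBranch.inner_phi2 (h : IsHelicalBranch κ α β τ δ m lam) {s : ℝ}
    (hs : s ∈ Ioo (-δ) δ) : inner ℝ (fld (phi2 κ β τ)) (fld (m s)) = 0 :=
  inner_phi2_of_mem_helical κ β (h.symmetric s hs).mem_helical

lemma IsHelicalBranch.equation (h : IsHelicalBranch κ α β τ δ m lam) {s : ℝ}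
    (hs : s ∈ Ioo (-δ) δ) : linPart κ β (lam s) τ (m s) + α • cub (m s) = 0 :=
  Lp.ext (((eulerLagrange_eq κ α β (lam s) (h.pd_zero hs)).symm.trans (h.solution s hs)).trans
    (Lp.coeFn_zero _ _ _).symm)

lemma IsHelicalBranch.equation_smul (h : IsHelicalBranch κ α β τ δ m lam) {s : ℝ}
    (hs : s ∈ Ioo (-δ) δ) (hs0 : s ≠ 0) :
    linPart κ β (lam0 κ β) τ (s⁻¹ • m s)
      = (lam0 κ β - lam s) • fld (s⁻¹ • m s) - (s ^ 2 * α) • cub (s⁻¹ • m s) := by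
  have h1 := h.equation hs
  rw [linPart_eq_add κ β (lam s) (lam0 κ β)] at h1
  have h2 : linPart κ β (lam0 κ β) τ (m s) = (lam0 κ β - lam s) • fld (m s) - α • cub (m s) := by
    rw [← sub_eq_zero, ← h1]; module
  rw [map_smul, h2, cub_smul, fld_smul, smul_sub, smul_smul,
    smul_smul, smul_smul, smul_smul]
  congr 2
  · ring
  · field_simp

/-- The quotient converges in $H^2_\Lambda$ to the derivative of the branch at $0$. Passing to the
limit in the rescaled equation puts this derivative in the kernel of the linear part, and the two
inner products with $\varphi_1$ and $\varphi_2$ identify it. -/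
theorem IsHelicalBranch.tendsto (h : IsHelicalBranch κ α β τ δ m lam) (adm : Admissible κ β τ) :
    Filter.Tendsto (fun s => s⁻¹ • m s) (𝓝[≠] 0) (𝓝 (phi1 κ β τ)) := by
  have hd : HasDerivAt m (deriv m 0) 0 := (h.analytic_m 0 h.mem).differentiableAt.hasDerivAt
  have hz := hasDerivAt_iff_tendsto_slope_zero.1 hd
  simp only [zero_add, h.m_zero, sub_zero] at hz
  generalize deriv m 0 = m1 at hz
  suffices e : m1 = phi1 κ β τ by rwa [e] at hz
  have hlam : Filter.Tendsto lam (𝓝[≠] 0) (𝓝 (lam0 κ β)) := by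
    have := (h.analytic_lam 0 h.mem).continuousAt.tendsto
    rw [h.lam_zero] at this
    exact this.mono_left nhdsWithin_le_nhds
  have hs : Filter.Tendsto (fun s : ℝ => s) (𝓝[≠] 0) (𝓝 0) :=
    Filter.tendsto_id.mono_left nhdsWithin_le_nhds
  have hfld : Filter.Tendsto (fun s => fld (s⁻¹ • m s)) (𝓝[≠] 0) (𝓝 (fld m1)) :=
    ((fldL τ).continuous.tendsto m1).comp hz
  have hcub : Filter.Tendsto (fun s => cub (s⁻¹ • m s)) (𝓝[≠] 0) (𝓝 (cub m1)) :=
    ((contDiff_cub τ).continuous.tendsto m1).comp hz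
  have hlin : linPart κ β (lam0 κ β) τ m1 = 0 := by
    refine tendsto_nhds_unique (((linPart κ β (lam0 κ β) τ).continuous.tendsto m1).comp hz) ?_
    have h0 : Filter.Tendsto (fun s => (lam0 κ β - lam s) • fld (s⁻¹ • m s)
        - (s ^ 2 * α) • cub (s⁻¹ • m s)) (𝓝[≠] 0)
        (𝓝 ((lam0 κ β - lam0 κ β) • fld m1 - ((0 : ℝ) ^ 2 * α) • cub m1)) :=
      ((tendsto_const_nhds.sub hlam).smul hfld).sub (((hs.pow 2).mul_const α).smul hcub)
    simp only [sub_self, zero_smul, ne_eq, OfNat.ofNat_ne_zero, not_false_eq_true, zero_pow,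
      zero_mul] at h0
    refine h0.congr' ?_
    filter_upwards [h.eventually_mem] with s hs
    exact (h.equation_smul hs.1 hs.2).symm
  have h1 : inner ℝ (fld (phi1 κ β τ)) (fld m1) = 1 := by
    refine tendsto_nhds_unique (tendsto_const_nhds.inner hfld) (tendsto_const_nhds.congr' ?_)
    filter_upwards [h.eventually_mem] with s hs
    rw [fld_smul, real_inner_smul_right, h.inner_phi1 hs.1,
      inv_mul_cancel₀ hs.2]
  have h2 : inner ℝ (fld (phi2 κ β τ)) (fld m1) = 0 := by
    refine tendsto_nhds_unique (tendsto_const_nhds.inner hfld) (tendsto_const_nhds.congr' ?_)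
    filter_upwards [h.eventually_mem] with s hs
    rw [fld_smul, real_inner_smul_right, h.inner_phi2 hs.1,
      mul_zero]
  exact adm.eq_phi1 hlin h1 h2

/-- Pair the rescaled equation with $\varphi_1$: the linear part drops out by symmetry, and $\langle
s^{-1}m_s,\varphi_1\rangle=1$. The formula is exact, so no expansion of $\lambda_s$ is required. -/
lemma IsHelicalBranch.lam_sub (h : IsHelicalBranch κ α β τ δ m lam) (adm : Admissible κ β τ)
    {s : ℝ} (hs : s ∈ Ioo (-δ) δ) (hs0 : s ≠ 0) :
    lam s - lam0 κ β = -(s ^ 2 * (α * inner ℝ (cub (s⁻¹ • m s)) (fld (phi1 κ β τ)))) := by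
  have h1 := congrArg (fun u => inner ℝ u (fld (phi1 κ β τ))) (h.equation_smul hs hs0)
  beta_reduce at h1
  rw [inner_linPart_comm, linPart_phi1 β adm.kappa_pos, inner_zero_right,
    inner_sub_left, real_inner_smul_left, real_inner_smul_left, fld_smul,
    real_inner_smul_left, real_inner_comm, h.inner_phi1 hs,
    inv_mul_cancel₀ hs0] at h1
  linarith

lemma IsHelicalBranch.linearization (h : IsHelicalBranch κ α β τ δ m lam)
    (adm : Admissible κ β τ) {s : ℝ} (hs : s ∈ Ioo (-δ) δ) (hs0 : s ≠ 0) (φ : H2 τ) :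
    linOp κ α β (lam s) (m s) φ
      = linPart κ β (lam0 κ β) τ φ + s ^ 2 • secondVar κ α β (s⁻¹ • m s) (fld φ) := by
  have e : dcub (m s) (fld φ) = s ^ 2 • dcub (s⁻¹ • m s) (fld φ) := by
    rw [← dcub_smul, smul_smul, mul_inv_cancel₀ hs0, one_smul]
  rw [linOp_apply, linPart_eq_add κ β (lam s) (lam0 κ β), h.lam_sub adm hs hs0, e]
  simp only [secondVar, sub_apply, smul_apply,
    ContinuousLinearMap.id_apply]
  module

end Branch

/-! ### Positivity of the perturbed quadratic form and stability -/

lemma quadratic_lower_bound {c q M s a r X P : ℝ} (hq : 0 < q)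
    (hs : s ^ 2 * (M + 2 * M ^ 2 / q) ≤ c / 2) (hP : c * r ^ 2 ≤ P)
    (hX : a ^ 2 * q - 2 * M * |a| * r - M * r ^ 2 ≤ X) :
    s ^ 2 * (q / 2) * a ^ 2 + c / 2 * r ^ 2 ≤ P + s ^ 2 * X := by
  -- Young's inequality gives up half of $q$ in the $a$-direction; the price $2M^2/q$ in the
  -- $r$-direction carries a factor $s^2$ and is paid from half of the gap $c$.
  have h1 : 2 * M * |a| * r ≤ q / 2 * a ^ 2 + 2 * M ^ 2 / q * r ^ 2 := by
    have : 0 ≤ q / 2 * (|a| - 2 * M / q * r) ^ 2 := by positivity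
    have e : q / 2 * (|a| - 2 * M / q * r) ^ 2
        = q / 2 * |a| ^ 2 - 2 * M * |a| * r + 2 * M ^ 2 / q * r ^ 2 := by
      field_simp
      ring
    rw [e, sq_abs] at this
    linarith
  have h2 : a ^ 2 * (q / 2) - (M + 2 * M ^ 2 / q) * r ^ 2 ≤ X := by linarith
  have h3 := mul_le_mul_of_nonneg_left h2 (sq_nonneg s)
  have h4 := mul_le_mul_of_nonneg_right hs (sq_nonneg r)
  linarith

lemma inner_add_lower_bound {E : Type*} [NormedAddCommGroup E] [InnerProductSpace ℝ E]
    {B : E →L[ℝ] E} {M q : ℝ} {f : E} (hM : ‖B‖ ≤ M) (hq : q ≤ inner ℝ (B f) f) (hf : ‖f‖ = 1)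
    (a : ℝ) (w : E) : a ^ 2 * q - 2 * M * |a| * ‖w‖ - M * ‖w‖ ^ 2
      ≤ inner ℝ (B (a • f + w)) (a • f + w) := by
  have hBn : ∀ u v, |inner ℝ (B u) v| ≤ M * ‖u‖ * ‖v‖ := fun u v =>
    (abs_real_inner_le_norm _ _).trans (mul_le_mul_of_nonneg_right
      (B.le_of_opNorm_le hM u) (norm_nonneg _))
  have e : inner ℝ (B (a • f + w)) (a • f + w) = a ^ 2 * inner ℝ (B f) f + a * inner ℝ (B f) w
      + a * inner ℝ (B w) f + inner ℝ (B w) w := by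
    simp only [map_add, map_smul, inner_add_left, inner_add_right, real_inner_smul_left,
      real_inner_smul_right]
    ring
  have b1 : |a * inner ℝ (B f) w| ≤ M * |a| * ‖w‖ := by
    rw [abs_mul]
    have := mul_le_mul_of_nonneg_left (hBn f w) (abs_nonneg a)
    rw [hf] at this
    linarith
  have b2 : |a * inner ℝ (B w) f| ≤ M * |a| * ‖w‖ := by
    rw [abs_mul]
    have := mul_le_mul_of_nonneg_left (hBn w f) (abs_nonneg a)
    rw [hf] at this
    linarith
  have b3 := (abs_le.1 (hBn w w)).1
  have b4 := mul_le_mul_of_nonneg_left hq (sq_nonneg a)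
  rw [e]
  linarith [(abs_le.1 b1).1, (abs_le.1 b2).1]

theorem IsHelicalBranch.stable {κ α β δ : ℝ} {τ : ℂ} {m : ℝ → H2 τ} {lam : ℝ → ℝ}
    [Fact (0 < τ.im)] (h : IsHelicalBranch κ α β τ δ m lam) (adm : Admissible κ β τ)
    (hα : 0 < α) : ∃ δ' : ℝ, 0 < δ' ∧ δ' ≤ δ ∧ ∀ s ∈ Ioo (-δ') δ', s ≠ 0 →
      LinearizationNonneg κ α β (lam s) (m s) ∧
      linearizationKer κ α β (lam s) (m s) = (Submodule.span ℝ {pd (m s) 1} : Set (L2 τ)) := by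
  obtain ⟨c, hc, hco⟩ := adm.exists_coercive
  have hz := h.tendsto adm
  obtain ⟨Q, hQ⟩ : ∃ Q : ℝ, Q = inner ℝ (cub (phi1 κ β τ)) (fld (phi1 κ β τ)) := ⟨_, rfl⟩
  have hQ1 : 1 ≤ Q := hQ ▸ one_le_inner_cub_phi1 κ β τ
  obtain ⟨q, hq⟩ : ∃ q : ℝ, q = α * Q := ⟨_, rfl⟩
  have hq0 : 0 < q := by rw [hq]; positivity
  -- $M$ lies strictly above the limit norm and $q$ strictly below the limit value $2q$ of the form
  -- at $\varphi_1$, so both bounds hold for all small $s\ne0$.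
  obtain ⟨M, hM⟩ : ∃ M : ℝ, M = ‖secondVar κ α β (phi1 κ β τ)‖ + 1 := ⟨_, rfl⟩

  have hB : Filter.Tendsto (fun s => secondVar κ α β (s⁻¹ • m s)) (𝓝[≠] 0)
      (𝓝 (secondVar κ α β (phi1 κ β τ))) :=
    ((continuous_secondVar κ α β τ).tendsto _).comp hz
  have ev1 : ∀ᶠ s in 𝓝[≠] (0 : ℝ), ‖secondVar κ α β (s⁻¹ • m s)‖ < M :=
    hB.norm.eventually (gt_mem_nhds (by rw [hM]; linarith))
  have ev2 : ∀ᶠ s in 𝓝[≠] (0 : ℝ), q < inner ℝ (secondVar κ α β (s⁻¹ • m s) (fld (phi1 κ β τ)))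
      (fld (phi1 κ β τ)) := by
    have : Filter.Tendsto (fun s => inner ℝ (secondVar κ α β (s⁻¹ • m s) (fld (phi1 κ β τ)))
      (fld (phi1 κ β τ))) (𝓝[≠] 0) (𝓝 (inner ℝ (secondVar κ α β (phi1 κ β τ) (fld (phi1 κ β τ)))
      (fld (phi1 κ β τ)))) := Filter.Tendsto.inner (((ContinuousLinearMap.apply ℝ (L2 τ)
        (fld (phi1 κ β τ))).continuous.tendsto _).comp hB) tendsto_const_nhds
    rw [inner_secondVar_phi1, ← hQ, ← hq] at this
    exact this.eventually (lt_mem_nhds (by linarith))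
  -- $\partial_2m_s/s\to\partial_2\varphi_1=\varphi_2$, a unit vector, so the translation mode is
  -- transversal to the orthogonal complement of $\varphi_2$.
  have ev3 : ∀ᶠ s in 𝓝[≠] (0 : ℝ), inner ℝ (fld (phi2 κ β τ)) (pd (s⁻¹ • m s) 1) ≠ 0 := by
    have : Filter.Tendsto (fun s => inner ℝ (fld (phi2 κ β τ)) (pd (s⁻¹ • m s) 1)) (𝓝[≠] 0)
        (𝓝 (inner ℝ (fld (phi2 κ β τ)) (pd (phi1 κ β τ) 1))) :=
      tendsto_const_nhds.inner (((pdL τ 1).continuous.tendsto _).comp hz)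
    rw [pd_phi1_one, inner_phi2_phi2] at this
    exact this.eventually_ne one_ne_zero
  have ev4 : ∀ᶠ s in 𝓝[≠] (0 : ℝ), s ^ 2 * (M + 2 * M ^ 2 / q) < c / 2 := by
    have : Filter.Tendsto (fun s : ℝ => s ^ 2 * (M + 2 * M ^ 2 / q)) (𝓝 0)
        (𝓝 ((0 : ℝ) ^ 2 * (M + 2 * M ^ 2 / q))) := Continuous.tendsto (by fun_prop) _
    refine nhdsWithin_le_nhds (this.eventually (gt_mem_nhds ?_))
    simpa using hc
  have ev : ∀ᶠ s in 𝓝[≠] (0 : ℝ), LinearizationNonneg κ α β (lam s) (m s) ∧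
      linearizationKer κ α β (lam s) (m s) = (Submodule.span ℝ {pd (m s) 1} : Set (L2 τ)) := by
    filter_upwards [ev1, ev2, ev3, ev4, h.eventually_mem] with s h1 h2 h3 h4 hs
    have hs2 : 0 < s ^ 2 := by have := hs.2; positivity
    refine stable_of_positive (ε := min (s ^ 2 * (q / 2)) (c / 2)) (h.pd_zero hs.1) ?_
      (h.equation hs.1) (by positivity) fun a w hw1 hw2 => ?_
    · rw [pd_smul, real_inner_smul_right] at h3
      exact right_ne_zero_of_mul h3
    · have e2 := inner_add_lower_bound h1.le h2.le (norm_phi1 κ β τ) a (fld w)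
      rw [h.linearization adm hs.1 hs.2, adm.inner_linPart_add, fld_add, fld_smul,
        real_inner_smul_left]
      refine le_trans ?_ (quadratic_lower_bound hq0 h4.le (hco w hw1 hw2) e2)
      rw [mul_add]
      exact add_le_add (mul_le_mul_of_nonneg_right (min_le_left _ _) (sq_nonneg _))
        (mul_le_mul_of_nonneg_right (min_le_right _ _) (sq_nonneg _))
  obtain ⟨ε, hε, hball⟩ := Metric.eventually_nhds_iff.1 (eventually_nhdsWithin_iff.1 ev)
  refine ⟨min ε δ, lt_min hε h.pos, min_le_right _ _, fun s hs hs0 => hball ?_ hs0⟩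
  rw [Real.dist_eq, sub_zero]
  exact (abs_lt.2 hs).trans_le (min_le_left _ _)

/-! ### Invariance of the helical fields under the nonlinear operator -/

lemma spinFlip_spinFlip (w : Spin) : spinFlip (spinFlip w) = w := by
  ext j; fin_cases j <;> simp [spinFlip_apply]

lemma norm_spinFlip (w : Spin) : ‖spinFlip w‖ = ‖w‖ := by
  simp [spinFlip_apply, EuclideanSpace.norm_eq, Fin.sum_univ_three]

lemma mode_neg {τ : ℂ} {n : Fin 2 → ℤ} {a b : Spin} (ha : spinFlip a = a) (hb : spinFlip b = -b)
    (x : Plane) : mode τ n a b (-x) = spinFlip (mode τ n a b x) := by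
  simp [mode, ha, hb]

lemma isHelicallySymmetric_of_forall {τ : ℂ} {u : L2 τ} {f : Plane → Spin} (hp : IsPeriodic τ f)
    (hu : f =ᵐ[cellMeasure τ] u) (hx : IsXInvariant f) (hf : ∀ x, f (-x) = spinFlip (f x)) :
    IsHelicallySymmetric u := by
  refine ⟨f, hp, hu, fun t => Filter.Eventually.of_forall fun x => ?_,
    Filter.Eventually.of_forall fun x => ?_⟩
  · have := hx (-t) x
    rwa [neg_smul, ← sub_eq_add_neg] at this
  · change spinFlip (f (-x)) = f x
    rw [hf, spinFlip_spinFlip]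

lemma toL2_mode_mem_helical {τ : ℂ} [Fact (0 < τ.im)] {n : Fin 2 → ℤ} {a b : Spin}
    (h : waveVec τ n 0 = 0 ∨ (a = 0 ∧ b = 0)) (ha : spinFlip a = a) (hb : spinFlip b = -b) :
    toL2 τ (mode τ n a b) ∈ helical τ :=
  (isHelicallySymmetric_of_forall (isPeriodic_mode τ n a b)
    (coeFn_toL2 τ (continuous_mode τ n a b)).symm (isXInvariant_mode h) (mode_neg ha hb)).mem_helical

lemma fld_phi1_mem_helical (κ β : ℝ) (τ : ℂ) [Fact (0 < τ.im)] :
    fld (phi1 κ β τ) ∈ helical τ := by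
  refine toL2_mode_mem_helical (Or.inl (by simp [waveVec])) ?_ ?_
  · ext j; fin_cases j <;> simp [spinFlip_apply, helCos]
  · ext j; fin_cases j <;> simp [spinFlip_apply, helSin]

lemma hasSum_rep {τ : ℂ} [Fact (0 < τ.im)] (m : H2 τ) (x : Plane) (i : Fin 3) :
    HasSum (fun k : ℤ => mode τ ![0, k] (cosCoeff τ ![0, k] (fld m))
      (sinCoeff τ ![0, k] (fld m)) x i) (rep m x i) := by
  have := (BoundedContinuousFunction.evalCLM ℝ x).hasSum (hasSum_toBCF τ i m)
  exact this.congr_fun fun k => (modeB_apply τ i k m x).symm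

lemma isPeriodic_rep {τ : ℂ} [Fact (0 < τ.im)] (m : H2 τ) : IsPeriodic τ (rep m) := by
  intro u hu x
  ext i
  refine (hasSum_rep m (x + u) i).unique ((hasSum_rep m x i).congr_fun fun k => ?_)
  rw [isPeriodic_mode τ _ _ _ u hu x]

lemma isXInvariant_rep {τ : ℂ} [Fact (0 < τ.im)] (m : H2 τ) : IsXInvariant (rep m) := by
  intro t x
  ext i
  refine (hasSum_rep m _ i).unique ((hasSum_rep m x i).congr_fun fun k => ?_)
  rw [isXInvariant_mode (Or.inl (by simp [waveVec])) t x]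

lemma rep_neg {τ : ℂ} [Fact (0 < τ.im)] {m : H2 τ} (hm : fld m ∈ helical τ) (x : Plane) :
    rep m (-x) = spinFlip (rep m x) := by
  have hσ : ∀ (w : Spin) (i : Fin 3), spinFlip w i = (![-1, -1, 1] : Fin 3 → ℝ) i * w i :=
    fun w i => by fin_cases i <;> simp [spinFlip_apply]
  ext i
  rw [hσ]
  refine (hasSum_rep m (-x) i).unique (((hasSum_rep m x i).mul_left _).congr_fun fun k => ?_)
  rw [mode_neg (mem_helical.1 hm _).2.1 (mem_helical.1 hm _).2.2, hσ]

/-- The converse passage from coefficients to symmetry of the field: the continuous representative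
has all the invariances pointwise, since each of its modes does. -/
lemma isHelicallySymmetric_fld {τ : ℂ} [Fact (0 < τ.im)] {m : H2 τ} (hm : fld m ∈ helical τ) :
    IsHelicallySymmetric (fld m) :=
  isHelicallySymmetric_of_forall (isPeriodic_rep m) (fld_eq_rep (pd_zero_of_mem_helical hm)).symm
    (isXInvariant_rep m) (rep_neg hm)

lemma cub_mem_helical {τ : ℂ} [Fact (0 < τ.im)] {m : H2 τ} (hm : fld m ∈ helical τ) :
    cub m ∈ helical τ := by
  refine (isHelicallySymmetric_of_forall (f := fun x => ‖rep m x‖ ^ 2 • rep m x) ?_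
    (coeFn_cub m).symm ?_ ?_).mem_helical
  · intro u hu x
    simp only [isPeriodic_rep m u hu x]
  · intro t x
    simp only [isXInvariant_rep m t x]
  · intro x
    simp only [rep_neg hm x, norm_spinFlip, map_smul]

lemma linPart_mem_helical (κ β lam : ℝ) {τ : ℂ} [Fact (0 < τ.im)] {m : H2 τ}
    (hm : fld m ∈ helical τ) : linPart κ β lam τ m ∈ helical τ := by
  refine mem_helical.2 fun n => ?_
  obtain ⟨⟨h1, h2⟩, h3, h4⟩ := mem_helical.1 hm n
  -- The flip anticommutes with $v\times\cdot$ for $v$ along $e_2$. This sign compensates the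
  -- exchange of the even cosine and odd sine coefficients by the curl.
  have hc : ∀ w : Spin, waveVec τ n 0 • w = 0 →
      spinFlip (curlSymbol (waveVec τ n) w) = -curlSymbol (waveVec τ n) (spinFlip w) := by
    intro w hw
    have hw' : ∀ j, waveVec τ n 0 * w j = 0 := fun j => congrArg (fun v : Spin => v j) hw
    ext j
    fin_cases j <;> simp [spinFlip_apply, curlSymbol_apply]
    have := hw' 1
    linarith
  have ht : ∀ w : Spin, spinFlip (thirdProj w) = thirdProj (spinFlip w) := by
    intro w
    ext j
    fin_cases j <;> simp [spinFlip_apply, thirdProj_apply]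
  rw [cosCoeff_linPart, sinCoeff_linPart]
  generalize cosCoeff τ n (fld m) = C at *
  generalize sinCoeff τ n (fld m) = S at *
  refine ⟨⟨?_, ?_⟩, ?_, ?_⟩
  · simp only [smul_add, smul_comm (waveVec τ n 0), h1, ← map_smul, h2, map_zero, smul_zero,
      add_zero]
  · simp only [smul_add, smul_sub, smul_comm (waveVec τ n 0), h1, ← map_smul, h2, map_zero,
      smul_zero, add_zero, sub_zero]
  · simp only [map_add, map_smul, hc _ h2, ht, h3, h4, map_neg, neg_neg]
  · simp only [map_add, map_sub, map_smul, hc _ h1, ht, h3, h4, map_neg]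
    module

/-! ### The elliptic estimate -/

/-- Integration by parts, carried out on the Fourier side, followed by Cauchy–Schwarz. -/
lemma norm_pd_sq_le {τ : ℂ} [Fact (0 < τ.im)] (m : H2 τ) (i : Fin 2) :
    ‖pd m i‖ ^ 2 ≤ ‖pdd m i i‖ * ‖fld m‖ := by
  have h : inner ℝ (pd m i) (pd m i) = -inner ℝ (pdd m i i) (fld m) := by
    refine (hasSum_inner τ _ _).unique ((hasSum_inner τ _ _).neg.congr_fun fun n => ?_)
    rw [cosCoeff_pdd, sinCoeff_pdd, (isWeakDeriv_pd m i).cosCoeff_eq,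
      (isWeakDeriv_pd m i).sinCoeff_eq]
    simp only [inner_neg_left, inner_neg_right, real_inner_smul_left, real_inner_smul_right]
    ring
  rw [← real_inner_self_eq_norm_sq, h]
  exact (neg_le_abs _).trans (abs_real_inner_le_norm _ _)

/-- For $\partial_1m=0$ only $\partial_2^2m$ is of top order and the operator can be solved for it.
The first-order curl term is interpolated between $\partial_2^2m$ and $m$ and half of
$\|\partial_2^2m\|$ is absorbed. -/
lemma exists_norm_le_linPart (κ β lam : ℝ) (τ : ℂ) [Fact (0 < τ.im)] : ∃ K : ℝ, 0 ≤ K ∧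
    ∀ m : H2 τ, pd m 0 = 0 → ‖m‖ ≤ K * (‖linPart κ β lam τ m‖ + ‖fld m‖) := by
  obtain ⟨P, hP⟩ : ∃ P : ℝ, P = ‖(2 * κ) • pointwise τ (curlMat 1)‖ := ⟨_, rfl⟩
  obtain ⟨R, hR⟩ : ∃ R : ℝ, R = |lam| + ‖β • pointwise τ thirdProj‖ := ⟨_, rfl⟩
  have hP0 : 0 ≤ P := hP ▸ norm_nonneg _
  have hR0 : 0 ≤ R := hR ▸ add_nonneg (abs_nonneg _) (norm_nonneg _)
  refine ⟨2 + P ^ 2 + 2 * R + 1, by positivity, fun m hm => ?_⟩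
  have e : pdd m 1 1 = ((2 * κ) • pointwise τ (curlMat 1)) (pd m 1)
      + (lam • fld m + (β • pointwise τ thirdProj) (fld m)) - linPart κ β lam τ m := by
    rw [linPart_apply, hm, pdd_zero_eq_zero hm, map_zero, smul_apply, smul_apply]
    module
  have hD : ‖pdd m 1 1‖ ≤ P * ‖pd m 1‖ + R * ‖fld m‖ + ‖linPart κ β lam τ m‖ := by
    rw [e]
    refine (norm_sub_le _ _).trans (add_le_add_left ((norm_add_le _ _).trans
      (add_le_add ?_ ((norm_add_le _ _).trans ?_))) _)
    · rw [hP]; exact ContinuousLinearMap.le_opNorm _ _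
    · rw [hR, add_mul, norm_smul, Real.norm_eq_abs]
      exact add_le_add_right (ContinuousLinearMap.le_opNorm _ _) _
  have hd := norm_pd_sq_le m 1
  have hd0 := norm_nonneg (pd m 1)
  have hf0 := norm_nonneg (fld m)
  have hD0 := norm_nonneg (pdd m 1 1)
  have hl0 := norm_nonneg (linPart κ β lam τ m)
  have h10 := pdd_one_zero_eq_zero hm
  have h0j := pdd_zero_eq_zero hm
  generalize ‖linPart κ β lam τ m‖ = l at *
  have hf : ‖fld m‖ ≤ l + ‖fld m‖ := by linarith
  generalize hff : ‖fld m‖ = f at *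
  generalize hdd : ‖pd m 1‖ = d at *
  generalize hDD : ‖pdd m 1 1‖ = D at *
  have hPd : P * d ≤ D / 2 + P ^ 2 / 2 * f := by
    refine abs_le_of_sq_le_sq (a := P * d) ?_ (by positivity) |> fun h => (abs_le.1 h).2
    have : (P * d) ^ 2 ≤ P ^ 2 * (D * f) := by rw [mul_pow]; gcongr
    nlinarith [sq_nonneg (D / 2 - P ^ 2 / 2 * f)]
  have hd' : d ≤ D / 2 + f / 2 := by
    refine abs_le_of_sq_le_sq (a := d) ?_ (by positivity) |> fun h => (abs_le.1 h).2
    nlinarith [sq_nonneg (D / 2 - f / 2)]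
  have hPl : 0 ≤ P ^ 2 * l := by positivity
  have hPf : 0 ≤ P ^ 2 * f := by positivity
  have hRl : 0 ≤ R * l := by positivity
  have hRf : 0 ≤ R * f := by positivity
  have eK : (2 + P ^ 2 + 2 * R + 1) * (l + f)
      = 3 * l + 3 * f + P ^ 2 * l + P ^ 2 * f + 2 * (R * l) + 2 * (R * f) := by ring
  rw [eK]
  refine norm_le_of_forall m ?_ (fun i => ?_) (fun i j => ?_)
  · linarith
  · fin_cases i
    · rw [Fin.zero_eta, hm, norm_zero]; positivity
    · rw [Fin.mk_one, hdd]; linarith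
  · fin_cases i
    · rw [Fin.zero_eta, h0j, norm_zero]; positivity
    · fin_cases j
      · rw [Fin.mk_one, Fin.zero_eta, h10, norm_zero]; positivity
      · rw [Fin.mk_one, hDD]; linarith

/-! ### Analytic implicit functions from a priori estimates -/

/-- A lower bound closes the range, and a trivial orthogonal complement makes it dense. -/
lemma range_eq_top_of_bound {E F : Type*} [NormedAddCommGroup E] [NormedSpace ℝ E]
    [CompleteSpace E] [NormedAddCommGroup F] [InnerProductSpace ℝ F] [CompleteSpace F]
    {T : E →L[ℝ] F} {K : ℝ} (hK0 : 0 ≤ K) (hK : ∀ x, ‖x‖ ≤ K * ‖T x‖)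
    (hd : ∀ y, (∀ x, inner ℝ (T x) y = 0) → y = 0) : T.range = ⊤ := by
  have hanti : AntilipschitzWith ⟨K, hK0⟩ T := T.antilipschitz_of_bound hK
  have hcl : IsClosed (T.range : Set F) := hanti.isClosed_range T.uniformContinuous
  rw [← hcl.submodule_topologicalClosure_eq, Submodule.topologicalClosure_eq_top_iff,
    Submodule.eq_bot_iff]
  exact fun y hy => hd y fun x => hy _ ⟨x, rfl⟩

/-- The a priori bound and the trivial orthogonal complement make the partial derivative $T$ an
isomorphism, so the implicit function theorem applies in the class `ω`. -/
theorem exists_analytic_implicit {E F : Type*} [NormedAddCommGroup E] [NormedSpace ℝ E]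
    [CompleteSpace E] [NormedAddCommGroup F] [InnerProductSpace ℝ F] [CompleteSpace F]
    {T : E →L[ℝ] F} {K : ℝ} (hK0 : 0 ≤ K) (hK : ∀ x, ‖x‖ ≤ K * ‖T x‖)
    (hd : ∀ y, (∀ x, inner ℝ (T x) y = 0) → y = 0) {G : ℝ × E → F} (hG : ContDiff ℝ ω G)
    (hG0 : G 0 = 0) (hT : HasFDerivAt (fun x => G (0, x)) T 0) :
    ∃ (δ : ℝ) (ψ : ℝ → E), 0 < δ ∧ ψ 0 = 0 ∧ AnalyticOnNhd ℝ ψ (Ioo (-δ) δ) ∧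
      ∀ s ∈ Ioo (-δ) δ, G (s, ψ s) = 0 := by
  have hG' : ContDiffAt ℝ ω G 0 := hG.contDiffAt
  have hω : (ω : WithTop ℕ∞) ≠ 0 := by simp
  have hker : T.ker = ⊥ := by
    refine (Submodule.eq_bot_iff _).2 fun x hx => norm_le_zero_iff.1 ?_
    have := hK x
    rwa [show T x = 0 from hx, norm_zero, mul_zero] at this
  have hTG : fderiv ℝ G 0 ∘L .inr ℝ ℝ E = T := by
    have h1 : HasFDerivAt G (fderiv ℝ G 0) (ContinuousLinearMap.inr ℝ ℝ E 0) := by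
      rw [map_zero]
      exact (hG'.differentiableAt hω).hasFDerivAt
    exact (h1.comp 0 (ContinuousLinearMap.inr ℝ ℝ E).hasFDerivAt).unique hT
  have hinv : (fderiv ℝ G 0 ∘L .inr ℝ ℝ E).IsInvertible := by
    rw [hTG]
    exact ⟨ContinuousLinearEquiv.ofBijective T hker (range_eq_top_of_bound hK0 hK hd), rfl⟩
  have h1 := hG'.eventually_apply_implicitFunction hω hinv
  have h2 := (hG'.contDiffAt_implicitFunction hω hinv).analyticAt.eventually_analyticAt
  have h3 := hG'.implicitFunction_apply_self hω hinv
  obtain ⟨δ, hδ, hball⟩ := Metric.eventually_nhds_iff.1 (h1.and h2)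
  have hmem : ∀ s ∈ Ioo (-δ) δ, dist s (0 : ℝ × E).1 < δ := fun s hs => by
    rw [Prod.fst_zero, Real.dist_eq, sub_zero]
    exact abs_lt.2 hs
  exact ⟨δ, hG'.implicitFunction hω hinv, hδ, h3, fun s hs => (hball (hmem s hs)).2,
    fun s hs => ((hball (hmem s hs)).1).trans hG0⟩

/-- The map takes values in $Y$ and surjectivity is wanted only there. Composing with the orthogonal
projection onto $Y$ changes no value but makes $Y$ the target space. -/
theorem exists_analytic_implicit_mem {E H : Type*} [NormedAddCommGroup E] [NormedSpace ℝ E]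
    [CompleteSpace E] [NormedAddCommGroup H] [InnerProductSpace ℝ H] (Y : Submodule ℝ H)
    [CompleteSpace Y] {T : E →L[ℝ] H} (hTY : ∀ x, T x ∈ Y) {K : ℝ} (hK0 : 0 ≤ K)
    (hK : ∀ x, ‖x‖ ≤ K * ‖T x‖) (hd : ∀ y ∈ Y, (∀ x, inner ℝ (T x) y = 0) → y = 0)
    {G : ℝ × E → H} (hGY : ∀ p, G p ∈ Y) (hG : ContDiff ℝ ω G) (hG0 : G 0 = 0)
    (hT : HasFDerivAt (fun x => G (0, x)) T 0) :
    ∃ (δ : ℝ) (ψ : ℝ → E), 0 < δ ∧ ψ 0 = 0 ∧ AnalyticOnNhd ℝ ψ (Ioo (-δ) δ) ∧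
      ∀ s ∈ Ioo (-δ) δ, G (s, ψ s) = 0 := by
  have hQ : ∀ u ∈ Y, (Y.orthogonalProjectionOnto u : H) = u := fun u hu =>
    congrArg Subtype.val (Submodule.orthogonalProjectionOnto_mem_subspace_eq_self (⟨u, hu⟩ : Y))
  obtain ⟨δ, ψ, h1, h2, h3, h4⟩ := exists_analytic_implicit
    (T := Y.orthogonalProjectionOnto.comp T) (G := fun p => Y.orthogonalProjectionOnto (G p)) hK0
    (fun x => by
      rw [ContinuousLinearMap.comp_apply, Submodule.coe_norm, hQ _ (hTY x)]
      exact hK x)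
    (fun y hy => Subtype.ext (hd y y.2 fun x => by
      have := hy x
      rwa [ContinuousLinearMap.comp_apply, Submodule.coe_inner, hQ _ (hTY x)] at this))
    (Y.orthogonalProjectionOnto.contDiff.comp hG) (by rw [hG0, map_zero])
    (Y.orthogonalProjectionOnto.hasFDerivAt.comp 0 hT)
  refine ⟨δ, ψ, h1, h2, h3, fun s hs => ?_⟩
  rw [← hQ _ (hGY (s, ψ s)), h4 s hs, Submodule.coe_zero]

/-! ### The linearization at the bifurcation point -/

/-- The helically symmetric fields in `H²_Λ` orthogonal to `φ₁`. -/
def helicalCompl (κ β : ℝ) (τ : ℂ) [Fact (0 < τ.im)] : Submodule ℝ (H2 τ) :=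
  (helical τ).comap (fldL τ : H2 τ →ₗ[ℝ] L2 τ)
    ⊓ ((innerSL ℝ (fld (phi1 κ β τ))).comp (fldL τ)).ker

lemma mem_helicalCompl {κ β : ℝ} {τ : ℂ} [Fact (0 < τ.im)] {w : H2 τ} : w ∈ helicalCompl κ β τ ↔
    fld w ∈ helical τ ∧ inner ℝ (fld (phi1 κ β τ)) (fld w) = 0 := by
  simp [helicalCompl]

instance (κ β : ℝ) (τ : ℂ) [Fact (0 < τ.im)] : CompleteSpace (helicalCompl κ β τ) := by
  refine IsClosed.completeSpace_coe (hs := ?_)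
  exact ((isClosed_helical τ).preimage (fldL τ).continuous).inter
    (ContinuousLinearMap.isClosed_ker _)

instance (τ : ℂ) : CompleteSpace (helical τ) :=
  (isClosed_helical τ).completeSpace_coe

lemma max_le_of_estimates {c K f l w y ν : ℝ} (hc : 0 < c) (hK : 0 ≤ K)
    (hy : 0 ≤ y) (hf : c * f ≤ l) (hsq : y * y = l * l + ν * ν) (hw : w ≤ K * (l + f)) :
    max w ν ≤ max 1 (K * (1 + 1 / c)) * y := by
  have hly : l ≤ y := abs_le_of_sq_le_sq (by nlinarith) hy |> fun h => (abs_le.1 h).2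
  have hνy : ν ≤ y := abs_le_of_sq_le_sq (by nlinarith) hy |> fun h => (abs_le.1 h).2
  refine max_le ?_ ?_
  · refine hw.trans (le_trans ?_ (mul_le_mul_of_nonneg_right (le_max_right _ _) hy))
    rw [mul_assoc]
    refine mul_le_mul_of_nonneg_left ?_ hK
    have : f ≤ 1 / c * y := by
      rw [one_div, ← div_eq_inv_mul, le_div_iff₀ hc]
      linarith
    linarith
  · refine hνy.trans ?_
    have := mul_le_mul_of_nonneg_right (le_max_left 1 (K * (1 + 1 / c))) hy
    linarith

/-- By symmetry the range of the linear part is orthogonal to $\varphi_1$, so Pythagoras controls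
$\mu$ and the linear part separately. Coercivity then bounds $w$ in $L^2$ and the elliptic estimate
lifts this to $H^2$. The maximum is the product norm. -/
lemma Admissible.exists_norm_le {κ β : ℝ} {τ : ℂ} [Fact (0 < τ.im)] (adm : Admissible κ β τ) :
    ∃ K : ℝ, 0 ≤ K ∧ ∀ w ∈ helicalCompl κ β τ, ∀ μ : ℝ, max ‖w‖ ‖μ‖
      ≤ K * ‖linPart κ β (lam0 κ β) τ w + μ • fld (phi1 κ β τ)‖ := by
  obtain ⟨c, hc, hco⟩ := adm.exists_coercive
  obtain ⟨K, hK0, hK⟩ := exists_norm_le_linPart κ β (lam0 κ β) τ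
  refine ⟨max 1 (K * (1 + 1 / c)), by positivity, fun w hw μ => ?_⟩
  obtain ⟨hw1, hw2⟩ := mem_helicalCompl.1 hw
  have horth : inner ℝ (linPart κ β (lam0 κ β) τ w) (μ • fld (phi1 κ β τ)) = 0 := by
    rw [real_inner_smul_right, inner_linPart_comm, linPart_phi1 β adm.kappa_pos,
      inner_zero_right, mul_zero]
  have hsq := norm_add_sq_eq_norm_sq_add_norm_sq_of_inner_eq_zero _ _ horth
  have hmu : ‖μ • fld (phi1 κ β τ)‖ = ‖μ‖ := by rw [norm_smul, norm_phi1, mul_one]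
  rw [hmu] at hsq
  have hf : c * ‖fld w‖ ≤ ‖linPart κ β (lam0 κ β) τ w‖ := by
    by_cases h0 : ‖fld w‖ = 0
    · rw [h0, mul_zero]; exact norm_nonneg _
    · refine le_of_mul_le_mul_right ?_ ((norm_nonneg _).lt_of_ne' h0)
      have := (hco w hw2 (inner_phi2_of_mem_helical κ β hw1)).trans (real_inner_le_norm _ _)
      linarith
  have hw3 := hK w (pd_zero_of_mem_helical hw1)
  exact max_le_of_estimates hc hK0 (norm_nonneg _) hf hsq hw3

/-- Since $y$ is only in $L^2$, it is tested against its own Fourier modes, each corrected by a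
multiple of $\varphi_1$ that the linear part does not see. Every symbol form of $y$ then vanishes,
while $y$ is orthogonal to both critical modes, so modewise coercivity gives $y=0$. -/
lemma Admissible.eq_zero_of_orthogonal {κ β : ℝ} {τ : ℂ} [Fact (0 < τ.im)]
    (adm : Admissible κ β τ) {y : L2 τ} (hy : y ∈ helical τ)
    (h : ∀ w ∈ helicalCompl κ β τ, ∀ μ : ℝ,
      inner ℝ (linPart κ β (lam0 κ β) τ w + μ • fld (phi1 κ β τ)) y = 0) : y = 0 := by
  obtain ⟨c, hc, hle⟩ := adm.exists_le_symbolForm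
  have h1 : inner ℝ (fld (phi1 κ β τ)) y = 0 := by
    have := h 0 (Submodule.zero_mem _) 1
    rwa [map_zero, zero_add, one_smul] at this
  have hle' := hle y h1 (inner_phi2_of_mem_helical κ β hy)
  have key : ∀ n, cosCoeff τ n y = 0 ∧ sinCoeff τ n y = 0 := fun n => by
    obtain ⟨⟨hc1, hs1⟩, hc2, hs2⟩ := mem_helical.1 hy n
    obtain ⟨p, hp⟩ : ∃ p, p = modeH2 τ n (cosCoeff τ n y) (sinCoeff τ n y) := ⟨_, rfl⟩
    have hpm : fld p ∈ helical τ := by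
      rw [hp]
      refine toL2_mode_mem_helical ?_ hc2 hs2
      by_cases hn : waveVec τ n 0 = 0
      · exact Or.inl hn
      · exact Or.inr ⟨(smul_eq_zero.1 hc1).resolve_left hn, (smul_eq_zero.1 hs1).resolve_left hn⟩
    obtain ⟨a, ha⟩ : ∃ a : ℝ, a = inner ℝ (fld (phi1 κ β τ)) (fld p) := ⟨_, rfl⟩
    have hq : p - a • phi1 κ β τ ∈ helicalCompl κ β τ := by
      refine mem_helicalCompl.2 ⟨?_, ?_⟩
      · rw [fld_sub, fld_smul]
        exact Submodule.sub_mem _ hpm (Submodule.smul_mem _ _ (fld_phi1_mem_helical κ β τ))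
      · rw [fld_sub, fld_smul, inner_sub_right, real_inner_smul_right, inner_phi1_phi1, ha]
        ring
    have h2 := h _ hq 0
    have e : linPart κ β (lam0 κ β) τ (p - a • phi1 κ β τ) = linPart κ β (lam0 κ β) τ p := by
      refine ((linPart κ β (lam0 κ β) τ).map_sub p _).trans ?_
      refine (congrArg (_ - ·) (((linPart κ β (lam0 κ β) τ).map_smul a _).trans ?_)).trans
        (sub_zero _)
      rw [linPart_phi1 β adm.kappa_pos, smul_zero]
    rw [e, zero_smul, add_zero, hp, linPart_modeH2, inner_toL2_mode] at h2
    have h3 : symbolForm κ β (lam0 κ β) (waveVec τ n) (cosCoeff τ n y) (sinCoeff τ n y) = 0 := by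
      rw [← h2]
      simp only [curlSymbol_apply, thirdProj_apply, PiLp.inner_apply, Fin.sum_univ_three,
        symbolForm, EuclideanSpace.norm_sq_eq]
      simp
      ring
    have h4 := hle' n
    rw [h3] at h4
    have h5 := nonpos_of_mul_nonpos_right h4 hc
    have h6 := sq_nonneg ‖cosCoeff τ n y‖
    have h7 := sq_nonneg ‖sinCoeff τ n y‖
    constructor
    · exact norm_eq_zero.1 (pow_eq_zero_iff two_ne_zero |>.1 (by linarith))
    · exact norm_eq_zero.1 (pow_eq_zero_iff two_ne_zero |>.1 (by linarith))
  exact eq_of_coeff_eq (fun n => by rw [(key n).1, map_zero]) (fun n => by rw [(key n).2, map_zero])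

/-! ### Existence of the helical branch -/

/-- The bilinear term $\mu w$ of the bifurcation map is of second order at the origin. -/
lemma hasFDerivAt_add_smul {E F : Type*} [NormedAddCommGroup E] [NormedSpace ℝ E]
    [NormedAddCommGroup F] [NormedSpace ℝ F] (D : E × ℝ →L[ℝ] F) (A : E →L[ℝ] F) :
    HasFDerivAt (fun p : E × ℝ => D p + p.2 • A p.1) D 0 := by
  have h := ((ContinuousLinearMap.snd ℝ E ℝ).hasFDerivAt (x := 0)).smul
    ((A.comp (ContinuousLinearMap.fst ℝ E ℝ)).hasFDerivAt (x := 0))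
  refine (D.hasFDerivAt.add h).congr_fderiv ?_
  ext <;> simp

/-- The bifurcation equation, divided by `s`, for `m = s (φ₁ + w)` and `λ = λ₀ + μ`. -/
def bifurcationMap (κ α β : ℝ) (τ : ℂ) [Fact (0 < τ.im)] (s : ℝ) (w : H2 τ) (μ : ℝ) : L2 τ :=
  linPart κ β (lam0 κ β) τ w + μ • fld (phi1 κ β τ + w)
    + (s ^ 2 * α) • cub (phi1 κ β τ + w)

lemma bifurcationMap_mem_helical (κ α β : ℝ) {τ : ℂ} [Fact (0 < τ.im)] (s μ : ℝ) {w : H2 τ}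
    (hw : fld w ∈ helical τ) : bifurcationMap κ α β τ s w μ ∈ helical τ := by
  have h : fld (phi1 κ β τ + w) ∈ helical τ := by
    rw [fld_add]
    exact Submodule.add_mem _ (fld_phi1_mem_helical κ β τ) hw
  exact Submodule.add_mem _ (Submodule.add_mem _ (linPart_mem_helical _ _ _ hw)
    (Submodule.smul_mem _ _ h)) (Submodule.smul_mem _ _ (cub_mem_helical h))

lemma contDiff_bifurcationMap (κ α β : ℝ) {τ : ℂ} [Fact (0 < τ.im)] {X : Type*}
    [NormedAddCommGroup X] [NormedSpace ℝ X] {s μ : X → ℝ} {w : X → H2 τ} (hs : ContDiff ℝ ω s)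
    (hw : ContDiff ℝ ω w) (hμ : ContDiff ℝ ω μ) :
    ContDiff ℝ ω fun x => bifurcationMap κ α β τ (s x) (w x) (μ x) := by
  have h1 : ContDiff ℝ ω fun x => phi1 κ β τ + w x := contDiff_const.add hw
  exact (((linPart κ β (lam0 κ β) τ).contDiff.comp hw).add
    (hμ.smul ((fldL τ).contDiff.comp h1))).add
      (((hs.pow 2).mul contDiff_const).smul ((contDiff_cub τ).comp h1))

/-- The derivative of the bifurcation map with respect to `(w, μ)` at the origin. -/
def bifurcationDeriv (κ β : ℝ) (τ : ℂ) [Fact (0 < τ.im)] : H2 τ × ℝ →L[ℝ] L2 τ :=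
  (linPart κ β (lam0 κ β) τ).comp (ContinuousLinearMap.fst ℝ _ _)
    + (ContinuousLinearMap.snd ℝ _ _).smulRight (fld (phi1 κ β τ))

lemma bifurcationDeriv_apply (κ β : ℝ) {τ : ℂ} [Fact (0 < τ.im)] (p : H2 τ × ℝ) :
    bifurcationDeriv κ β τ p = linPart κ β (lam0 κ β) τ p.1 + p.2 • fld (phi1 κ β τ) := rfl

lemma bifurcationMap_zero_left (κ α β : ℝ) {τ : ℂ} [Fact (0 < τ.im)] (w : H2 τ) (μ : ℝ) :
    bifurcationMap κ α β τ 0 w μ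
      = linPart κ β (lam0 κ β) τ w + μ • fld (phi1 κ β τ + w) := by
  have h : (0 : ℝ) ^ 2 * α = 0 := by ring
  rw [bifurcationMap, h, zero_smul ℝ (cub (phi1 κ β τ + w)), add_zero]

lemma hasFDerivAt_bifurcationMap (κ α β : ℝ) (τ : ℂ) [Fact (0 < τ.im)] :
    HasFDerivAt (fun p : H2 τ × ℝ => bifurcationMap κ α β τ 0 p.1 p.2)
      (bifurcationDeriv κ β τ) 0 := by
  have e : (fun p : H2 τ × ℝ => bifurcationMap κ α β τ 0 p.1 p.2)
      = fun p => bifurcationDeriv κ β τ p + p.2 • fldL τ p.1 := by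
    funext p
    rw [bifurcationMap_zero_left, bifurcationDeriv_apply, fldL_apply, fld_add, smul_add, add_assoc]
  rw [e]
  exact hasFDerivAt_add_smul (bifurcationDeriv κ β τ) (fldL τ)

lemma bifurcationMap_zero (κ α β : ℝ) (τ : ℂ) [Fact (0 < τ.im)] :
    bifurcationMap κ α β τ 0 0 0 = 0 := by
  rw [bifurcationMap_zero_left, map_zero, zero_add]
  exact zero_smul ℝ _

lemma hasFDerivAt_bifurcationMap_comp (κ α β : ℝ) {τ : ℂ} [Fact (0 < τ.im)] {E : Type*}
    [NormedAddCommGroup E] [NormedSpace ℝ E] (ι : E →L[ℝ] H2 τ × ℝ) :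
    HasFDerivAt (fun x => bifurcationMap κ α β τ 0 (ι x).1 (ι x).2)
      ((bifurcationDeriv κ β τ).comp ι) 0 := by
  have h1 : HasFDerivAt (fun p : H2 τ × ℝ => bifurcationMap κ α β τ 0 p.1 p.2)
      (bifurcationDeriv κ β τ) (ι 0) := by
    rw [map_zero]; exact hasFDerivAt_bifurcationMap κ α β τ
  exact h1.comp 0 ι.hasFDerivAt

set_option maxHeartbeats 400000 in
-- The parameter space is kept abstract, known only through a norm-preserving embedding $\iota$ onto
-- the pairs $(w,\mu)$ with $w$ helical and orthogonal to $\varphi_1$.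
lemma exists_implicit_of_embedding {κ β : ℝ} {τ : ℂ} [Fact (0 < τ.im)] (adm : Admissible κ β τ)
    (α : ℝ) {E : Type*} [NormedAddCommGroup E] [NormedSpace ℝ E] [CompleteSpace E]
    {ι : E →L[ℝ] H2 τ × ℝ} (hι : ∀ x, (ι x).1 ∈ helicalCompl κ β τ)
    (hnorm : ∀ x, ‖x‖ = max ‖(ι x).1‖ ‖(ι x).2‖)
    (hsurj : ∀ w ∈ helicalCompl κ β τ, ∀ μ : ℝ, ∃ x, ι x = (w, μ)) :
    ∃ (δ : ℝ) (ψ : ℝ → E), 0 < δ ∧ ψ 0 = 0 ∧ AnalyticOnNhd ℝ ψ (Ioo (-δ) δ) ∧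
      ∀ s ∈ Ioo (-δ) δ, bifurcationMap κ α β τ s (ι (ψ s)).1 (ι (ψ s)).2 = 0 := by
  obtain ⟨K, hK0, hK⟩ := adm.exists_norm_le
  have hD : ∀ x, (bifurcationDeriv κ β τ).comp ι x ∈ helical τ := fun x => by
    rw [ContinuousLinearMap.comp_apply, bifurcationDeriv_apply]
    exact Submodule.add_mem _ (linPart_mem_helical _ _ _ (mem_helicalCompl.1 (hι x)).1)
      (Submodule.smul_mem _ _ (fld_phi1_mem_helical κ β τ))
  have hT : ∀ x, ‖x‖ ≤ K * ‖(bifurcationDeriv κ β τ).comp ι x‖ := fun x => by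
    rw [hnorm, ContinuousLinearMap.comp_apply, bifurcationDeriv_apply]
    exact hK _ (hι x) _
  have hd : ∀ y ∈ helical τ, (∀ x, inner ℝ ((bifurcationDeriv κ β τ).comp ι x) y = 0) → y = 0 :=
    fun y hy h => adm.eq_zero_of_orthogonal hy fun w hw ν => by
      obtain ⟨x, hx⟩ := hsurj w hw ν
      have := h x
      rwa [ContinuousLinearMap.comp_apply, bifurcationDeriv_apply, hx] at this
  have hG0 : bifurcationMap κ α β τ (0 : ℝ × E).1 (ι (0 : ℝ × E).2).1 (ι (0 : ℝ × E).2).2 = 0 := by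
    rw [Prod.fst_zero, Prod.snd_zero, map_zero]
    exact bifurcationMap_zero κ α β τ
  have hι' : ContDiff ℝ ω fun p : ℝ × E => ι p.2 := ι.contDiff.comp contDiff_snd
  have hG := contDiff_bifurcationMap κ α β contDiff_fst hι'.fst hι'.snd
  have hGY : ∀ p : ℝ × E, bifurcationMap κ α β τ p.1 (ι p.2).1 (ι p.2).2 ∈ helical τ := fun p =>
    bifurcationMap_mem_helical κ α β _ _ (mem_helicalCompl.1 (hι p.2)).1
  exact exists_analytic_implicit_mem (helical τ) hD hK0 hT hd hGY hG hG0
    (hasFDerivAt_bifurcationMap_comp κ α β ι)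

/-- The inclusion of the pairs `(w, μ)` with `w` helically symmetric and orthogonal to `φ₁`. -/
def helicalIncl (κ β : ℝ) (τ : ℂ) [Fact (0 < τ.im)] :
    helicalCompl κ β τ × ℝ →L[ℝ] H2 τ × ℝ :=
  (helicalCompl κ β τ).subtypeL.prodMap (ContinuousLinearMap.id ℝ ℝ)

theorem Admissible.exists_bifurcationMap_eq_zero {κ β : ℝ} {τ : ℂ} [Fact (0 < τ.im)]
    (adm : Admissible κ β τ) (α : ℝ) : ∃ (δ : ℝ) (w : ℝ → H2 τ) (μ : ℝ → ℝ), 0 < δ ∧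
      AnalyticOnNhd ℝ w (Ioo (-δ) δ) ∧ AnalyticOnNhd ℝ μ (Ioo (-δ) δ) ∧ μ 0 = 0 ∧
      ∀ s ∈ Ioo (-δ) δ, w s ∈ helicalCompl κ β τ ∧ bifurcationMap κ α β τ s (w s) (μ s) = 0 := by
  obtain ⟨δ, ψ, hδ, hψ0, hψ, hsol⟩ := exists_implicit_of_embedding adm α
    (ι := helicalIncl κ β τ) (fun x : helicalCompl κ β τ × ℝ => x.1.2) (fun x => rfl) (fun w hw μ => ⟨(⟨w, hw⟩, μ), rfl⟩)
  have hψ1 : ∀ s ∈ Ioo (-δ) δ, AnalyticAt ℝ ((helicalCompl κ β τ).subtypeL ∘ fun s => (ψ s).1) s :=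
    fun s hs => (ContinuousLinearMap.analyticAt _ _).comp (analyticAt_fst.comp (hψ s hs))
  have hψ2 : ∀ s ∈ Ioo (-δ) δ, AnalyticAt ℝ (fun s => (ψ s).2) s := fun s hs =>
    analyticAt_snd.comp (hψ s hs)
  exact ⟨δ, fun s => ((ψ s).1 : H2 τ), fun s => (ψ s).2, hδ, hψ1, hψ2, congrArg Prod.snd hψ0,
    fun s hs => ⟨(ψ s).1.2, hsol s hs⟩⟩

/-- As the linear part at $\lambda_0$ annihilates $\varphi_1$, a factor $s$ comes out of the whole
equation; zeros of `bifurcationMap` are therefore solutions, also at $s=0$. -/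
lemma linPart_add_cub_eq {κ β : ℝ} {τ : ℂ} [Fact (0 < τ.im)] (adm : Admissible κ β τ) (α s : ℝ)
    (w : H2 τ) (μ : ℝ) : linPart κ β (lam0 κ β + μ) τ (s • (phi1 κ β τ + w))
      + α • cub (s • (phi1 κ β τ + w)) = s • bifurcationMap κ α β τ s w μ := by
  have e1 : linPart κ β (lam0 κ β) τ (s • (phi1 κ β τ + w))
      = s • linPart κ β (lam0 κ β) τ w := by
    refine ((linPart κ β (lam0 κ β) τ).map_smul s _).trans (congrArg (s • ·) ?_)
    refine ((linPart κ β (lam0 κ β) τ).map_add _ _).trans ?_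
    rw [linPart_phi1 β adm.kappa_pos, zero_add]
  rw [linPart_eq_add κ β _ (lam0 κ β), e1, cub_smul, fld_smul, bifurcationMap]
  generalize linPart κ β (lam0 κ β) τ w = a
  generalize cub (phi1 κ β τ + w) = b
  generalize fld (phi1 κ β τ + w) = c
  module

/-- The branch is $m_s=s(\varphi_1+w_s)$, $\lambda_s=\lambda_0+\mu_s$. Thus $\psi_s=sw_s$, and
orthogonality and symmetry are inherited from the subspace in which $w_s$ was sought. -/
theorem Admissible.exists_branch {κ β : ℝ} {τ : ℂ} [Fact (0 < τ.im)] (adm : Admissible κ β τ)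
    (α : ℝ) : ∃ (δ : ℝ) (m : ℝ → H2 τ) (lam : ℝ → ℝ), IsHelicalBranch κ α β τ δ m lam := by
  obtain ⟨δ, w, μ, hδ, hw, hμ, hμ0, h⟩ := adm.exists_bifurcationMap_eq_zero α
  have hfld : ∀ s ∈ Ioo (-δ) δ, fld (s • (phi1 κ β τ + w s)) ∈ helical τ := fun s hs => by
    rw [fld_smul, fld_add]
    exact Submodule.smul_mem _ _ (Submodule.add_mem _ (fld_phi1_mem_helical κ β τ)
      (mem_helicalCompl.1 (h s hs).1).1)
  refine ⟨δ, fun s => s • (phi1 κ β τ + w s), fun s => lam0 κ β + μ s, hδ, fun s hs => ?_,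
    fun s hs => analyticAt_const.add (hμ s hs), zero_smul _ _, ?_, fun s hs => ?_, fun s hs => ?_,
    fun s hs => isHelicallySymmetric_fld (hfld s hs)⟩
  · exact analyticAt_id.smul (analyticAt_const.add (hw s hs))
  · rw [hμ0, add_zero]
  · refine (eulerLagrange_eq κ α β _ (pd_zero_of_mem_helical (hfld s hs))).trans ?_
    have e := linPart_add_cub_eq adm α s (w s) (μ s)
    rw [e, (h s hs).2, smul_zero]
    exact Lp.coeFn_zero _ _ _
  · have e : (s • fld (w s) : L2 τ) =ᵐ[cellMeasure τ]
        fun x => fld (s • (phi1 κ β τ + w s)) x - s • helicalMode κ β x := by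
      have e2 : s • fld (w s) = fld (s • (phi1 κ β τ + w s)) - s • fld (phi1 κ β τ) := by
        rw [fld_smul, fld_add]; module
      rw [e2]
      filter_upwards [Lp.coeFn_sub (fld (s • (phi1 κ β τ + w s))) (s • fld (phi1 κ β τ)),
        Lp.coeFn_smul s (fld (phi1 κ β τ)), fld_phi1 κ β τ] with x h1 h2 h3
      rw [h1, Pi.sub_apply, h2, Pi.smul_apply, h3]
    rw [← inner_eq_integral e (fld_phi1 κ β τ), real_inner_smul_left, real_inner_comm,
      (mem_helicalCompl.1 (h s hs).1).2, mul_zero]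

end ChiralMagnet

end
theorem mainTheorem6 (κ α β : ℝ) (hκ : 0 < κ) (hα : 0 < α) (hβ : 0 ≤ β)
    (τ : ℂ) (hτ : ChiralMagnet.IsNonEquilateral τ)
    (hres : ChiralMagnet.NonResonant κ β τ)
    (hlam : 0 < ChiralMagnet.lam0 κ β)
    (hγ : 4 * κ ^ 2 ≤ Real.sqrt (4 * κ ^ 2 + β ^ 2 / 4)
      + Real.sqrt (4 * κ ^ 2 * ChiralMagnet.secondWaveNumber τ ^ 2 + β ^ 2 / 4)) :
    (∃ (δ : ℝ) (m : ℝ → ChiralMagnet.H2 τ) (lam : ℝ → ℝ),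
      ChiralMagnet.IsHelicalBranch κ α β τ δ m lam) ∧
    ∀ (δ : ℝ) (m : ℝ → ChiralMagnet.H2 τ) (lam : ℝ → ℝ),
      ChiralMagnet.IsHelicalBranch κ α β τ δ m lam →
      ∃ δ' : ℝ, 0 < δ' ∧ δ' ≤ δ ∧ ∀ s ∈ Set.Ioo (-δ') δ', s ≠ 0 →
        ChiralMagnet.LinearizationNonneg κ α β (lam s) (m s) ∧
        ChiralMagnet.linearizationKer κ α β (lam s) (m s)
          = (Submodule.span ℝ {ChiralMagnet.pd (m s) 1} : Set (ChiralMagnet.L2 τ)) := by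
  have : Fact (0 < τ.im) := ⟨hτ.1⟩
  have adm : ChiralMagnet.Admissible κ β τ := ⟨hκ, hβ, hτ, hres, hlam, hγ⟩
  exact ⟨adm.exists_branch α, fun δ m lam h => h.stable adm hα⟩
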